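/- Let $K$ be a field and let $E=(E^0,E^1,r,s)$ be a finite directed graph (finitely many vertices and edges; loops and parallel edges are allowed). Let $L=L_K(E)$ be its Leavitt path algebra: the $K$-algebra generated by pairwise orthogonal idempotents $v\in E^0$ together with $e,e^*$ ($e\in E^1$), subject to $s(e)e=e=er(e)$, $r(e)e^*=e^*=e^*s(e)$, $e^*e=r(e)$, $e^*f=0$ for edges $e\neq f$, and $v=\sum_{s(e)=v}ee^*$ for every vertex $v$ which emits an edge; its identity is $\sum_{v\in E^0}v$. It is $\mathbb Z$-graded, with $L_n$ spanned over $K$ by the elements $pq^*$, where $p,q$ are paths with the same range and $|p|-|q|=n$. A cycle is a closed path $e_1\cdots e_n$ ($n\ge 1$) whose vertices $s(e_1),\dots,s(e_n)$ are distinct; cycles which differ by a cyclic permutation of the edges are identified. An exit of it is an edge $f$ with $s(f)=s(e_i)$ and $f\ne e_i$ for some $i$. For each cycle $c$ fix a vertex $w_c$ on $c$. Then the following are equivalent. (a) $L$ is a graded $\Sigma$-$V$ ring: for every graded simple $L$-module $S$, every index set $I$ and all integers $\alpha_i$ $(i\in I)$, the direct sum $\bigoplus_{i\in I}S(\alpha_i)$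 of suspensions, where $S(\alpha)_n=S_{\alpha+n}$, is injective in the category of graded $L$-modules and degree-preserving homomorphisms. (The condition for left modules and the condition for right modules are both equivalent to the other statements.) (b) No cycle in $E$ has an exit. (c) $L$ is graded directly-finite with respect to the vertices: for every vertex $v$ and all homogeneous $x,y\in L$ with $xv=x=vx$ and $yv=y=vy$, $xy=v$ implies $yx=v$. Equivalently (also equivalent to the other statements), $L$ is directly-finite: for all $x,y\in L$, $xy=1$ implies $yx=1$. (d) There is an isomorphism of $\mathbb Z$-graded $K$-algebras $$L\;\cong_{\mathrm{gr}}\;\bigoplus_{v\in X}\mathbb M_{n_v}(K)(|p|)_{p\in P_v}\;\oplus\;\bigoplus_{c\in Y}\mathbb M_{m_c}(K[x^{|c|},x^{-|c|}])(|q|)_{q\in Q_c},$$ where $X$ is the finite set of sinks of $E$, $Y$ is the finite set of cycles of $E$, $P_v$ is the set of paths ending at $v$, $Q_c$ is the set of paths ending at $w_c$ which do not include all the edges of $c$ (vertices are paths of length $0$), and $n_v=|P_v|$ and $m_c=|Q_c|$ are positive integers (in particular finite). Here $K$ is concentrated in degree $0$, $x$ has degree $1$, and in $\mathbb M_n(R)(\delta_1,\dots,\delta_n)$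 the component of degree $\lambda$ consists of the matrices whose $(i,j)$ entry lies in $R_{\lambda+\delta_j-\delta_i}$. (e) $L$ is graded semisimple: $L$, as a module over itself, is a direct sum of finitely many graded submodules which are graded simple. (The left and the right condition are both equivalent to the other statements.) (f) $L$ has bounded index of nilpotence: there is an integer $n\ge 1$ with $x^n=0$ for every nilpotent $x\in L$. (g) $L$ is graded self-injective: $L$ is injective in the category of graded $L$-modules and degree-preserving homomorphisms. (The left and the right condition are both equivalent to the other statements.) -/

import Mathlib

open scoped LaurentPolynomial DirectSum

/-! ### Graded modules over a `ℤ`-graded ring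

A grading of an additive group `M` is a family `ℳ : ℤ → AddSubgroup M` of homogeneous components.
Modules are left modules; right modules over `R` are left modules over `Rᵐᵒᵖ`, which carries the
grading `opGrading 𝒜`.  All rings are unital, so all modules are unital. -/

section Graded

universe u

/-- The opposite ring, with the same homogeneous components. -/
def opGrading {R : Type u} [Ring R] (𝒜 : ℤ → AddSubgroup R) : ℤ → AddSubgroup Rᵐᵒᵖ :=
  fun n => (𝒜 n).map (MulOpposite.opAddEquiv : R ≃+ Rᵐᵒᵖ).toAddMonoidHom

/-- `M = ⨁ₙ ℳ n` (internal direct sum) and `𝒜 i • ℳ j ⊆ ℳ (i + j)`. -/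
structure IsGradedModule {R : Type u} [Ring R] (𝒜 : ℤ → AddSubgroup R)
    {M : Type u} [AddCommGroup M] [Module R M] (ℳ : ℤ → AddSubgroup M) : Prop where
  isInternal : DirectSum.IsInternal ℳ
  smul_mem : ∀ i j : ℤ, ∀ a ∈ 𝒜 i, ∀ m ∈ ℳ j, a • m ∈ ℳ (i + j)

/-- `N` is a graded submodule: it is the sum of the subgroups `N ∩ ℳ n`. -/
def IsGradedSubmodule {R : Type u} [Ring R]
    {M : Type u} [AddCommGroup M] [Module R M] (ℳ : ℤ → AddSubgroup M)
    (N : Submodule R M) : Prop :=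
  N.toAddSubgroup = ⨆ n : ℤ, N.toAddSubgroup ⊓ ℳ n

/-- The components of the grading induced on a submodule. -/
def inducedGrading {R : Type u} [Ring R]
    {M : Type u} [AddCommGroup M] [Module R M] (ℳ : ℤ → AddSubgroup M)
    (N : Submodule R M) : ℤ → AddSubgroup N :=
  fun n => (ℳ n).comap N.subtype.toAddMonoidHom

/-- A graded simple module: a nonzero graded module whose only graded submodules are `0` and
the whole module. -/
structure IsGradedSimple {R : Type u} [Ring R] (𝒜 : ℤ → AddSubgroup R)
    {M : Type u} [AddCommGroup M] [Module R M] (ℳ : ℤ → AddSubgroup M) : Prop where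
  isGraded : IsGradedModule 𝒜 ℳ
  nontrivial : Nontrivial M
  eq_bot_or_eq_top : ∀ N : Submodule R M, IsGradedSubmodule ℳ N → N = ⊥ ∨ N = ⊤

/-- Graded homomorphisms: linear maps which preserve degrees. -/
def IsGradedHom {R : Type u} [Ring R]
    {M N : Type u} [AddCommGroup M] [Module R M] [AddCommGroup N] [Module R N]
    (ℳ : ℤ → AddSubgroup M) (𝒩 : ℤ → AddSubgroup N) (f : M →ₗ[R] N) : Prop :=
  ∀ n : ℤ, ∀ m ∈ ℳ n, f m ∈ 𝒩 n

/-- A graded module `Q` is graded injective if it is an injective object in the category of graded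
modules and graded homomorphisms: graded homomorphisms into `Q` extend along injective graded
homomorphisms.  (By Baer's criterion it makes no difference that the test modules are taken in the
universe of `R`: the graded left ideals of `R`, with shifted gradings, suffice.) -/
def IsGradedInjective {R : Type u} [Ring R] (𝒜 : ℤ → AddSubgroup R)
    {Q : Type u} [AddCommGroup Q] [Module R Q] (𝒬 : ℤ → AddSubgroup Q) : Prop :=
  ∀ (M N : Type u) [AddCommGroup M] [Module R M] [AddCommGroup N] [Module R N]
    (ℳ : ℤ → AddSubgroup M) (𝒩 : ℤ → AddSubgroup N),
    IsGradedModule 𝒜 ℳ → IsGradedModule 𝒜 𝒩 →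
    ∀ (i : M →ₗ[R] N) (f : M →ₗ[R] Q), IsGradedHom ℳ 𝒩 i → Function.Injective i →
      IsGradedHom ℳ 𝒬 f →
      ∃ g : N →ₗ[R] Q, IsGradedHom 𝒩 𝒬 g ∧ g ∘ₗ i = f

/-- The grading of the direct sum `⨁_{i ∈ I} M(α i)` of suspensions of `M`, where
`M(α)ₙ = M_{α + n}`; the underlying module is `I →₀ M`. -/
def suspensionSumGrading {M : Type u} [AddCommGroup M] (ℳ : ℤ → AddSubgroup M)
    {I : Type u} (α : I → ℤ) : ℤ → AddSubgroup (I →₀ M) :=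
  fun n =>
    { carrier := {x | ∀ i, x i ∈ ℳ (α i + n)}
      zero_mem' := fun i => (ℳ (α i + n)).zero_mem
      add_mem' := fun hx hy i => (ℳ (α i + n)).add_mem (hx i) (hy i)
      neg_mem' := fun hx i => (ℳ (α i + n)).neg_mem (hx i) }

/-- Graded `Σ`-injective: every direct sum of suspensions of `M` is graded injective. -/
def IsGradedSigmaInjective {R : Type u} [Ring R] (𝒜 : ℤ → AddSubgroup R)
    {M : Type u} [AddCommGroup M] [Module R M] (ℳ : ℤ → AddSubgroup M) : Prop :=
  ∀ (I : Type u) (α : I → ℤ), IsGradedInjective 𝒜 (suspensionSumGrading ℳ α)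

/-- Graded left `Σ`-`V` ring: every graded simple left module is graded `Σ`-injective. -/
def IsGradedSigmaVRing {R : Type u} [Ring R] (𝒜 : ℤ → AddSubgroup R) : Prop :=
  ∀ (S : Type u) [AddCommGroup S] [Module R S] (𝒮 : ℤ → AddSubgroup S),
    IsGradedSimple 𝒜 𝒮 → IsGradedSigmaInjective 𝒜 𝒮

/-- Graded left semisimple ring: the left module `R` is the direct sum of finitely many graded
submodules, each of which is a graded simple module. -/
def IsGradedSemisimpleRing {R : Type u} [Ring R] (𝒜 : ℤ → AddSubgroup R) : Prop :=
  ∃ (k : ℕ) (S : Fin k → Submodule R R),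
    (∀ i, IsGradedSubmodule 𝒜 (S i) ∧ IsGradedSimple 𝒜 (inducedGrading 𝒜 (S i))) ∧
      DirectSum.IsInternal S

/-- Graded left self-injective ring. -/
def IsGradedSelfInjective {R : Type u} [Ring R] (𝒜 : ℤ → AddSubgroup R) : Prop :=
  IsGradedInjective (Q := R) 𝒜 𝒜

/-- `R` is graded directly-finite with respect to a set `S` of homogeneous idempotents: for every
`u ∈ S`, one-sided inverses of homogeneous elements of the corner ring `uRu` are two-sided. -/
def IsGradedDirectlyFinite {R : Type u} [Ring R] (𝒜 : ℤ → AddSubgroup R) (S : Set R) : Prop :=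
  ∀ u ∈ S, ∀ (m n : ℤ) (x y : R), x ∈ 𝒜 m → y ∈ 𝒜 n →
    x * u = x → u * x = x → y * u = y → u * y = y → x * y = u → y * x = u

/-- Bounded index of nilpotence. -/
def HasBoundedNilpotenceIndex (R : Type u) [Ring R] : Prop :=
  ∃ n : ℕ, 0 < n ∧ ∀ x : R, IsNilpotent x → x ^ n = 0

end Graded

/-! ### Directed graphs -/

universe uV uA uK

/-- A directed graph with vertex set `V` and edge set `A`; loops and parallel edges are allowed. -/
structure DirGraph (V : Type uV) (A : Type uA) where
  /-- source of an edge -/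
  s : A → V
  /-- range of an edge -/
  r : A → V

namespace DirGraph

variable {V : Type uV} {A : Type uA} (G : DirGraph V A)

/-- Consecutive edges of a path `e f`: the range of `e` is the source of `f`. -/
def Follows (e f : A) : Prop := G.r e = G.s f

/-- The paths ending at the vertex `v`, each given by its list of edges; the empty list is the path
`v` of length `0`. -/
def PathTo (v : V) : Type uA :=
  {p : List A // p.IsChain G.Follows ∧ ∀ e ∈ p.getLast?, G.r e = v}

/-- The sinks: vertices which emit no edges. -/
def Sinks : Type uV := {v : V // ∀ e : A, G.s e ≠ v}

/-- The cycles of the graph: nonempty closed paths `e₁ ⋯ eₙ` for which the vertices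
`s(e₁), …, s(eₙ)` are distinct.  Closed paths which differ by a cyclic permutation of
the edges are the same cycle. -/
def Cycles : Type uA :=
  {c : Cycle A // c ≠ Cycle.nil ∧ c.Chain G.Follows ∧ (c.map G.s).Nodup}

/-- No cycle has an exit: no edge other than the edge of the cycle starts at a vertex
of the cycle. -/
def NoCycleHasExit : Prop :=
  ∀ c : G.Cycles, ∀ e ∈ c.1, ∀ f : A, G.s f = G.s e → f = e

/-- The paths ending at `w` which do not include all the edges of the cycle `c`. -/
def CyclePathTo (c : G.Cycles) (w : V) : Type uA :=
  {p : G.PathTo w // ¬ ∀ e ∈ c.1, e ∈ p.1}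

end DirGraph

/-! ### Leavitt path algebras of finite graphs -/

/-- Generators of the Leavitt path algebra: vertices, edges and ghost edges. -/
inductive LeavittGen (V : Type uV) (A : Type uA) : Type (max uV uA)
  | vertex (v : V)
  | edge (e : A)
  | ghost (e : A)

section Leavitt

variable (K : Type uK) [Field K] {V : Type uV} {A : Type uA} [Fintype V] [Fintype A]
  [DecidableEq V] (G : DirGraph V A)

open LeavittGen in
/-- The defining relations.  As there are finitely many vertices, the algebra has the identity
`∑ v`; this is the relation `sum_vertex`. -/
inductive LeavittRel :
    FreeAlgebra K (LeavittGen V A) → FreeAlgebra K (LeavittGen V A) → Prop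
  | sum_vertex : LeavittRel (∑ v : V, FreeAlgebra.ι K (vertex v)) 1
  | vertex_self (v : V) :
      LeavittRel (FreeAlgebra.ι K (vertex v) * FreeAlgebra.ι K (vertex v))
        (FreeAlgebra.ι K (vertex v))
  | vertex_ne (v w : V) (h : v ≠ w) :
      LeavittRel (FreeAlgebra.ι K (vertex v) * FreeAlgebra.ι K (vertex w)) 0
  | source_edge (e : A) :
      LeavittRel (FreeAlgebra.ι K (vertex (G.s e)) * FreeAlgebra.ι K (edge e))
        (FreeAlgebra.ι K (edge e))
  | edge_range (e : A) :
      LeavittRel (FreeAlgebra.ι K (edge e) * FreeAlgebra.ι K (vertex (G.r e)))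
        (FreeAlgebra.ι K (edge e))
  | range_ghost (e : A) :
      LeavittRel (FreeAlgebra.ι K (vertex (G.r e)) * FreeAlgebra.ι K (ghost e))
        (FreeAlgebra.ι K (ghost e))
  | ghost_source (e : A) :
      LeavittRel (FreeAlgebra.ι K (ghost e) * FreeAlgebra.ι K (vertex (G.s e)))
        (FreeAlgebra.ι K (ghost e))
  | ck1_self (e : A) :
      LeavittRel (FreeAlgebra.ι K (ghost e) * FreeAlgebra.ι K (edge e))
        (FreeAlgebra.ι K (vertex (G.r e)))
  | ck1_ne (e f : A) (h : e ≠ f) :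
      LeavittRel (FreeAlgebra.ι K (ghost e) * FreeAlgebra.ι K (edge f)) 0
  | ck2 (v : V) (h : ∃ e : A, G.s e = v) :
      LeavittRel (FreeAlgebra.ι K (vertex v))
        (∑ e : A with G.s e = v, FreeAlgebra.ι K (edge e) * FreeAlgebra.ι K (ghost e))

/-- The Leavitt path algebra `L_K(E)` of a finite graph. -/
def LeavittPathAlgebra : Type (max uK uV uA) := RingQuot (LeavittRel K G)

namespace LeavittPathAlgebra

noncomputable instance : Ring (LeavittPathAlgebra K G) :=
  inferInstanceAs (Ring (RingQuot (LeavittRel K G)))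

noncomputable instance : Algebra K (LeavittPathAlgebra K G) :=
  inferInstanceAs (Algebra K (RingQuot (LeavittRel K G)))

/-- The image of a generator. -/
noncomputable def gen (x : LeavittGen V A) : LeavittPathAlgebra K G :=
  RingQuot.mkAlgHom K (LeavittRel K G) (FreeAlgebra.ι K x)

/-- The element `p` of the algebra, for a path `p` ending at `v`. -/
noncomputable def ofPath {v : V} (p : G.PathTo v) : LeavittPathAlgebra K G :=
  (p.1.map fun e => gen K G (.edge e)).prod * gen K G (.vertex v)

/-- The element `p*` of the algebra, for a path `p` ending at `v`. -/
noncomputable def ofGhostPath {v : V} (p : G.PathTo v) : LeavittPathAlgebra K G :=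
  gen K G (.vertex v) * (p.1.reverse.map fun e => gen K G (.ghost e)).prod

/-- The homogeneous component of degree `n`: linear combinations of the elements `p q*`, where
`p` and `q` are paths ending at the same vertex and `|p| - |q| = n`. -/
noncomputable def grading (n : ℤ) : AddSubgroup (LeavittPathAlgebra K G) :=
  (Submodule.span K {x | ∃ (v : V) (p q : G.PathTo v),
    (p.1.length : ℤ) - (q.1.length : ℤ) = n ∧
      x = ofPath K G p * ofGhostPath K G q}).toAddSubgroup

/-- The set of the vertices, as elements of the algebra. -/
def vertices : Set (LeavittPathAlgebra K G) := Set.range fun v : V => gen K G (.vertex v)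

end LeavittPathAlgebra

end Leavitt

/-! ### Graded matrix rings -/

/-- The grading of the matrix ring `M_I(R)(δ)`: a matrix is homogeneous of degree `n` if its
`(i, j)` entry has degree `n + δ j - δ i`. -/
def matrixGrading {R : Type*} [Ring R] (𝒜 : ℤ → AddSubgroup R) {I : Type*} (δ : I → ℤ) :
    ℤ → AddSubgroup (Matrix I I R) :=
  fun n =>
    { carrier := {M | ∀ i j, M i j ∈ 𝒜 (n + δ j - δ i)}
      zero_mem' := fun i j => (𝒜 (n + δ j - δ i)).zero_mem
      add_mem' := fun hx hy i j => (𝒜 (n + δ j - δ i)).add_mem (hx i j) (hy i j)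
      neg_mem' := fun hx i j => (𝒜 (n + δ j - δ i)).neg_mem (hx i j) }

/-- The ring `R` concentrated in degree `0`. -/
def trivialGrading (R : Type*) [Ring R] : ℤ → AddSubgroup R :=
  fun n => if n = 0 then ⊤ else ⊥

/-- The subalgebra `K[xⁿ, x⁻ⁿ]` of `K[x, x⁻¹]`. -/
noncomputable def laurentPow (K : Type*) [Field K] (n : ℕ) : Subalgebra K K[T;T⁻¹] :=
  Algebra.adjoin K {LaurentPolynomial.T (n : ℤ), LaurentPolynomial.T (-(n : ℤ))}

/-- The grading of `K[xⁿ, x⁻ⁿ]` inherited from `K[x, x⁻¹]`, where `x` has degree `1`: the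
component of degree `d` consists of the elements of the form `a x ^ d`. -/
noncomputable def laurentPowGrading (K : Type*) [Field K] (n : ℕ) :
    ℤ → AddSubgroup (laurentPow K n) :=
  fun d =>
    ((Submodule.span K {(LaurentPolynomial.T d : K[T;T⁻¹])}).comap
      (laurentPow K n).val.toLinearMap).toAddSubgroup

section Decomposition

variable (K : Type uK) [Field K] {V : Type uV} {A : Type uA} [Fintype V] [Fintype A]
  [DecidableEq V] (G : DirGraph V A)

open Classical in
/-- The graded decomposition
`L_K(E) ≅ ⨁_{v} M_{n_v}(K)(|p|)_{p} ⊕ ⨁_{c} M_{m_c}(K[x^|c|, x^-|c|])(|q|)_{q}`,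
where `v` runs over the sinks and `c` over the cycles, both finite in number; the `n_v` rows and
columns are indexed by the paths `p` ending at `v`, the `m_c` rows and columns by the paths `q`
which end at the base vertex `base c` and do not include all the edges of `c`, and `n_v` and
`m_c` are positive integers. -/
def HasGradedMatrixDecomposition (base : G.Cycles → V) : Prop :=
  Finite G.Sinks ∧ Finite G.Cycles ∧
  ∃ (_ : ∀ v : G.Sinks, Fintype (G.PathTo v.1))
    (_ : ∀ c : G.Cycles, Fintype (G.CyclePathTo c (base c))),
    (∀ v : G.Sinks, 0 < Fintype.card (G.PathTo v.1)) ∧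
    (∀ c : G.Cycles, 0 < Fintype.card (G.CyclePathTo c (base c))) ∧
    ∃ φ : LeavittPathAlgebra K G ≃ₐ[K]
        ((v : G.Sinks) → Matrix (G.PathTo v.1) (G.PathTo v.1) K) ×
        ((c : G.Cycles) → Matrix (G.CyclePathTo c (base c)) (G.CyclePathTo c (base c))
          (laurentPow K c.1.length)),
      ∀ (n : ℤ) (x : LeavittPathAlgebra K G),
        x ∈ LeavittPathAlgebra.grading K G n ↔
          (∀ v : G.Sinks, (φ x).1 v ∈
            matrixGrading (trivialGrading K) (fun p : G.PathTo v.1 => (p.1.length : ℤ)) n) ∧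
          (∀ c : G.Cycles, (φ x).2 c ∈
            matrixGrading (laurentPowGrading K c.1.length)
              (fun q : G.CyclePathTo c (base c) => (q.1.1.length : ℤ)) n)

end Decomposition

/-!
# Leavitt path algebras of finite graphs in which no cycle has an exit

Let `L` be the Leavitt path algebra of a finite graph `E`.

**From the graph to the matrices.**  Suppose that no cycle has an exit.  Then a path which starts on
a cycle stays on it, distinct cycles are disjoint, and a path which does not run through the whole
of a cycle never meets a vertex twice (`NoCycleHasExit.nodup_map_source`), so the index sets of the
matrix rings are finite.  The paths ending at a sink, or the paths ending at the base `w` of a cycle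
`c` which do not include all the edges of `c`, form a *branching system*: every path which is not
trivial splits off its first edge, and for a cycle the trivial path `w` splits as `x^|c|` times the
cycle.  A branching system carries a representation of `L` (`BranchingSystem.toEnd`), here one by
matrices over `K` or over `K[x^|c|, x^-|c|]`.  It maps `p r q*` to the matrix with the entry `r` at
`(p, q)` and is faithful on `L w` (`LeavittBlock.mul_vert_eq_zero`).  The sum of these
representations is surjective, as the matrix units of a block vanish in the other blocks, and
injective, as every vertex is connected to a sink or to a cycle by paths along which zero can be
pulled back (`vertex_induction`).  It is an isomorphism of graded algebras since the components of
the coefficient rings are independent (`NoCycleHasExit.hasGradedMatrixDecomposition`).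

**From the matrices to the ring conditions.**  The diagonal matrix units are homogeneous idempotents
which generate graded simple one-sided ideals, because nonzero homogeneous elements of `K` and of
`K[xⁿ, x⁻ⁿ]` are invertible.  So `L` is graded semisimple on both sides.  Over a graded semisimple
ring every graded submodule has a graded complement, so every graded module is graded injective
(`IsGradedSemisimpleRing.isGradedInjective`), which covers the `Σ`-`V` condition and
self-injectivity.  A nilpotent `m × m` matrix over a domain has `m`-th power `0`, which bounds the
index of nilpotence.

**Back to the graph.**  If `d c = 1 ≠ c d`, then `(1 - cⁿ dⁿ) d` is nilpotent, but its `n`-th power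
`(1 - c d) dⁿ` is not zero, so bounded index of nilpotence implies direct finiteness
(`HasBoundedNilpotenceIndex.isDedekindFiniteMonoid`), which passes to corners.  Now suppose that a
cycle has an exit `f`, and let `c` be the cycle as a closed path at `s(f)`.  Then `c* c = s(f)` but
`c c* f = 0`, so `L` is not graded directly-finite.  Moreover the elements `x_k = c ^ k f` satisfy
`x_j* x_k = δ_{jk} r(f)` (`exists_matrixUnits`).  On the left ideal of the `a` with `a x_k = 0` for
almost all `k`, consider homomorphisms which depend linearly on the sequence of the `a x_k`.

* For a graded simple module with a homogeneous element `s` such that `r(f) s = s ≠ 0`, the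
  homomorphism `a ↦ (a x_k s)_k` into a direct sum of suspensions does not extend to `L`, since the
  image of `1` would have only finitely many nonzero entries (`not_isGradedSigmaVRing`).
* If `a ↦ ∑ a x_k x_k*`, the sum over even `k`, extends to `L`, then the image `z` of `1` has degree
  `0` and satisfies `x_k* z x_k = r(f)` for even `k` and `x_k* z x_k = 0` for odd `k`
  (`IsGradedSelfInjective.exists_mul_eq`).  But an element `z` of degree `0` is a combination of
  elements `p q*` with `|p| = |q|`, so that `x_k* z x_k` does not depend on `k` for large `k`.

The relations are symmetric under exchanging edges and ghost edges, so the same elements serve for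
right modules.
-/

/-! ### Homogeneous components -/

section Graded

universe u

section Components

variable {M : Type u} [AddCommGroup M] {ℳ : ℤ → AddSubgroup M}
  {N : Type u} [AddCommGroup N] {𝒩 : ℤ → AddSubgroup N}

/-- The homogeneous component of degree `n`, as an additive endomorphism. -/
noncomputable def homogComp (h : DirectSum.IsInternal ℳ) (n : ℤ) : M →+ M :=
  letI := h.chooseDecomposition
  { toFun := fun x => (DirectSum.decompose ℳ x n : M)
    map_zero' := by simp
    map_add' := by simp }

theorem homogComp_mem (h : DirectSum.IsInternal ℳ) (n : ℤ) (x : M) : homogComp h n x ∈ ℳ n :=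
  letI := h.chooseDecomposition
  (DirectSum.decompose ℳ x n).2

theorem homogComp_of_mem (h : DirectSum.IsInternal ℳ) {n : ℤ} {x : M} (hx : x ∈ ℳ n) :
    homogComp h n x = x :=
  letI := h.chooseDecomposition
  DirectSum.decompose_of_mem_same ℳ hx

theorem homogComp_of_mem_ne (h : DirectSum.IsInternal ℳ) {m n : ℤ} {x : M} (hx : x ∈ ℳ m)
    (hmn : m ≠ n) : homogComp h n x = 0 :=
  letI := h.chooseDecomposition
  DirectSum.decompose_of_mem_ne ℳ hx hmn

theorem exists_sum_homogComp (h : DirectSum.IsInternal ℳ) (x : M) :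
    ∃ s : Finset ℤ, ∑ n ∈ s, homogComp h n x = x := by
  classical
  let := h.chooseDecomposition
  exact ⟨_, DirectSum.sum_support_decompose ℳ x⟩

theorem isInternal_of_components (π : ℤ → M →+ M) (h₁ : ∀ n, ∀ x ∈ ℳ n, π n x = x)
    (h₂ : ∀ m n, m ≠ n → ∀ x ∈ ℳ m, π n x = 0) (h₃ : ∀ x, x ∈ ⨆ n, ℳ n) :
    DirectSum.IsInternal ℳ := by
  classical
  have key : ∀ (z : ⨁ n, ℳ n) (n : ℤ), π n (DirectSum.coeAddMonoidHom ℳ z) = z n := by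
    intro z n
    induction z using DirectSum.induction_on with
    | zero => simp
    | of i x =>
      rw [DirectSum.coeAddMonoidHom_of]
      by_cases hi : i = n
      · subst hi; rw [h₁ _ _ x.2, DirectSum.of_eq_same]
      · rw [h₂ _ _ hi _ x.2, DirectSum.of_eq_of_ne _ _ _ (Ne.symm hi)]; rfl
    | add x y hx hy => simp [hx, hy]
  refine ⟨?_, ?_⟩
  · rw [injective_iff_map_eq_zero]
    intro z hz
    ext n
    rw [← key z n, hz]; simp
  · intro x
    change x ∈ (DirectSum.coeAddMonoidHom ℳ).range
    revert x
    have : (⨆ n, ℳ n) ≤ (DirectSum.coeAddMonoidHom ℳ).range :=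
      iSup_le fun n x hx => ⟨DirectSum.of (fun n => ℳ n) n ⟨x, hx⟩, by simp⟩
    exact fun x => this (h₃ x)

theorem homogComp_map (h : DirectSum.IsInternal ℳ) (h' : DirectSum.IsInternal 𝒩) {f : M →+ N}
    {σ : ℤ → ℤ} (hσ : Function.Injective σ) (hf : ∀ n, ∀ x ∈ ℳ n, f x ∈ 𝒩 (σ n)) (n : ℤ) (x : M) :
    homogComp h' (σ n) (f x) = f (homogComp h n x) := by
  obtain ⟨s, hs⟩ := exists_sum_homogComp h x
  rw [← hs]
  simp only [map_sum]
  refine Finset.sum_congr rfl fun m _ => ?_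
  have hm := homogComp_mem h m x
  by_cases hmn : m = n
  · subst hmn
    rw [homogComp_of_mem h hm, homogComp_of_mem h' (hf _ _ hm)]
  · rw [homogComp_of_mem_ne h hm hmn, homogComp_of_mem_ne h' (hf _ _ hm) (hσ.ne hmn), map_zero]

end Components

variable {R : Type u} [Ring R] {𝒜 : ℤ → AddSubgroup R}
  {M : Type u} [AddCommGroup M] [Module R M] {ℳ : ℤ → AddSubgroup M}
  {N : Type u} [AddCommGroup N] [Module R N] {𝒩 : ℤ → AddSubgroup N}

/-! ### Graded submodules and quotients -/

theorem isGradedSubmodule_iff (h : DirectSum.IsInternal ℳ) {P : Submodule R M} :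
    IsGradedSubmodule ℳ P ↔ ∀ x ∈ P, ∀ n, homogComp h n x ∈ P := by
  constructor
  · intro hP x hx n
    have hle : P.toAddSubgroup ≤ P.toAddSubgroup.comap (homogComp h n) := by
      nth_rewrite 1 [hP]
      rintro x hx
      refine (iSup_le fun i => ?_ : (⨆ i, P.toAddSubgroup ⊓ ℳ i) ≤ _) hx
      rintro x ⟨h1, h2⟩
      rw [AddSubgroup.mem_comap]
      by_cases hi : i = n
      · subst hi; rwa [homogComp_of_mem h h2]
      · rw [homogComp_of_mem_ne h h2 hi]; exact zero_mem _
    exact hle hx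
  · intro hP
    refine le_antisymm (fun x hx => ?_) (iSup_le fun n => inf_le_left)
    obtain ⟨s, hs⟩ := exists_sum_homogComp h x
    rw [← hs]
    exact sum_mem fun n _ => AddSubgroup.mem_iSup_of_mem n ⟨hP x hx n, homogComp_mem h n x⟩

theorem isGradedSubmodule_comap (h : DirectSum.IsInternal ℳ) (h' : DirectSum.IsInternal 𝒩)
    {f : M →ₗ[R] N} {σ : ℤ → ℤ} (hσ : Function.Injective σ)
    (hf : ∀ n, ∀ x ∈ ℳ n, f x ∈ 𝒩 (σ n)) {P : Submodule R N} (hP : IsGradedSubmodule 𝒩 P) :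
    IsGradedSubmodule ℳ (P.comap f) := by
  rw [isGradedSubmodule_iff h]
  intro x hx n
  have := (isGradedSubmodule_iff h').1 hP _ hx (σ n)
  rw [Submodule.mem_comap]
  rwa [← LinearMap.toAddMonoidHom_coe f, homogComp_map h h' hσ hf n x] at this

theorem isGradedSubmodule_map (h : DirectSum.IsInternal ℳ) (h' : DirectSum.IsInternal 𝒩)
    {f : M →ₗ[R] N} {σ : ℤ → ℤ} (hσ : Function.Bijective σ)
    (hf : ∀ n, ∀ x ∈ ℳ n, f x ∈ 𝒩 (σ n)) {P : Submodule R M} (hP : IsGradedSubmodule ℳ P) :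
    IsGradedSubmodule 𝒩 (P.map f) := by
  rw [isGradedSubmodule_iff h']
  rintro _ ⟨x, hx, rfl⟩ m
  obtain ⟨n, rfl⟩ := hσ.2 m
  refine ⟨homogComp h n x, (isGradedSubmodule_iff h).1 hP x hx n, ?_⟩
  exact (homogComp_map (f := f.toAddMonoidHom) h h' hσ.1 hf n x).symm

theorem IsGradedSubmodule.sup {P Q : Submodule R M} (hP : IsGradedSubmodule ℳ P)
    (hQ : IsGradedSubmodule ℳ Q) (h : DirectSum.IsInternal ℳ) : IsGradedSubmodule ℳ (P ⊔ Q) := by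
  rw [isGradedSubmodule_iff h] at *
  intro x hx n
  obtain ⟨p, hp, q, hq, rfl⟩ := Submodule.mem_sup.1 hx
  rw [map_add]
  exact Submodule.add_mem_sup (hP p hp n) (hQ q hq n)

theorem isGradedSubmodule_sSup_of_chain (h : DirectSum.IsInternal ℳ) {c : Set (Submodule R M)}
    (hc : IsChain (· ≤ ·) c) (hne : c.Nonempty) (hg : ∀ P ∈ c, IsGradedSubmodule ℳ P) :
    IsGradedSubmodule ℳ (sSup c) := by
  rw [isGradedSubmodule_iff h]
  intro x hx n
  rw [Submodule.mem_sSup_of_directed hne hc.directedOn] at hx ⊢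
  obtain ⟨P, hP, hx⟩ := hx
  exact ⟨P, hP, (isGradedSubmodule_iff h).1 (hg P hP) x hx n⟩

theorem isGradedSubmodule_bot : IsGradedSubmodule ℳ (⊥ : Submodule R M) := by
  refine le_antisymm (fun x hx => ?_) (iSup_le fun n => inf_le_left)
  have : x = 0 := hx
  rw [this]; exact zero_mem _

theorem IsGradedModule.induced (h : IsGradedModule 𝒜 ℳ) {P : Submodule R M}
    (hP : IsGradedSubmodule ℳ P) : IsGradedModule 𝒜 (inducedGrading ℳ P) := by
  have hP' := (isGradedSubmodule_iff h.isInternal).1 hP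
  let π : ℤ → P →+ P := fun n =>
    { toFun := fun x => ⟨homogComp h.isInternal n x, hP' x x.2 n⟩
      map_zero' := by ext; simp
      map_add' := fun x y => by ext; simp }
  refine ⟨isInternal_of_components π ?_ ?_ ?_, ?_⟩
  · intro n x hx
    exact Subtype.ext (homogComp_of_mem h.isInternal hx)
  · intro m n hmn x hx
    exact Subtype.ext (homogComp_of_mem_ne h.isInternal hx hmn)
  · intro x
    obtain ⟨s, hs⟩ := exists_sum_homogComp h.isInternal (x : M)
    have : x = ∑ n ∈ s, π n x := by
      ext; rw [Submodule.coe_sum]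
      exact hs.symm
    rw [this]
    exact sum_mem fun n _ => AddSubgroup.mem_iSup_of_mem n (homogComp_mem h.isInternal n _)
  · intro i j a ha m hm
    exact h.smul_mem i j a ha m hm

/-- The grading of a quotient module by the images of the homogeneous components. -/
def quotientGrading (ℳ : ℤ → AddSubgroup M) (P : Submodule R M) : ℤ → AddSubgroup (M ⧸ P) :=
  fun n => (ℳ n).map P.mkQ.toAddMonoidHom

theorem IsGradedModule.quotient (h : IsGradedModule 𝒜 ℳ) {P : Submodule R M}
    (hP : IsGradedSubmodule ℳ P) : IsGradedModule 𝒜 (quotientGrading ℳ P) := by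
  have hP' := (isGradedSubmodule_iff h.isInternal).1 hP
  let π : ℤ → (M ⧸ P) →+ (M ⧸ P) := fun n =>
    QuotientAddGroup.lift P.toAddSubgroup (P.mkQ.toAddMonoidHom.comp (homogComp h.isInternal n))
      fun x hx => (Submodule.Quotient.mk_eq_zero P).2 (hP' x hx n)
  have hπ : ∀ n x, π n (P.mkQ x) = P.mkQ (homogComp h.isInternal n x) := fun n x => rfl
  refine ⟨isInternal_of_components π ?_ ?_ ?_, ?_⟩
  · rintro n _ ⟨x, hx, rfl⟩
    exact congrArg P.mkQ (homogComp_of_mem h.isInternal hx)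
  · rintro m n hmn _ ⟨x, hx, rfl⟩
    exact (congrArg P.mkQ (homogComp_of_mem_ne h.isInternal hx hmn)).trans (map_zero _)
  · intro x
    obtain ⟨x, rfl⟩ := P.mkQ_surjective x
    obtain ⟨s, hs⟩ := exists_sum_homogComp h.isInternal x
    rw [← hs, map_sum]
    exact sum_mem fun n _ => AddSubgroup.mem_iSup_of_mem n
      ⟨_, homogComp_mem h.isInternal n x, rfl⟩
  · rintro i j a ha _ ⟨x, hx, rfl⟩
    exact ⟨a • x, h.smul_mem i j a ha x hx, map_smul P.mkQ a x⟩

/-! ### Graded modules over graded semisimple rings -/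

/-- Right multiplication of `R` into a graded module by a homogeneous element of degree `d`
raises degrees by `d`. -/
theorem toSpanSingleton_mem (h : IsGradedModule 𝒜 ℳ) {d : ℤ} {x : M} (hx : x ∈ ℳ d) (n : ℤ) :
    ∀ a ∈ 𝒜 n, LinearMap.toSpanSingleton R M x a ∈ ℳ (n + d) :=
  fun a ha => h.smul_mem n d a ha x hx

/-- Over a graded semisimple ring graded submodules have graded complements: a graded submodule
maximal among those which are disjoint from the given one is a complement. -/
theorem IsGradedSemisimpleRing.exists_isCompl (hA : IsGradedModule 𝒜 𝒜)
    (hS : IsGradedSemisimpleRing 𝒜) (hM : IsGradedModule 𝒜 ℳ) {P : Submodule R M}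
    (hP : IsGradedSubmodule ℳ P) : ∃ C : Submodule R M, IsGradedSubmodule ℳ C ∧ IsCompl P C := by
  obtain ⟨k, S, hS, hint⟩ := hS
  obtain ⟨C, -, hC⟩ := zorn_le_nonempty₀ {C : Submodule R M | IsGradedSubmodule ℳ C ∧ Disjoint P C}
    (by
      intro c hc hch y hy
      refine ⟨sSup c, ⟨isGradedSubmodule_sSup_of_chain hM.isInternal hch ⟨y, hy⟩
        fun P hP => (hc hP).1, ?_⟩, fun z hz => le_sSup hz⟩
      rw [Submodule.disjoint_def]
      intro x hx hx'
      rw [Submodule.mem_sSup_of_directed ⟨y, hy⟩ hch.directedOn] at hx'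
      obtain ⟨Q, hQ, hx'⟩ := hx'
      exact Submodule.disjoint_def.1 (hc hQ).2 x hx hx')
    ⊥ ⟨isGradedSubmodule_bot, disjoint_bot_right⟩
  refine ⟨C, hC.prop.1, hC.prop.2, ?_⟩
  have hW := hP.sup hC.prop.1 hM.isInternal
  have hsum : ∀ r : R, r ∈ ⨆ i, S i := by
    rw [(DirectSum.isInternal_submodule_iff_iSupIndep_and_iSup_eq_top S).1 hint |>.2]
    exact fun r => Submodule.mem_top
  -- A homogeneous `x` outside `P + C` gives a simple summand `S i` with `S i • x ⊄ P + C`.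
  rw [codisjoint_iff, Submodule.eq_top_iff']
  intro x
  obtain ⟨s, hs⟩ := exists_sum_homogComp hM.isInternal x
  rw [← hs]
  refine sum_mem fun n _ => ?_
  have hx := homogComp_mem hM.isInternal n x
  generalize homogComp hM.isInternal n x = x at hx
  let f := LinearMap.toSpanSingleton R M x
  have hf : ∀ m, ∀ a ∈ 𝒜 m, f a ∈ ℳ (m + n) := toSpanSingleton_mem hM hx
  have hmap : ∀ i, S i ≤ (P ⊔ C).comap f := by
    intro i
    let f' := f ∘ₗ (S i).subtype
    have hf' : ∀ m, ∀ a ∈ inducedGrading 𝒜 (S i) m, f' a ∈ ℳ (m + n) := fun m a ha => hf m a ha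
    rcases (hS i).2.eq_bot_or_eq_top _ (isGradedSubmodule_comap (hS i).2.isGraded.isInternal
      hM.isInternal (add_left_injective n) hf' hW) with h | h
    · have hinj : ∀ a ∈ S i, f a ∈ P ⊔ C → a = 0 := by
        intro a ha hfa
        have : (⟨a, ha⟩ : S i) ∈ (P ⊔ C).comap f' := hfa
        rw [h] at this
        exact congrArg Subtype.val ((Submodule.mem_bot R).1 this)
      have hg : IsGradedSubmodule ℳ ((S i).map f) :=
        isGradedSubmodule_map hA.isInternal hM.isInternal (Equiv.addRight n).bijective hf (hS i).1
      have hC' := hC.le_of_ge (y := C ⊔ (S i).map f) ⟨hC.prop.1.sup hg hM.isInternal, by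
        rw [Submodule.disjoint_def]
        intro y hy hy'
        obtain ⟨z, hz, _, ⟨a, ha, rfl⟩, rfl⟩ := Submodule.mem_sup.1 hy'
        have ha0 : a = 0 := hinj a ha (by
          have : f a = (z + f a) + (-z) := by abel
          rw [this]
          exact Submodule.add_mem_sup hy (C.neg_mem hz))
        rw [ha0, map_zero, add_zero] at hy ⊢
        exact Submodule.disjoint_def.1 hC.prop.2 z hy hz⟩ le_sup_left
      intro a ha
      exact (le_trans le_sup_right hC' |>.trans le_sup_right) ⟨a, ha, rfl⟩
    · intro a ha
      have : (⟨a, ha⟩ : S i) ∈ (P ⊔ C).comap f' := by rw [h]; trivial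
      exact this
  have := iSup_le hmap (hsum 1)
  simpa [f] using this

theorem IsGradedSemisimpleRing.isGradedInjective (hA : IsGradedModule 𝒜 𝒜)
    (hS : IsGradedSemisimpleRing 𝒜) {Q : Type u} [AddCommGroup Q] [Module R Q]
    (𝒬 : ℤ → AddSubgroup Q) : IsGradedInjective 𝒜 𝒬 := by
  intro M N _ _ _ _ ℳ 𝒩 hM hN i f hi hinj hf
  have hrange : IsGradedSubmodule 𝒩 (LinearMap.range i) := by
    rw [isGradedSubmodule_iff hN.isInternal]
    rintro _ ⟨x, rfl⟩ n
    exact ⟨homogComp hM.isInternal n x, (homogComp_map (f := i.toAddMonoidHom) (σ := id)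
      hM.isInternal hN.isInternal Function.injective_id hi n x).symm⟩
  obtain ⟨C, hC, hcompl⟩ := hS.exists_isCompl hA hN hrange
  let p := Submodule.projectionOnto _ _ hcompl
  let e := LinearEquiv.ofInjective i hinj
  have hp : ∀ x, p (i x) = e x := fun x =>
    Submodule.projectionOnto_apply_left hcompl (e x)
  refine ⟨f ∘ₗ e.symm.toLinearMap ∘ₗ p, ?_, ?_⟩
  · intro n x hx
    obtain ⟨_, ⟨m, rfl⟩, c, hc, rfl⟩ := Submodule.mem_sup.1
      (show x ∈ LinearMap.range i ⊔ C by rw [hcompl.sup_eq_top]; trivial)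
    have hpc : p c = 0 := (Submodule.projectionOnto_apply_eq_zero_iff hcompl).2 hc
    have h1 : i (homogComp hM.isInternal n m) + homogComp hN.isInternal n c = i m + c := by
      have := homogComp_of_mem hN.isInternal hx
      rw [map_add] at this
      rw [← this]
      congr 1
      exact (homogComp_map (f := i.toAddMonoidHom) (σ := id)
        hM.isInternal hN.isInternal Function.injective_id hi n m).symm
    have hpc' : p (homogComp hN.isInternal n c) = 0 :=
      (Submodule.projectionOnto_apply_eq_zero_iff hcompl).2
        ((isGradedSubmodule_iff hN.isInternal).1 hC c hc n)
    have h2 := congrArg p h1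
    rw [map_add, map_add, hp, hp, hpc, hpc', add_zero, add_zero] at h2
    have h3 := e.injective h2
    simp only [LinearMap.comp_apply, LinearEquiv.coe_coe, map_add, hp, hpc, map_zero, add_zero,
      LinearEquiv.symm_apply_apply]
    rw [← h3]
    exact hf n _ (homogComp_mem hM.isInternal n m)
  · ext x
    simp [hp]

/-- A ring is graded semisimple if `1` is a sum of orthogonal homogeneous idempotents `g i` such
that every nonzero homogeneous element of `R g i` generates the left ideal `R g i`. -/
theorem isGradedSemisimpleRing_of_idempotents (hA : IsGradedModule 𝒜 𝒜) {ι : Type*} [Finite ι]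
    (g : ι → R) (hg : ∀ i, g i ∈ 𝒜 0) (hg0 : ∀ i, g i ≠ 0) (hidem : ∀ i, g i * g i = g i)
    (horth : ∀ i j, i ≠ j → g i * g j = 0)
    (hone : ∀ r : R, (∀ i, r * g i = 0) → r = 0)
    (hmin : ∀ i n, ∀ x ∈ 𝒜 n, x ≠ 0 → x * g i = x → ∃ y, y * x = g i) :
    IsGradedSemisimpleRing 𝒜 := by
  classical
  obtain ⟨k, ⟨e⟩⟩ := Finite.exists_equiv_fin ι
  cases nonempty_fintype ι
  have hmem : ∀ i (x : R), x ∈ R ∙ (g i) ↔ x * g i = x := by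
    intro i x
    rw [Submodule.mem_span_singleton]
    constructor
    · rintro ⟨a, rfl⟩
      rw [smul_eq_mul, mul_assoc, hidem]
    · intro h; exact ⟨x, h⟩
  have hgr : ∀ i, IsGradedSubmodule 𝒜 (R ∙ (g i)) := by
    intro i
    rw [isGradedSubmodule_iff hA.isInternal]
    intro x hx n
    rw [hmem] at hx ⊢
    have := homogComp_map (f := AddMonoidHom.mulRight (g i)) (σ := id) hA.isInternal
      hA.isInternal Function.injective_id
      (fun m a ha => by simpa using hA.smul_mem m 0 a ha (g i) (hg i)) n x
    simp only [id, AddMonoidHom.mulRight_apply] at this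
    rw [← this, hx]
  have hone' : ∑ i, g i = 1 := by
    rw [← sub_eq_zero]
    refine hone _ fun i => ?_
    rw [sub_mul, one_mul, Finset.sum_mul, Finset.sum_eq_single i, hidem, sub_self]
    · intro j _ hj; exact horth j i hj
    · simp
  refine ⟨k, fun i => R ∙ (g (e.symm i)), fun i => ⟨hgr _, hA.induced (hgr _), ?_, ?_⟩, ?_⟩
  · exact ⟨⟨⟨g (e.symm i), Submodule.mem_span_singleton_self _⟩, 0,
      fun h => hg0 (e.symm i) (congrArg Subtype.val h)⟩⟩
  · intro P hP
    by_cases hbot : P = ⊥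
    · exact Or.inl hbot
    right
    obtain ⟨x, hxP, hx0⟩ := P.exists_mem_ne_zero_of_ne_bot hbot
    have hI := (hA.induced (hgr (e.symm i))).isInternal
    obtain ⟨n, hn⟩ : ∃ n, homogComp hI n x ≠ 0 := by
      by_contra! hcon
      obtain ⟨s, hs⟩ := exists_sum_homogComp hI x
      exact hx0 (by rw [← hs]; exact Finset.sum_eq_zero fun n _ => hcon n)
    have hyP := (isGradedSubmodule_iff hI).1 hP x hxP n
    have hy := homogComp_mem hI n x
    generalize homogComp hI n x = y at hn hyP hy
    obtain ⟨z, hz⟩ := hmin (e.symm i) n y hy (fun h => hn (Subtype.ext h)) ((hmem _ _).1 y.2)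
    rw [Submodule.eq_top_iff']
    intro w
    have : w = ((w : R) * z) • y := by
      ext
      rw [Submodule.coe_smul, smul_eq_mul, mul_assoc, hz, (hmem _ _).1 w.2]
    rw [this]
    exact P.smul_mem _ hyP
  · rw [DirectSum.isInternal_submodule_iff_iSupIndep_and_iSup_eq_top]
    refine ⟨?_, ?_⟩
    · intro i
      rw [Submodule.disjoint_def]
      intro x hx hx'
      have h1 := (hmem _ _).1 hx
      have h2 : (⨆ j, ⨆ (_ : j ≠ i), R ∙ (g (e.symm j)))
          ≤ LinearMap.ker (LinearMap.toSpanSingleton R R (g (e.symm i))) := by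
        refine iSup_le fun j => iSup_le fun hj => ?_
        rw [Submodule.span_singleton_le_iff_mem, LinearMap.mem_ker]
        exact horth _ _ (e.symm.injective.ne hj)
      rw [← h1]; exact h2 hx'
    · rw [Submodule.eq_top_iff']
      intro r
      have : r = ∑ i, r * g (e.symm i) := by
        rw [← Finset.mul_sum, e.symm.sum_comp g, hone', mul_one]
      rw [this]
      exact sum_mem fun i _ => Submodule.mem_iSup_of_mem i
        ((hmem _ _).2 (by rw [mul_assoc, hidem]))

/-! ### Infinite families of matrix units obstruct injectivity -/

/-- A nonzero idempotent `u` of degree `0` acts nontrivially on some graded simple module, namely on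
the quotient of `R` by a maximal graded left ideal which contains `1 - u` but not `u`. -/
theorem exists_isGradedSimple (hA : IsGradedModule 𝒜 𝒜) (h1 : (1 : R) ∈ 𝒜 0) {u : R}
    (hu : u ∈ 𝒜 0) (hu0 : u ≠ 0) (huu : u * u = u) :
    ∃ (S : Type u) (_ : AddCommGroup S) (_ : Module R S) (𝒮 : ℤ → AddSubgroup S),
      IsGradedSimple 𝒜 𝒮 ∧ ∃ s ∈ 𝒮 0, u • s = s ∧ s ≠ 0 := by
  have hI := hA.isInternal
  obtain ⟨P, -, hP⟩ := zorn_le_nonempty₀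
    {P : Submodule R R | IsGradedSubmodule 𝒜 P ∧ 1 - u ∈ P ∧ u ∉ P}
    (by
      intro c hc hch y hy
      refine ⟨sSup c, ⟨isGradedSubmodule_sSup_of_chain hI hch ⟨y, hy⟩ fun P hP => (hc hP).1,
        le_sSup hy (hc hy).2.1, ?_⟩, fun z hz => le_sSup hz⟩
      rw [Submodule.mem_sSup_of_directed ⟨y, hy⟩ hch.directedOn]
      rintro ⟨Q, hQ, hx⟩
      exact (hc hQ).2.2 hx)
    (R ∙ (1 - u)) ⟨by
      rw [isGradedSubmodule_iff hI]
      intro x hx n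
      obtain ⟨a, rfl⟩ := Submodule.mem_span_singleton.1 hx
      refine Submodule.mem_span_singleton.2 ⟨homogComp hI n a, ?_⟩
      have := homogComp_map (f := AddMonoidHom.mulRight (1 - u)) (σ := id) hI hI
        Function.injective_id (fun m a ha => by
          simpa using hA.smul_mem m 0 a ha (1 - u) (sub_mem h1 hu)) n a
      exact this.symm, Submodule.mem_span_singleton_self _, by
      intro h
      obtain ⟨a, ha⟩ := Submodule.mem_span_singleton.1 h
      apply hu0
      rw [← huu]
      nth_rewrite 1 [← ha]
      rw [smul_eq_mul, mul_assoc, sub_mul, one_mul, huu, sub_self, mul_zero]⟩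
  obtain ⟨hPg, hPu, hPu'⟩ := hP.prop
  refine ⟨R ⧸ P, inferInstance, inferInstance, quotientGrading 𝒜 P,
    ⟨hA.quotient hPg, ⟨⟨P.mkQ u, 0, ?_⟩⟩, ?_⟩, P.mkQ u, ⟨u, hu, rfl⟩, ?_, ?_⟩
  · exact fun h => hPu' ((Submodule.Quotient.mk_eq_zero P).1 h)
  · intro Q hQ
    have hcomap := isGradedSubmodule_comap (f := P.mkQ) hI (hA.quotient hPg).isInternal
      Function.injective_id (fun n x hx => ⟨x, hx, rfl⟩) hQ
    have hle : P ≤ Q.comap P.mkQ := Submodule.le_comap_mkQ P Q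
    by_cases huQ : u ∈ Q.comap P.mkQ
    · right
      have h1Q : (1 : R) ∈ Q.comap P.mkQ := by
        have := add_mem huQ (hle hPu)
        rwa [add_sub_cancel] at this
      rw [Submodule.eq_top_iff']
      intro x
      obtain ⟨x, rfl⟩ := P.mkQ_surjective x
      have := (Q.comap P.mkQ).smul_mem x h1Q
      rwa [smul_eq_mul, mul_one] at this
    · left
      have hle' := hP.le_of_ge (y := Q.comap P.mkQ) ⟨hcomap, hle hPu, huQ⟩ hle
      rw [eq_bot_iff]
      intro x hx
      obtain ⟨x, rfl⟩ := P.mkQ_surjective x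
      exact (Submodule.Quotient.mk_eq_zero P).2 (hle' hx)
  · rw [← map_smul, smul_eq_mul, huu]
  · exact fun h => hPu' ((Submodule.Quotient.mk_eq_zero P).1 h)

/-- The left ideal of the elements which are annihilated by almost all of the `x k`. -/
def finiteSupportIdeal (x : ℕ → R) : Submodule R R where
  carrier := {a | {k | a * x k ≠ 0}.Finite}
  zero_mem' := by simp
  add_mem' := fun {a b} ha hb => (ha.union hb).subset fun k hk => by
    by_contra! hcon
    simp only [Set.mem_union, Set.mem_ofPred_eq, not_or, not_not] at hcon
    exact hk (by rw [add_mul, hcon.1, hcon.2, add_zero])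
  smul_mem' := fun r a ha => Set.Finite.subset ha fun k hk h => hk (by
    rw [smul_eq_mul, mul_assoc, h, mul_zero])

/-- The map `a ↦ (a x₀, a x₁, …)` on `finiteSupportIdeal x`. -/
noncomputable def finiteSupportMap (x : ℕ → R) :
    finiteSupportIdeal x →ₗ[R] (ℕ →₀ R) where
  toFun a := Finsupp.ofSupportFinite (fun k => a.1 * x k) a.2
  map_add' a b := by ext k; exact add_mul _ _ _
  map_smul' r a := by ext k; exact mul_assoc _ _ _

@[simp]
theorem finiteSupportMap_apply (x : ℕ → R) (a : finiteSupportIdeal x) (k : ℕ) :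
    finiteSupportMap x a k = a.1 * x k := rfl

theorem isGradedSubmodule_finiteSupportIdeal (hA : IsGradedModule 𝒜 𝒜) {x : ℕ → R} {d : ℕ → ℤ}
    (hx : ∀ k, x k ∈ 𝒜 (d k)) : IsGradedSubmodule 𝒜 (finiteSupportIdeal x) := by
  rw [isGradedSubmodule_iff hA.isInternal]
  intro a ha n
  refine Set.Finite.subset ha fun k hk h => hk ?_
  have := homogComp_map (f := AddMonoidHom.mulRight (x k)) (σ := (· + d k)) hA.isInternal
    hA.isInternal (add_left_injective _) (fun m a ha => hA.smul_mem m (d k) a ha _ (hx k)) n a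
  simp only [AddMonoidHom.mulRight_apply] at this
  rw [← this, h, map_zero]

/-- If `y j * x k = δ_{jk} u`, the orthogonal idempotents `x k * y k` act independently on a graded
left self-injective ring: some `z` of degree `0` has `x k y k z = x k y k` for `k ∈ T` and
`x k y k z = 0` for `k ∉ T`. -/
theorem IsGradedSelfInjective.exists_mul_eq (hA : IsGradedModule 𝒜 𝒜) (h1 : (1 : R) ∈ 𝒜 0)
    (hinj : IsGradedSelfInjective 𝒜) {x y : ℕ → R} {d : ℕ → ℤ} (hx : ∀ k, x k ∈ 𝒜 (d k))
    (hy : ∀ k, y k ∈ 𝒜 (-d k)) {u : R} (hyx : ∀ k, y k * x k = u) (hxu : ∀ k, x k * u = x k)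
    (horth : ∀ j k, j ≠ k → y j * x k = 0) (T : Set ℕ) :
    ∃ z ∈ 𝒜 0, (∀ k ∈ T, x k * y k * z = x k * y k) ∧ ∀ k ∉ T, x k * y k * z = 0 := by
  classical
  have hg := isGradedSubmodule_finiteSupportIdeal hA hx
  have hmem : ∀ k, x k * y k ∈ finiteSupportIdeal x := fun k =>
    (Set.finite_singleton k).subset fun j hj => by
      by_contra hne
      exact hj (by rw [mul_assoc, horth k j (Ne.symm hne), mul_zero])
  let w : ℕ → R := fun k => if k ∈ T then y k else 0
  let F : (ℕ →₀ R) →ₗ[R] R := Finsupp.lsum ℕ fun k => LinearMap.toSpanSingleton R R (w k)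
  obtain ⟨h, hh, hcomp⟩ := hinj _ R (inducedGrading 𝒜 (finiteSupportIdeal x)) 𝒜 (hA.induced hg) hA
    (finiteSupportIdeal x).subtype (F ∘ₗ finiteSupportMap x) (fun n m hm => hm)
    (Submodule.subtype_injective _) (by
      intro n a ha
      rw [LinearMap.comp_apply, Finsupp.lsum_apply]
      refine sum_mem fun k _ => ?_
      simp only [finiteSupportMap_apply, LinearMap.toSpanSingleton_apply, w]
      split_ifs
      · have := hA.smul_mem _ _ _ (hA.smul_mem _ _ _ ha _ (hx k)) _ (hy k)
        rwa [add_neg_cancel_right] at this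
      · rw [smul_zero]; exact zero_mem _)
  refine ⟨h 1, hh 0 1 h1, ?_⟩
  have key : ∀ k, x k * y k * h 1 = x k * w k := by
    intro k
    have h2 : h (x k * y k) = x k * y k * h 1 := by
      rw [← smul_eq_mul (x k * y k) (h 1), ← map_smul, smul_eq_mul, mul_one]
    have h3 := LinearMap.congr_fun hcomp ⟨x k * y k, hmem k⟩
    rw [← h2]
    refine h3.trans ?_
    rw [LinearMap.comp_apply, Finsupp.lsum_apply, Finsupp.sum_of_support_subset _ (s := {k})]
    · rw [Finset.sum_singleton, finiteSupportMap_apply, mul_assoc, hyx, hxu,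
        LinearMap.toSpanSingleton_apply, smul_eq_mul]
    · intro j hj
      rw [Finsupp.mem_support_iff, finiteSupportMap_apply] at hj
      by_contra hne
      rw [Finset.mem_singleton] at hne
      exact hj (by rw [mul_assoc, horth k j (Ne.symm hne), mul_zero])
    · simp
  exact ⟨fun k hk => by rw [key]; simp [w, hk], fun k hk => by rw [key]; simp [w, hk]⟩

/-- A graded left `Σ`-`V` ring has no infinite family of homogeneous matrix units: if `s` is a
homogeneous element of a graded simple module with `u s = s`, the map `a ↦ (a x_k s)_k` into the
direct sum of suspensions cannot be extended to the ring. -/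
theorem not_isGradedSigmaVRing (hA : IsGradedModule 𝒜 𝒜) (h1 : (1 : R) ∈ 𝒜 0)
    {x y : ℕ → R} {d : ℕ → ℤ} (hx : ∀ k, x k ∈ 𝒜 (d k)) {u : R} (hu : u ∈ 𝒜 0) (hu0 : u ≠ 0)
    (huu : u * u = u) (hyx : ∀ k, y k * x k = u) (hxu : ∀ k, x k * u = x k)
    (horth : ∀ j k, j ≠ k → y j * x k = 0) : ¬ IsGradedSigmaVRing 𝒜 := by
  intro hV
  obtain ⟨S, _, _, 𝒮, hS, s, hs, hus, hs0⟩ := exists_isGradedSimple hA h1 hu hu0 huu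
  have hg := isGradedSubmodule_finiteSupportIdeal hA hx
  have hmem : ∀ k, x k * y k ∈ finiteSupportIdeal x := fun k =>
    (Set.finite_singleton k).subset fun j hj => by
      by_contra hne
      exact hj (by rw [mul_assoc, horth k j (Ne.symm hne), mul_zero])
  let F : (ℕ →₀ R) →ₗ[R] (ULift.{u} ℕ →₀ S) :=
    (Finsupp.domLCongr Equiv.ulift.symm).toLinearMap ∘ₗ
      Finsupp.mapRange.linearMap (LinearMap.toSpanSingleton R S s)
  have hF : ∀ (z : ℕ →₀ R) (k : ULift.{u} ℕ), F z k = z k.down • s := fun z k => rfl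
  obtain ⟨h, -, hcomp⟩ := hV S 𝒮 hS (ULift.{u} ℕ) (fun k => d k.down) _ R
    (inducedGrading 𝒜 (finiteSupportIdeal x)) 𝒜 (hA.induced hg) hA
    (finiteSupportIdeal x).subtype (F ∘ₗ finiteSupportMap x) (fun n m hm => hm)
    (Submodule.subtype_injective _) (by
      intro n a ha k
      rw [LinearMap.comp_apply, hF, finiteSupportMap_apply]
      have := hS.isGraded.smul_mem _ _ _ (hA.smul_mem _ _ _ ha _ (hx k.down)) _ hs
      rwa [add_zero, add_comm] at this)
  obtain ⟨k, hk⟩ := Infinite.exists_notMem_finset (h 1).support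
  rw [Finsupp.notMem_support_iff] at hk
  have h2 : h (x k.down * y k.down) = (x k.down * y k.down) • h 1 := by
    rw [← map_smul, smul_eq_mul, mul_one]
  have h3 := LinearMap.congr_fun hcomp ⟨_, hmem k.down⟩
  have h4 := (DFunLike.congr_fun h2 k).symm.trans (DFunLike.congr_fun h3 k)
  rw [Finsupp.smul_apply, hk, smul_zero, LinearMap.comp_apply, hF, finiteSupportMap_apply,
    mul_assoc, hyx, hxu] at h4
  apply hs0
  rw [← hus, ← hyx k.down, mul_smul, ← h4, smul_zero]

/-! ### The opposite of a graded ring -/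

theorem op_mem_opGrading {n : ℤ} {a : R} : MulOpposite.op a ∈ opGrading 𝒜 n ↔ a ∈ 𝒜 n := by
  constructor
  · rintro ⟨b, hb, h⟩
    rwa [← MulOpposite.op_injective h]
  · intro h; exact ⟨a, h, rfl⟩

theorem isGradedModule_opGrading (hA : IsGradedModule 𝒜 𝒜) :
    IsGradedModule (opGrading 𝒜) (opGrading 𝒜) := by
  let e : R ≃+ Rᵐᵒᵖ := MulOpposite.opAddEquiv
  refine ⟨isInternal_of_components (fun n => (e.toAddMonoidHom.comp
    (homogComp hA.isInternal n)).comp e.symm.toAddMonoidHom) ?_ ?_ ?_, ?_⟩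
  · rintro n _ ⟨a, ha, rfl⟩
    exact congrArg e (homogComp_of_mem hA.isInternal ha)
  · rintro m n hmn _ ⟨a, ha, rfl⟩
    exact (congrArg e (homogComp_of_mem_ne hA.isInternal ha hmn)).trans (map_zero e)
  · intro x
    obtain ⟨x, rfl⟩ := e.surjective x
    obtain ⟨s, hs⟩ := exists_sum_homogComp hA.isInternal x
    rw [← hs, map_sum]
    exact sum_mem fun n _ => AddSubgroup.mem_iSup_of_mem n ⟨_, homogComp_mem hA.isInternal n x, rfl⟩
  · rintro i j _ ⟨a, ha, rfl⟩ _ ⟨b, hb, rfl⟩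
    exact ⟨b * a, by rw [add_comm]; exact hA.smul_mem j i b hb a ha, rfl⟩

end Graded

/-! ### Paths -/


namespace DirGraph

variable {V : Type uV} {A : Type uA} {G : DirGraph V A}

namespace PathTo

/-- The source of a path. -/
def src {v : V} (p : G.PathTo v) : V := (p.1.head?.map G.s).getD v

/-- The path of length `0`. -/
def nil (v : V) : G.PathTo v := ⟨[], by simp, by simp⟩

theorem src_nil (v : V) : (nil v : G.PathTo v).src = v := rfl

/-- The path `e p`. -/
def cons {v : V} (e : A) (p : G.PathTo v) (h : G.r e = p.src) : G.PathTo v :=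
  ⟨e :: p.1, by
    obtain ⟨p, hp, hv⟩ := p
    cases p with
    | nil => simp
    | cons f l => exact List.isChain_cons_cons.2 ⟨h, hp⟩, by
    obtain ⟨p, hp, hv⟩ := p
    cases p with
    | nil => simpa using (show G.r e = v from h)
    | cons f l => simpa using hv⟩

theorem src_cons {v : V} (e : A) (p : G.PathTo v) (h : G.r e = p.src) : (cons e p h).src = G.s e :=
  rfl

theorem cons_val {v : V} (e : A) (p : G.PathTo v) (h : G.r e = p.src) :
    (cons e p h).1 = e :: p.1 := rfl

theorem exists_cons {v : V} (e : A) (l : List A) (hp : (e :: l).IsChain G.Follows ∧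
    ∀ f ∈ (e :: l).getLast?, G.r f = v) :
    ∃ (q : G.PathTo v) (h : G.r e = q.src), q.1 = l ∧ (⟨e :: l, hp⟩ : G.PathTo v) = cons e q h := by
  cases l with
  | nil => exact ⟨nil v, hp.2 e (by simp), rfl, rfl⟩
  | cons f l =>
    exact ⟨⟨f :: l, hp.1.tail, by simpa using hp.2⟩, (List.isChain_cons_cons.1 hp.1).1, rfl, rfl⟩

theorem induction {v : V} {motive : G.PathTo v → Prop} (nil : motive (nil v))
    (cons : ∀ e q h, motive q → motive (cons e q h)) (p : G.PathTo v) : motive p := by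
  obtain ⟨l, hl⟩ := p
  induction l with
  | nil => exact nil
  | cons e l ih =>
    obtain ⟨q, h, hq, hc⟩ := exists_cons e l hl
    rw [hc]
    subst hq
    exact cons e q h (ih q.2)

/-- The composition of paths. -/
def comp {u v : V} (p : G.PathTo u) (q : G.PathTo v) (h : q.src = u) : G.PathTo v :=
  ⟨p.1 ++ q.1, by
    obtain ⟨p, hp, hu⟩ := p
    obtain ⟨q, hq, hv⟩ := q
    refine List.isChain_append.2 ⟨hp, hq, fun x hx y hy => ?_⟩
    have := hu x hx
    cases q with
    | nil => simp at hy
    | cons f l =>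
      obtain rfl : f = y := by simpa using hy
      exact this.trans h.symm, by
    obtain ⟨p, hp, hu⟩ := p
    obtain ⟨q, hq, hv⟩ := q
    cases q with
    | nil =>
      obtain rfl : v = u := h
      simpa using hu
    | cons f l => simpa [List.getLast?_append] using hv⟩

theorem comp_val {u v : V} (p : G.PathTo u) (q : G.PathTo v) (h : q.src = u) :
    (comp p q h).1 = p.1 ++ q.1 := rfl

theorem src_comp {u v : V} (p : G.PathTo u) (q : G.PathTo v) (h : q.src = u) :
    (comp p q h).src = p.src := by
  obtain ⟨p, hp, hu⟩ := p
  cases p with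
  | nil => exact h
  | cons f l => rfl

theorem nil_comp {u v : V} (q : G.PathTo v) (h : q.src = u) : comp (nil u) q h = q := rfl

theorem cons_comp {u v : V} (e : A) (p : G.PathTo u) (q : G.PathTo v) (h : q.src = u)
    (hp : G.r e = p.src) :
    comp (cons e p hp) q h = cons e (comp p q h) (hp.trans (src_comp p q h).symm) := rfl

end PathTo

end DirGraph

/-! ### Leavitt path algebras -/

section Leavitt

variable (K : Type uK) [Field K] {V : Type uV} {A : Type uA} [Fintype V] [Fintype A]
  [DecidableEq V] (G : DirGraph V A)

/-- Elements of an algebra which satisfy the relations of the Leavitt path algebra. -/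
structure LeavittFamily (B : Type*) [Ring B] where
  /-- images of the vertices -/
  vert : V → B
  /-- images of the edges -/
  edge : A → B
  /-- images of the ghost edges -/
  ghost : A → B
  sum_vert : ∑ v, vert v = 1
  vert_self : ∀ v, vert v * vert v = vert v
  vert_ne : ∀ v w, v ≠ w → vert v * vert w = 0
  source_edge : ∀ e, vert (G.s e) * edge e = edge e
  edge_range : ∀ e, edge e * vert (G.r e) = edge e
  range_ghost : ∀ e, vert (G.r e) * ghost e = ghost e
  ghost_source : ∀ e, ghost e * vert (G.s e) = ghost e
  ck1_self : ∀ e, ghost e * edge e = vert (G.r e)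
  ck1_ne : ∀ e f, e ≠ f → ghost e * edge f = 0
  ck2 : ∀ v, (∃ e, G.s e = v) → vert v = ∑ e with G.s e = v, edge e * ghost e

namespace LeavittPathAlgebra

local notation "ν" v:max => gen K G (LeavittGen.vertex v)
local notation "ε" e:max => gen K G (LeavittGen.edge e)
local notation "γ" e:max => gen K G (LeavittGen.ghost e)

/-- The quotient map from the free algebra. -/
noncomputable def mk : FreeAlgebra K (LeavittGen V A) →ₐ[K] LeavittPathAlgebra K G :=
  RingQuot.mkAlgHom K (LeavittRel K G)

theorem mk_ι (x : LeavittGen V A) : mk K G (FreeAlgebra.ι K x) = gen K G x := rfl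

theorem mk_surjective : Function.Surjective (mk K G) := RingQuot.mkAlgHom_surjective K _

variable {K G} in
theorem mk_rel {x y : FreeAlgebra K (LeavittGen V A)} (h : LeavittRel K G x y) :
    mk K G x = mk K G y :=
  RingQuot.mkAlgHom_rel K h

theorem sum_vert : ∑ v : V, ν v = 1 := by
  simpa [mk_ι] using mk_rel (K := K) (LeavittRel.sum_vertex (G := G))

theorem vert_mul_self (v : V) : ν v * ν v = ν v := by
  simpa [mk_ι] using mk_rel (K := K) (LeavittRel.vertex_self (G := G) v)

theorem vert_mul_of_ne {v w : V} (h : v ≠ w) : ν v * ν w = 0 := by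
  simpa [mk_ι] using mk_rel (K := K) (LeavittRel.vertex_ne (G := G) v w h)

theorem source_mul_edge (e : A) : ν (G.s e) * ε e = ε e := by
  simpa [mk_ι] using mk_rel (K := K) (LeavittRel.source_edge (G := G) e)

theorem edge_mul_range (e : A) : ε e * ν (G.r e) = ε e := by
  simpa [mk_ι] using mk_rel (K := K) (LeavittRel.edge_range (G := G) e)

theorem range_mul_ghost (e : A) : ν (G.r e) * γ e = γ e := by
  simpa [mk_ι] using mk_rel (K := K) (LeavittRel.range_ghost (G := G) e)

theorem ghost_mul_source (e : A) : γ e * ν (G.s e) = γ e := by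
  simpa [mk_ι] using mk_rel (K := K) (LeavittRel.ghost_source (G := G) e)

theorem ghost_mul_edge_self (e : A) : γ e * ε e = ν (G.r e) := by
  simpa [mk_ι] using mk_rel (K := K) (LeavittRel.ck1_self (G := G) e)

theorem ghost_mul_edge_of_ne {e f : A} (h : e ≠ f) : γ e * ε f = 0 := by
  simpa [mk_ι] using mk_rel (K := K) (LeavittRel.ck1_ne (G := G) e f h)

theorem vert_eq_sum {v : V} (h : ∃ e, G.s e = v) : ν v = ∑ e with G.s e = v, ε e * γ e := by
  simpa [mk_ι] using mk_rel (K := K) (LeavittRel.ck2 (G := G) v h)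

theorem ghost_mul_vert_of_ne {e : A} {v : V} (h : G.s e ≠ v) : γ e * ν v = 0 := by
  rw [← ghost_mul_source, mul_assoc, vert_mul_of_ne K G h, mul_zero]

section Lift

variable {K G} {B : Type*} [Ring B] [Algebra K B]

/-- The universal property of the Leavitt path algebra. -/
noncomputable def lift (F : LeavittFamily G B) : LeavittPathAlgebra K G →ₐ[K] B :=
  RingQuot.liftAlgHom K ⟨FreeAlgebra.lift K fun
    | .vertex v => F.vert v
    | .edge e => F.edge e
    | .ghost e => F.ghost e, by
    intro x y h
    induction h with
    | sum_vertex => simpa using F.sum_vert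
    | vertex_self v => simpa using F.vert_self v
    | vertex_ne v w h => simpa using F.vert_ne v w h
    | source_edge e => simpa using F.source_edge e
    | edge_range e => simpa using F.edge_range e
    | range_ghost e => simpa using F.range_ghost e
    | ghost_source e => simpa using F.ghost_source e
    | ck1_self e => simpa using F.ck1_self e
    | ck1_ne e f h => simpa using F.ck1_ne e f h
    | ck2 v h => simpa using F.ck2 v h⟩

theorem lift_vert (F : LeavittFamily G B) (v : V) : lift (K := K) F (ν v) = F.vert v := by
  refine (RingQuot.liftAlgHom_mkAlgHom_apply K _ _ _).trans ?_
  simp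

theorem lift_edge (F : LeavittFamily G B) (e : A) : lift (K := K) F (ε e) = F.edge e := by
  refine (RingQuot.liftAlgHom_mkAlgHom_apply K _ _ _).trans ?_
  simp

theorem lift_ghost (F : LeavittFamily G B) (e : A) : lift (K := K) F (γ e) = F.ghost e := by
  refine (RingQuot.liftAlgHom_mkAlgHom_apply K _ _ _).trans ?_
  simp

end Lift

variable {K G}

/-- A subspace which is closed under left multiplication by the generators is a left ideal. -/
theorem mul_mem_of_gen {Y : Submodule K (LeavittPathAlgebra K G)}
    (hY : ∀ g, ∀ y ∈ Y, gen K G g * y ∈ Y) (x y : LeavittPathAlgebra K G) (hy : y ∈ Y) :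
    x * y ∈ Y := by
  obtain ⟨x, rfl⟩ := mk_surjective K G x
  induction x using FreeAlgebra.induction generalizing y with
  | grade0 r => rw [AlgHom.commutes, ← Algebra.smul_def]; exact Y.smul_mem r hy
  | grade1 g => exact hY g y hy
  | mul a b ha hb => rw [map_mul, mul_assoc]; exact ha _ (hb _ hy)
  | add a b ha hb => rw [map_add, add_mul]; exact Y.add_mem (ha _ hy) (hb _ hy)

open DirGraph

theorem ofPath_nil (v : V) : ofPath K G (PathTo.nil v) = ν v := one_mul _

theorem ofPath_cons {v : V} (e : A) (p : G.PathTo v) (h : G.r e = p.src) :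
    ofPath K G (p.cons e h) = ε e * ofPath K G p := by
  simp [ofPath, PathTo.cons_val, mul_assoc]

theorem ofGhostPath_nil (v : V) : ofGhostPath K G (PathTo.nil v) = ν v := mul_one _

theorem ofGhostPath_cons {v : V} (e : A) (p : G.PathTo v) (h : G.r e = p.src) :
    ofGhostPath K G (p.cons e h) = ofGhostPath K G p * γ e := by
  simp [ofGhostPath, PathTo.cons_val, mul_assoc]

theorem ofPath_mul_vert {v : V} (p : G.PathTo v) : ofPath K G p * ν v = ofPath K G p := by
  rw [ofPath, mul_assoc, vert_mul_self]

theorem vert_mul_ofGhostPath {v : V} (p : G.PathTo v) :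
    ν v * ofGhostPath K G p = ofGhostPath K G p := by
  rw [ofGhostPath, ← mul_assoc, vert_mul_self]

theorem src_mul_ofPath {v : V} (p : G.PathTo v) : ν p.src * ofPath K G p = ofPath K G p := by
  induction p using PathTo.induction with
  | nil => rw [ofPath_nil, PathTo.src_nil, vert_mul_self]
  | cons e q h => rw [ofPath_cons, PathTo.src_cons, ← mul_assoc, source_mul_edge]

theorem ofGhostPath_mul_src {v : V} (p : G.PathTo v) :
    ofGhostPath K G p * ν p.src = ofGhostPath K G p := by
  induction p using PathTo.induction with
  | nil => rw [ofGhostPath_nil, PathTo.src_nil, vert_mul_self]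
  | cons e q h => rw [ofGhostPath_cons, PathTo.src_cons, mul_assoc, ghost_mul_source]

theorem vert_mul_ofPath_of_ne {u v : V} (p : G.PathTo v) (h : u ≠ p.src) :
    ν u * ofPath K G p = 0 := by
  rw [← src_mul_ofPath, ← mul_assoc, vert_mul_of_ne K G h, zero_mul]

theorem ofPath_comp {u v : V} (p : G.PathTo u) (q : G.PathTo v) (h : q.src = u) :
    ofPath K G (p.comp q h) = ofPath K G p * ofPath K G q := by
  induction p using PathTo.induction with
  | nil => rw [PathTo.nil_comp, ofPath_nil, ← h, src_mul_ofPath]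
  | cons e p hp ih => rw [PathTo.cons_comp, ofPath_cons, ofPath_cons, ih, mul_assoc]

theorem ofGhostPath_comp {u v : V} (p : G.PathTo u) (q : G.PathTo v) (h : q.src = u) :
    ofGhostPath K G (p.comp q h) = ofGhostPath K G q * ofGhostPath K G p := by
  induction p using PathTo.induction with
  | nil => rw [PathTo.nil_comp, ofGhostPath_nil, ← h, ofGhostPath_mul_src]
  | cons e p hp ih => rw [PathTo.cons_comp, ofGhostPath_cons, ofGhostPath_cons, ih, mul_assoc]

theorem ofGhostPath_mul_ofPath {v : V} (p : G.PathTo v) :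
    ofGhostPath K G p * ofPath K G p = ν v := by
  induction p using PathTo.induction with
  | nil => rw [ofGhostPath_nil, ofPath_nil, vert_mul_self]
  | cons e q h ih =>
    rw [ofGhostPath_cons, ofPath_cons, mul_assoc, ← mul_assoc (γ e), ghost_mul_edge_self, h,
      src_mul_ofPath, ih]

/-! ### The grading of a Leavitt path algebra -/

theorem ofPath_mul_ofGhostPath_mem {v : V} (p q : G.PathTo v) :
    ofPath K G p * ofGhostPath K G q ∈ grading K G (p.1.length - q.1.length) :=
  Submodule.subset_span ⟨v, p, q, rfl, rfl⟩

theorem grading_induction {n : ℤ} {P : LeavittPathAlgebra K G → Prop}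
    (mem : ∀ (v : V) (p q : G.PathTo v), (p.1.length : ℤ) - q.1.length = n →
      P (ofPath K G p * ofGhostPath K G q))
    (zero : P 0) (add : ∀ x y, P x → P y → P (x + y)) (smul : ∀ (k : K) x, P x → P (k • x))
    {x : LeavittPathAlgebra K G} (hx : x ∈ grading K G n) : P x := by
  refine Submodule.span_induction ?_ zero (fun x y _ _ => add x y) (fun k x _ => smul k x) hx
  rintro _ ⟨v, p, q, h, rfl⟩
  exact mem v p q h

theorem smul_mem_grading {n : ℤ} (k : K) {x : LeavittPathAlgebra K G} (hx : x ∈ grading K G n) :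
    k • x ∈ grading K G n :=
  Submodule.smul_mem (Submodule.span K _) k hx

theorem vert_mem_grading (v : V) : ν v ∈ grading K G 0 := by
  have := ofPath_mul_ofGhostPath_mem (K := K) (PathTo.nil v : G.PathTo v) (PathTo.nil v)
  rwa [ofPath_nil, ofGhostPath_nil, vert_mul_self, sub_self] at this

theorem one_mem_grading : (1 : LeavittPathAlgebra K G) ∈ grading K G 0 := by
  rw [← sum_vert]; exact sum_mem fun v _ => vert_mem_grading v

theorem vert_mul_mem_grading {n : ℤ} (v : V) {x : LeavittPathAlgebra K G}
    (hx : x ∈ grading K G n) : ν v * x ∈ grading K G n := by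
  refine grading_induction (P := fun x => ν v * x ∈ grading K G n) ?_ ?_ ?_ ?_ hx
  · rintro w p q rfl
    rw [← mul_assoc]
    by_cases h : v = p.src
    · rw [h, src_mul_ofPath]; exact ofPath_mul_ofGhostPath_mem p q
    · rw [vert_mul_ofPath_of_ne p h, zero_mul]; exact zero_mem _
  · rw [mul_zero]; exact zero_mem _
  · intro x y hx hy; rw [mul_add]; exact add_mem hx hy
  · intro k x hx; rw [mul_smul_comm]; exact smul_mem_grading k hx

theorem edge_mul_mem_grading {n : ℤ} (e : A) {x : LeavittPathAlgebra K G}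
    (hx : x ∈ grading K G n) : ε e * x ∈ grading K G (n + 1) := by
  refine grading_induction (P := fun x => ε e * x ∈ grading K G (n + 1)) ?_ ?_ ?_ ?_ hx
  · rintro w p q rfl
    rw [← mul_assoc]
    by_cases h : G.r e = p.src
    · rw [← ofPath_cons e p h]
      have := ofPath_mul_ofGhostPath_mem (K := K) (p.cons e h) q
      convert this using 2
      rw [PathTo.cons_val, List.length_cons]; push_cast; ring
    · rw [← edge_mul_range, mul_assoc (ε e), vert_mul_ofPath_of_ne p h, mul_zero, zero_mul]
      exact zero_mem _
  · rw [mul_zero]; exact zero_mem _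
  · intro x y hx hy; rw [mul_add]; exact add_mem hx hy
  · intro k x hx; rw [mul_smul_comm]; exact smul_mem_grading k hx

theorem ghost_mul_mem_grading {n : ℤ} (e : A) {x : LeavittPathAlgebra K G}
    (hx : x ∈ grading K G n) : γ e * x ∈ grading K G (n - 1) := by
  refine grading_induction (P := fun x => γ e * x ∈ grading K G (n - 1)) ?_ ?_ ?_ ?_ hx
  · rintro w p q rfl
    induction p using PathTo.induction with
    | nil =>
      rw [ofPath_nil, ← mul_assoc]
      by_cases h : G.s e = w
      · subst h
        have h1 : G.r e = (PathTo.nil (G.r e) : G.PathTo (G.r e)).src := rfl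
        have := ofPath_mul_ofGhostPath_mem (K := K) (PathTo.nil (G.r e))
          (q.comp ((PathTo.nil (G.r e)).cons e h1) (PathTo.src_cons e _ h1))
        have h2 := ofGhostPath_comp (K := K) q ((PathTo.nil (G.r e)).cons e h1)
          (PathTo.src_cons e _ h1)
        have h3 :
            ((q.comp ((PathTo.nil (G.r e)).cons e h1) (PathTo.src_cons e _ h1)).1.length : ℤ) =
            q.1.length + 1 := by
          rw [PathTo.comp_val, List.length_append]; rfl
        rw [h3, h2, ofPath_nil, ofGhostPath_cons, ofGhostPath_nil, range_mul_ghost,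
          ← mul_assoc, range_mul_ghost] at this
        rw [ghost_mul_source]
        convert this using 2
        simp only [PathTo.nil, List.length_nil]; ring
      · rw [ghost_mul_vert_of_ne K G h, zero_mul]; exact zero_mem _
    | cons f p h =>
      rw [ofPath_cons, ← mul_assoc, ← mul_assoc]
      by_cases hef : e = f
      · subst hef
        rw [ghost_mul_edge_self, h, src_mul_ofPath]
        have := ofPath_mul_ofGhostPath_mem (K := K) p q
        convert this using 2
        rw [PathTo.cons_val, List.length_cons]; push_cast; ring
      · rw [ghost_mul_edge_of_ne K G hef, zero_mul, zero_mul]; exact zero_mem _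
  · rw [mul_zero]; exact zero_mem _
  · intro x y hx hy; rw [mul_add]; exact add_mem hx hy
  · intro k x hx; rw [mul_smul_comm]; exact smul_mem_grading k hx

theorem ofGhostPath_mul_mem_grading {n : ℤ} {v : V} (q : G.PathTo v) {x : LeavittPathAlgebra K G}
    (hx : x ∈ grading K G n) : ofGhostPath K G q * x ∈ grading K G (n - q.1.length) := by
  induction q using PathTo.induction generalizing n x with
  | nil =>
    rw [ofGhostPath_nil]
    simpa [PathTo.nil] using vert_mul_mem_grading v hx
  | cons e q h ih =>
    rw [ofGhostPath_cons, mul_assoc]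
    convert ih (ghost_mul_mem_grading e hx) using 2
    rw [PathTo.cons_val, List.length_cons]; push_cast; ring

theorem ofPath_mul_mem_grading {n : ℤ} {v : V} (p : G.PathTo v) {x : LeavittPathAlgebra K G}
    (hx : x ∈ grading K G n) : ofPath K G p * x ∈ grading K G (p.1.length + n) := by
  induction p using PathTo.induction with
  | nil =>
    rw [ofPath_nil]
    simpa [PathTo.nil] using vert_mul_mem_grading v hx
  | cons e q h ih =>
    rw [ofPath_cons, mul_assoc]
    convert edge_mul_mem_grading e ih using 2
    rw [PathTo.cons_val, List.length_cons]; push_cast; ring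

theorem mul_mem_grading {m n : ℤ} {x y : LeavittPathAlgebra K G} (hx : x ∈ grading K G m)
    (hy : y ∈ grading K G n) : x * y ∈ grading K G (m + n) := by
  refine grading_induction (P := fun x => x * y ∈ grading K G (m + n)) ?_ ?_ ?_ ?_ hx
  · rintro w p q rfl
    rw [mul_assoc]
    convert ofPath_mul_mem_grading p (ofGhostPath_mul_mem_grading q hy) using 2
    ring
  · rw [zero_mul]; exact zero_mem _
  · intro x y hx hy; rw [add_mul]; exact add_mem hx hy
  · intro k x hx; rw [smul_mul_assoc]; exact smul_mem_grading k hx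

theorem edge_mem_grading (e : A) : ε e ∈ grading K G 1 := by
  simpa using edge_mul_mem_grading e (one_mem_grading (K := K) (G := G))

theorem ghost_mem_grading (e : A) : γ e ∈ grading K G (-1) := by
  simpa using ghost_mul_mem_grading e (one_mem_grading (K := K) (G := G))

theorem ofPath_mem_grading {v : V} (p : G.PathTo v) : ofPath K G p ∈ grading K G p.1.length := by
  simpa using ofPath_mul_mem_grading p (one_mem_grading (K := K) (G := G))

theorem ofGhostPath_mem_grading {v : V} (p : G.PathTo v) :
    ofGhostPath K G p ∈ grading K G (-p.1.length) := by
  simpa using ofGhostPath_mul_mem_grading p (one_mem_grading (K := K) (G := G))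

theorem mem_iSup_grading (x : LeavittPathAlgebra K G) : x ∈ ⨆ n, grading K G n := by
  let Y : Submodule K (LeavittPathAlgebra K G) :=
    { (⨆ n, grading K G n).toAddSubmonoid with
      smul_mem' := fun k x hx => by
        have : (⨆ n, grading K G n) ≤ (⨆ n, grading K G n).comap
            (Algebra.lmul K (LeavittPathAlgebra K G) (algebraMap K _ k)).toAddMonoidHom :=
          iSup_le fun n x hx => AddSubgroup.mem_iSup_of_mem n (by
            have := smul_mem_grading k hx
            rwa [Algebra.smul_def] at this)
        rw [Algebra.smul_def]
        exact this hx }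
  have key : ∀ (z : LeavittPathAlgebra K G) (d : ℤ), z ∈ grading K G d → ∀ y ∈ Y, z * y ∈ Y := by
    intro z d hz y hy
    have : (⨆ n, grading K G n) ≤ (⨆ n, grading K G n).comap (AddMonoidHom.mulLeft z) :=
      iSup_le fun n x hx => AddSubgroup.mem_iSup_of_mem _ (mul_mem_grading hz hx)
    exact this hy
  have := mul_mem_of_gen (Y := Y) (fun g y hy => ?_) x 1
    (AddSubgroup.mem_iSup_of_mem 0 one_mem_grading)
  · rwa [mul_one] at this
  · cases g with
    | vertex v => exact key _ _ (vert_mem_grading v) y hy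
    | edge e => exact key _ _ (edge_mem_grading e) y hy
    | ghost e => exact key _ _ (ghost_mem_grading e) y hy

/-- A homomorphism into a graded algebra which maps the generators to homogeneous elements of the
right degrees preserves degrees. -/
theorem map_mem_of_mem_grading {B : Type*} [Ring B] [Algebra K B] {ℬ : ℤ → AddSubgroup B}
    (hmul : ∀ m n x y, x ∈ ℬ m → y ∈ ℬ n → x * y ∈ ℬ (m + n))
    (hsmul : ∀ n (k : K) x, x ∈ ℬ n → k • x ∈ ℬ n) (f : LeavittPathAlgebra K G →ₐ[K] B)
    (hv : ∀ v, f (ν v) ∈ ℬ 0) (he : ∀ e, f (ε e) ∈ ℬ 1) (hg : ∀ e, f (γ e) ∈ ℬ (-1))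
    {n : ℤ} {x : LeavittPathAlgebra K G} (hx : x ∈ grading K G n) : f x ∈ ℬ n := by
  have hp : ∀ (v : V) (p : G.PathTo v), f (ofPath K G p) ∈ ℬ p.1.length := by
    intro v p
    induction p using PathTo.induction with
    | nil => rw [ofPath_nil]; exact hv v
    | cons e q h ih =>
      rw [ofPath_cons, map_mul]
      convert hmul _ _ _ _ (he e) ih using 2
      rw [PathTo.cons_val, List.length_cons]; push_cast; ring
  have hq : ∀ (v : V) (p : G.PathTo v), f (ofGhostPath K G p) ∈ ℬ (-p.1.length) := by
    intro v p
    induction p using PathTo.induction with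
    | nil => rw [ofGhostPath_nil]; exact hv v
    | cons e q h ih =>
      rw [ofGhostPath_cons, map_mul]
      convert hmul _ _ _ _ ih (hg e) using 2
      rw [PathTo.cons_val, List.length_cons]; push_cast; ring
  refine grading_induction (P := fun x => f x ∈ ℬ n) ?_ ?_ ?_ ?_ hx
  · rintro v p q rfl
    rw [map_mul, sub_eq_add_neg]; exact hmul _ _ _ _ (hp v p) (hq v q)
  · rw [map_zero]; exact zero_mem _
  · intro x y hx hy; rw [map_add]; exact add_mem hx hy
  · intro k x hx; rw [map_smul]; exact hsmul n k _ hx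

variable (K G) in
/-- The family `v, e T, e* T⁻¹` in `L[T, T⁻¹]`. -/
noncomputable def laurentFamily : LeavittFamily G (LeavittPathAlgebra K G)[T;T⁻¹] where
  vert v := AddMonoidAlgebra.single 0 (ν v)
  edge e := AddMonoidAlgebra.single 1 (ε e)
  ghost e := AddMonoidAlgebra.single (-1) (γ e)
  sum_vert := by
    refine Eq.trans ?_ (congrArg (AddMonoidAlgebra.single 0) (sum_vert K G))
    exact (map_sum (AddMonoidAlgebra.singleAddHom 0) _ _).symm
  vert_self v := by rw [AddMonoidAlgebra.single_mul_single, vert_mul_self]; rfl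
  vert_ne v w h := by rw [AddMonoidAlgebra.single_mul_single, vert_mul_of_ne K G h]; simp
  source_edge e := by rw [AddMonoidAlgebra.single_mul_single, source_mul_edge]; rfl
  edge_range e := by rw [AddMonoidAlgebra.single_mul_single, edge_mul_range]; rfl
  range_ghost e := by rw [AddMonoidAlgebra.single_mul_single, range_mul_ghost]; rfl
  ghost_source e := by rw [AddMonoidAlgebra.single_mul_single, ghost_mul_source]; rfl
  ck1_self e := by rw [AddMonoidAlgebra.single_mul_single, ghost_mul_edge_self]; rfl
  ck1_ne e f h := by rw [AddMonoidAlgebra.single_mul_single, ghost_mul_edge_of_ne K G h]; simp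
  ck2 v h := by
    rw [vert_eq_sum K G h]
    simp only [AddMonoidAlgebra.single_mul_single]
    exact map_sum (AddMonoidAlgebra.singleAddHom 0) _ _

/-- The components are independent because the homomorphism `L → L[T, T⁻¹]` with `e ↦ e T` and
`e* ↦ e* T⁻¹` multiplies elements of degree `n` by `T ^ n`. -/
theorem isGradedModule_grading :
    IsGradedModule (grading K G) (grading K G) := by
  have hp : ∀ (v : V) (p : G.PathTo v), lift (K := K) (laurentFamily K G) (ofPath K G p) =
      AddMonoidAlgebra.single (p.1.length : ℤ) (ofPath K G p) := by
    intro v p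
    induction p using PathTo.induction with
    | nil => rw [ofPath_nil, lift_vert]; rfl
    | cons e q h ih =>
      rw [ofPath_cons, map_mul, lift_edge, ih]
      refine (AddMonoidAlgebra.single_mul_single _ _ _ _).trans ?_
      rw [PathTo.cons_val, List.length_cons]; push_cast; rw [add_comm]
  have hq : ∀ (v : V) (p : G.PathTo v), lift (K := K) (laurentFamily K G) (ofGhostPath K G p) =
      AddMonoidAlgebra.single (-p.1.length : ℤ) (ofGhostPath K G p) := by
    intro v p
    induction p using PathTo.induction with
    | nil => rw [ofGhostPath_nil, lift_vert]; rfl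
    | cons e q h ih =>
      rw [ofGhostPath_cons, map_mul, lift_ghost, ih]
      refine (AddMonoidAlgebra.single_mul_single _ _ _ _).trans ?_
      rw [PathTo.cons_val, List.length_cons]; push_cast; rw [neg_add]
  have key : ∀ n, ∀ x ∈ grading K G n,
      lift (K := K) (laurentFamily K G) x = AddMonoidAlgebra.single n x := by
    intro n x hx
    refine grading_induction (P := fun x => lift (K := K) (laurentFamily K G) x =
      AddMonoidAlgebra.single n x) ?_ ?_ ?_ ?_ hx
    · rintro v p q rfl
      rw [map_mul, hp, hq, AddMonoidAlgebra.single_mul_single, sub_eq_add_neg]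
    · simp
    · intro x y hx hy; rw [map_add, hx, hy, AddMonoidAlgebra.single_add]
    · intro k x hx; rw [map_smul, hx, AddMonoidAlgebra.smul_single]
  let π : ℤ → LeavittPathAlgebra K G →+ LeavittPathAlgebra K G := fun n =>
    { toFun := fun x => (lift (K := K) (laurentFamily K G) x).coeff n
      map_zero' := by simp
      map_add' := by simp }
  refine ⟨isInternal_of_components π (fun n x hx => ?_) (fun m n hmn x hx => ?_) mem_iSup_grading,
    fun i j a ha m hm => mul_mem_grading ha hm⟩
  · change (lift (K := K) (laurentFamily K G) x).coeff n = x
    rw [key n x hx]; exact Finsupp.single_eq_same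
  · change (lift (K := K) (laurentFamily K G) x).coeff n = 0
    rw [key m x hx]; exact Finsupp.single_eq_of_ne (Ne.symm hmn)

end LeavittPathAlgebra

end Leavitt

/-! ### Weighted branching systems -/

section Branching

variable {V : Type uV} {A : Type uA}

/-- A weighted branching system of a graph: a set `I` over the vertices in which every element `p`
over a vertex which is not a sink is decomposed uniquely as `e q`, for an edge `e` and an element
`q` over the range of `e`, up to a unit `wt p` of `R`.  The model is the set of paths ending at a
sink, with the weights `1`. -/
structure BranchingSystem (G : DirGraph V A) (R : Type*) [CommRing R] (I : Type*) where
  /-- the vertex below an element -/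
  src : I → V
  /-- the decomposition of an element into its first edge and the remainder -/
  dec : I → Option (A × I)
  /-- the weight of the decomposition -/
  wt : I → Rˣ
  sink_of_dec : ∀ p, dec p = none → ∀ e, G.s e ≠ src p
  source_eq : ∀ p e q, dec p = some (e, q) → G.s e = src p
  range_eq : ∀ p e q, dec p = some (e, q) → G.r e = src q
  dec_inj : ∀ p p' e q, dec p = some (e, q) → dec p' = some (e, q) → p = p'
  exists_dec : ∀ e q, G.r e = src q → ∃ p, dec p = some (e, q)

namespace BranchingSystem

variable {G : DirGraph V A} {R : Type*} [CommRing R] {I : Type*} (S : BranchingSystem G R I)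

open Classical in
/-- A vertex acts on functions by restriction to the elements over it. -/
noncomputable def vertMap (v : V) : Module.End R (I → R) where
  toFun g p := if S.src p = v then g p else 0
  map_add' g h := by ext p; simp only [Pi.add_apply]; split_ifs <;> simp
  map_smul' r g := by ext p; simp

open Classical in
/-- An edge `e` sends the indicator function of `q` to a multiple of that of `e q`. -/
noncomputable def edgeMap (e : A) : Module.End R (I → R) where
  toFun g p := (S.dec p).elim 0 fun x => if x.1 = e then (S.wt p : R) * g x.2 else 0
  map_add' g h := by
    ext p
    cases hp : S.dec p with
    | none => simp [hp]
    | some x =>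
      simp only [Pi.add_apply, hp, Option.elim_some]; split_ifs <;> simp [mul_add]
  map_smul' r g := by
    ext p
    cases hp : S.dec p with
    | none => simp [hp]
    | some x => simp [hp, mul_left_comm]

open Classical in
/-- A ghost edge acts as the inverse of the edge. -/
noncomputable def ghostMap (e : A) : Module.End R (I → R) where
  toFun g q := if h : ∃ p, S.dec p = some (e, q) then
    (↑(S.wt h.choose)⁻¹ : R) * g h.choose else 0
  map_add' g h := by ext q; simp only [Pi.add_apply]; split_ifs <;> simp [mul_add]
  map_smul' r g := by ext q; simp [mul_left_comm]

variable {S}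

theorem vertMap_apply_self (g : I → R) {p : I} {v : V} (h : S.src p = v) :
    S.vertMap v g p = g p := if_pos h

theorem vertMap_apply_of_ne (g : I → R) {p : I} {v : V} (h : S.src p ≠ v) :
    S.vertMap v g p = 0 := if_neg h

theorem edgeMap_apply_of_dec (g : I → R) {p : I} {e : A} {q : I} (h : S.dec p = some (e, q)) :
    S.edgeMap e g p = S.wt p * g q := by
  simp [edgeMap, h]

theorem edgeMap_apply_of_dec_ne (g : I → R) {p : I} {e f : A} {q : I} (h : S.dec p = some (f, q))
    (hne : f ≠ e) : S.edgeMap e g p = 0 := by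
  simp [edgeMap, h, hne]

theorem edgeMap_apply_of_none (g : I → R) {p : I} {e : A} (h : S.dec p = none) :
    S.edgeMap e g p = 0 := by
  simp [edgeMap, h]

theorem edgeMap_apply_of_src_ne (g : I → R) {p : I} {e : A} (h : S.src p ≠ G.s e) :
    S.edgeMap e g p = 0 := by
  cases hp : S.dec p with
  | none => exact edgeMap_apply_of_none g hp
  | some x =>
    refine edgeMap_apply_of_dec_ne g hp fun hx => h ?_
    rw [← hx]; exact (S.source_eq p x.1 x.2 hp).symm

theorem ghostMap_apply_of_dec (g : I → R) {p : I} {e : A} {q : I} (h : S.dec p = some (e, q)) :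
    S.ghostMap e g q = (↑(S.wt p)⁻¹ : R) * g p := by
  have hex : ∃ p, S.dec p = some (e, q) := ⟨p, h⟩
  have : hex.choose = p := S.dec_inj _ _ e q hex.choose_spec h
  refine (dif_pos hex).trans ?_
  rw [this]

theorem ghostMap_apply_of_ne (g : I → R) {e : A} {q : I} (h : S.src q ≠ G.r e) :
    S.ghostMap e g q = 0 :=
  dif_neg fun ⟨p, hp⟩ => h (S.range_eq p e q hp).symm

variable (S) [Fintype V] [Fintype A] [DecidableEq V]

/-- The operators of a branching system satisfy the relations of the Leavitt path algebra. -/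
noncomputable def family : LeavittFamily G (Module.End R (I → R)) where
  vert := S.vertMap
  edge := S.edgeMap
  ghost := S.ghostMap
  sum_vert := by
    ext1 g; ext p
    rw [LinearMap.sum_apply, Finset.sum_apply, Finset.sum_eq_single (S.src p)]
    · exact vertMap_apply_self g rfl
    · intro v _ hv; exact vertMap_apply_of_ne g (Ne.symm hv)
    · simp
  vert_self v := by
    ext1 g; ext p
    by_cases h : S.src p = v
    · rw [Module.End.mul_apply, vertMap_apply_self _ h]
    · rw [Module.End.mul_apply, vertMap_apply_of_ne _ h, vertMap_apply_of_ne _ h]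
  vert_ne v w hvw := by
    ext1 g; ext p
    by_cases h : S.src p = v
    · rw [Module.End.mul_apply, vertMap_apply_self _ h, vertMap_apply_of_ne _ (h ▸ hvw)]; rfl
    · rw [Module.End.mul_apply, vertMap_apply_of_ne _ h]; rfl
  source_edge e := by
    ext1 g; ext p
    by_cases h : S.src p = G.s e
    · rw [Module.End.mul_apply, vertMap_apply_self _ h]
    · rw [Module.End.mul_apply, vertMap_apply_of_ne _ h, edgeMap_apply_of_src_ne _ h]
  edge_range e := by
    ext1 g; ext p
    rw [Module.End.mul_apply]
    cases hp : S.dec p with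
    | none => rw [edgeMap_apply_of_none _ hp, edgeMap_apply_of_none _ hp]
    | some x =>
      obtain ⟨f, q⟩ := x
      by_cases h : f = e
      · subst h
        rw [edgeMap_apply_of_dec _ hp, edgeMap_apply_of_dec _ hp,
          vertMap_apply_self _ (S.range_eq p f q hp).symm]
      · rw [edgeMap_apply_of_dec_ne _ hp h, edgeMap_apply_of_dec_ne _ hp h]
  range_ghost e := by
    ext1 g; ext q
    by_cases h : S.src q = G.r e
    · rw [Module.End.mul_apply, vertMap_apply_self _ h]
    · rw [Module.End.mul_apply, vertMap_apply_of_ne _ h, ghostMap_apply_of_ne _ h]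
  ghost_source e := by
    ext1 g; ext q
    rw [Module.End.mul_apply]
    by_cases h : S.src q = G.r e
    · obtain ⟨p, hp⟩ := S.exists_dec e q h.symm
      rw [ghostMap_apply_of_dec _ hp, ghostMap_apply_of_dec _ hp,
        vertMap_apply_self _ (S.source_eq p e q hp).symm]
    · rw [ghostMap_apply_of_ne _ h, ghostMap_apply_of_ne _ h]
  ck1_self e := by
    ext1 g; ext q
    rw [Module.End.mul_apply]
    by_cases h : S.src q = G.r e
    · obtain ⟨p, hp⟩ := S.exists_dec e q h.symm
      rw [ghostMap_apply_of_dec _ hp, edgeMap_apply_of_dec _ hp, vertMap_apply_self _ h,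
        Units.inv_mul_cancel_left]
    · rw [ghostMap_apply_of_ne _ h, vertMap_apply_of_ne _ h]
  ck1_ne e f hef := by
    ext1 g; ext q
    rw [Module.End.mul_apply]
    by_cases h : S.src q = G.r e
    · obtain ⟨p, hp⟩ := S.exists_dec e q h.symm
      rw [ghostMap_apply_of_dec _ hp, edgeMap_apply_of_dec_ne _ hp hef, mul_zero]; rfl
    · rw [ghostMap_apply_of_ne _ h]; rfl
  ck2 v hv := by
    ext1 g; ext p
    rw [LinearMap.sum_apply, Finset.sum_apply]
    by_cases h : S.src p = v
    · cases hp : S.dec p with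
      | none =>
        obtain ⟨e, he⟩ := hv
        exact absurd (he.trans h.symm) (S.sink_of_dec p hp e)
      | some x =>
        obtain ⟨e, q⟩ := x
        rw [vertMap_apply_self _ h, Finset.sum_eq_single e, Module.End.mul_apply,
          edgeMap_apply_of_dec _ hp, ghostMap_apply_of_dec _ hp, Units.mul_inv_cancel_left]
        · intro f _ hf
          rw [Module.End.mul_apply, edgeMap_apply_of_dec_ne _ hp (Ne.symm hf)]
        · intro he
          exact absurd ((S.source_eq p e q hp).trans h) (by simpa using he)
    · rw [vertMap_apply_of_ne _ h]
      refine (Finset.sum_eq_zero fun e he => ?_).symm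
      rw [Module.End.mul_apply, edgeMap_apply_of_src_ne]
      rw [(Finset.mem_filter.1 he).2]; exact h

/-- The representation of the Leavitt path algebra on functions on a branching system. -/
noncomputable def toEnd (K : Type uK) [Field K] [Algebra K R] :
    LeavittPathAlgebra K G →ₐ[K] Module.End R (I → R) :=
  LeavittPathAlgebra.lift S.family

end BranchingSystem

variable [Fintype V] [Fintype A] [DecidableEq V]

/-- Vertices are nonzero: there is a branching system over any graph all whose fibres are countably
infinite. -/
theorem LeavittPathAlgebra.vert_ne_zero (K : Type uK) [Field K] (G : DirGraph V A) (v : V) :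
    gen K G (.vertex v) ≠ 0 := by
  classical
  have hσ : ∀ v : V, (∃ e, G.s e = v) → Nonempty (ℕ ≃ {e : A // G.s e = v} × ℕ) := by
    rintro v ⟨e, he⟩
    have : Nonempty {e : A // G.s e = v} := ⟨⟨e, he⟩⟩
    exact nonempty_equiv_of_countable
  obtain ⟨σ⟩ : Nonempty (∀ v : V, (∃ e, G.s e = v) → ℕ ≃ {e : A // G.s e = v} × ℕ) :=
    ⟨fun v h => (hσ v h).some⟩
  let S : BranchingSystem G K (V × ℕ) :=
    { src := Prod.fst
      dec := fun p => if h : ∃ e, G.s e = p.1 then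
        some ((σ p.1 h p.2).1, (G.r (σ p.1 h p.2).1, (σ p.1 h p.2).2)) else none
      wt := fun _ => 1
      sink_of_dec := by
        intro p hp e he
        rw [dif_pos ⟨e, he⟩] at hp
        cases hp
      source_eq := by
        intro p e q hp
        split_ifs at hp with h
        cases hp
        exact (σ p.1 h p.2).1.2
      range_eq := by
        intro p e q hp
        split_ifs at hp with h
        cases hp
        rfl
      dec_inj := by
        rintro ⟨v, m⟩ ⟨v', m'⟩ e q hp hp'
        split_ifs at hp with h
        split_ifs at hp' with h'
        simp only [Option.some.injEq, Prod.mk.injEq] at hp hp'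
        obtain rfl : v = v' := by
          rw [← (σ v h m).1.2, ← (σ v' h' m').1.2, hp.1, hp'.1]
        have : σ v h m = σ v h m' := by
          refine Prod.ext (Subtype.ext (hp.1.trans hp'.1.symm)) ?_
          have h1 := hp.2
          rw [← hp'.2] at h1
          exact (Prod.mk.inj h1).2
        rw [(σ v h).injective this]
      exists_dec := by
        rintro e ⟨u, m⟩ rfl
        have h : ∃ f, G.s f = G.s e := ⟨e, rfl⟩
        refine ⟨(G.s e, (σ (G.s e) h).symm (⟨e, rfl⟩, m)), ?_⟩
        rw [dif_pos h]
        simp }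
  intro h
  have h1 := congrArg (fun x => S.toEnd K x (fun _ => 1) (v, 0)) h
  simp only [BranchingSystem.toEnd, lift_vert, map_zero] at h1
  rw [show S.family.vert v = S.vertMap v from rfl,
    BranchingSystem.vertMap_apply_self _ (by rfl)] at h1
  exact one_ne_zero h1

end Branching

/-! ### Cycles with exits -/

section MatrixUnits

variable {R : Type*} [Ring R] {c d v f h : R}

theorem pow_mul_pow_mul_of_left_inverse (hdc : d * c = v) (hvc : v * c = c) (k : ℕ) {z : R}
    (hz : v * z = z) : d ^ k * (c ^ k * z) = z := by
  induction k with
  | zero => simp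
  | succ k ih =>
    have hck : v * (c ^ k * z) = c ^ k * z := by
      cases k with
      | zero => simpa using hz
      | succ k => rw [pow_succ', mul_assoc, ← mul_assoc, hvc]
    rw [pow_succ, pow_succ', mul_assoc, mul_assoc, ← mul_assoc d, hdc, hck, ih]

/-- If `d c = v` and `f` is orthogonal to `c`, then the elements `cᵏ f` behave like the first
column of an infinite family of matrix units. -/
theorem mul_pow_mul_pow_mul_of_ne (hdc : d * c = v) (hvc : v * c = c) (hvf : v * f = f)
    (hhc : h * c = 0) (hdf : d * f = 0) {j k : ℕ} (hjk : j ≠ k) :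
    h * d ^ j * (c ^ k * f) = 0 := by
  rcases Nat.lt_or_gt_of_ne hjk with hlt | hlt
  · obtain ⟨m, rfl⟩ := Nat.exists_eq_add_of_lt hlt
    rw [add_assoc, pow_add, mul_assoc, mul_assoc (c ^ j),
      pow_mul_pow_mul_of_left_inverse hdc hvc j, pow_succ', ← mul_assoc, ← mul_assoc, hhc,
      zero_mul, zero_mul]
    rw [pow_succ', ← mul_assoc, ← mul_assoc, hvc]
  · obtain ⟨m, rfl⟩ := Nat.exists_eq_add_of_lt hlt
    rw [add_assoc, add_comm, pow_add, mul_assoc, mul_assoc (d ^ (m + 1)),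
      pow_mul_pow_mul_of_left_inverse hdc hvc k hvf, pow_succ, mul_assoc, hdf, mul_zero, mul_zero]

end MatrixUnits

namespace DirGraph

variable {V : Type uV} {A : Type uA} {G : DirGraph V A}

theorem Cycles.exists_eq_cons (c : G.Cycles) {e : A} (he : e ∈ c.1) :
    ∃ (q : G.PathTo (G.s e)) (_ : G.r e = q.src), c.1 = ((e :: q.1 : List A) : Cycle A) ∧
      (G.s e :: q.1.map G.s).Nodup := by
  obtain ⟨c, hne, hc, hnd⟩ := c
  induction c using Quotient.inductionOn with | _ m => ?_
  change e ∈ m at he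
  obtain ⟨a, b, rfl⟩ := List.append_of_mem he
  have hrot : ((a ++ e :: b : List A) : Cycle A) = ((e :: (b ++ a) : List A) : Cycle A) :=
    Cycle.coe_eq_coe.2 (by simpa using (List.isRotated_append (l := a) (l' := e :: b)))
  change Cycle.Chain G.Follows ((a ++ e :: b : List A) : Cycle A) at hc
  change (Cycle.map G.s ((a ++ e :: b : List A) : Cycle A)).Nodup at hnd
  rw [hrot] at hc hnd
  rw [Cycle.chain_coe_cons, ← List.cons_append, List.isChain_append] at hc
  obtain ⟨h1, -, h2⟩ := hc
  obtain ⟨q, hq, hq', -⟩ := PathTo.exists_cons (v := G.s e) e (b ++ a)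
    ⟨h1, fun x hx => h2 x hx e (by simp)⟩
  refine ⟨q, hq, by rw [hq']; exact hrot, ?_⟩
  rw [hq']
  exact hnd

end DirGraph

section Leavitt

variable {K : Type uK} [Field K] {V : Type uV} {A : Type uA} [Fintype V] [Fintype A]
  [DecidableEq V] {G : DirGraph V A}

namespace LeavittPathAlgebra

open DirGraph

local notation "ν" v:max => gen K G (LeavittGen.vertex v)
local notation "ε" e:max => gen K G (LeavittGen.edge e)
local notation "γ" e:max => gen K G (LeavittGen.ghost e)

/-- Conjugating `p q*`, where `|p| = |q|`, by a path at least as long gives a multiple of a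
vertex. -/
theorem exists_conj_eq_smul {v : V} (l : G.PathTo v) {u : V} (p q : G.PathTo u)
    (hpq : p.1.length = q.1.length) (hpl : p.1.length ≤ l.1.length) :
    ∃ a : K, ofGhostPath K G l * (ofPath K G p * ofGhostPath K G q) * ofPath K G l = a • ν v := by
  induction l using PathTo.induction generalizing u p q with
  | nil =>
    induction p using PathTo.induction with
    | cons e p h _ => simp [PathTo.cons_val, PathTo.nil] at hpl
    | nil =>
      induction q using PathTo.induction with
      | cons e q h _ => simp [PathTo.cons_val, PathTo.nil] at hpq
      | nil =>
        rw [ofGhostPath_nil, ofPath_nil, ofPath_nil, ofGhostPath_nil, vert_mul_self]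
        by_cases h : v = u
        · subst h; exact ⟨1, by rw [vert_mul_self, vert_mul_self, one_smul]⟩
        · exact ⟨0, by rw [vert_mul_of_ne K G h, zero_mul, zero_smul]⟩
  | cons e l hl ih =>
    rw [ofGhostPath_cons, ofPath_cons]
    induction p using PathTo.induction with
    | nil =>
      induction q using PathTo.induction with
      | cons e q h _ => simp [PathTo.cons_val, PathTo.nil] at hpq
      | nil =>
        rw [ofPath_nil, ofGhostPath_nil, vert_mul_self]
        by_cases h : G.s e = u
        · subst h
          refine ⟨1, ?_⟩
          rw [mul_assoc, mul_assoc, ← mul_assoc (ν (G.s e)), source_mul_edge, ← mul_assoc (γ e),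
            ghost_mul_edge_self, hl, src_mul_ofPath, ofGhostPath_mul_ofPath, one_smul]
        · refine ⟨0, ?_⟩
          rw [mul_assoc (ofGhostPath K G l), ghost_mul_vert_of_ne K G h, mul_zero, zero_mul,
            zero_smul]
    | cons f p hp _ =>
      induction q using PathTo.induction with
      | nil => simp [PathTo.cons_val, PathTo.nil] at hpq
      | cons g q hq _ =>
        rw [ofPath_cons, ofGhostPath_cons]
        by_cases hf : e = f
        · by_cases hg : g = e
          · subst hf hg
            obtain ⟨a, ha⟩ := ih p q (by simpa [PathTo.cons_val] using hpq)
              (by simpa [PathTo.cons_val] using hpl)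
            refine ⟨a, ?_⟩
            rw [← ha]
            calc _ = ofGhostPath K G l * ((γ g * ε g) * ofPath K G p * ofGhostPath K G q *
                  (γ g * ε g)) * ofPath K G l := by simp only [mul_assoc]
              _ = ofGhostPath K G l * (ν (G.r g) * ofPath K G p * ofGhostPath K G q) *
                  (ν (G.r g) * ofPath K G l) := by rw [ghost_mul_edge_self]; simp only [mul_assoc]
              _ = _ := by
                rw [hl, src_mul_ofPath, ← hl, hp, src_mul_ofPath]
          · refine ⟨0, ?_⟩
            calc _ = ofGhostPath K G l * γ e * (ε f * ofPath K G p) * ofGhostPath K G q *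
                  (γ g * ε e) * ofPath K G l := by simp only [mul_assoc]
              _ = _ := by rw [ghost_mul_edge_of_ne K G hg]; simp
        · refine ⟨0, ?_⟩
          calc _ = ofGhostPath K G l * (γ e * ε f) * ofPath K G p * (ofGhostPath K G q *
                  γ g) * (ε e * ofPath K G l) := by simp only [mul_assoc]
              _ = _ := by rw [ghost_mul_edge_of_ne K G hf]; simp

/-- Conjugation by a long enough path turns an element of degree `0` into a multiple of a vertex. -/
theorem exists_forall_conj_eq_smul {z : LeavittPathAlgebra K G} (hz : z ∈ grading K G 0) :
    ∃ N : ℕ, ∀ (v : V) (l : G.PathTo v), N ≤ l.1.length →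
      ∃ a : K, ofGhostPath K G l * z * ofPath K G l = a • ν v := by
  refine grading_induction (P := fun z => ∃ N : ℕ, ∀ (v : V) (l : G.PathTo v), N ≤ l.1.length →
      ∃ a : K, ofGhostPath K G l * z * ofPath K G l = a • ν v) ?_ ?_ ?_ ?_ hz
  · intro u p q hpq
    exact ⟨p.1.length, fun v l hl => exists_conj_eq_smul l p q (by omega) hl⟩
  · exact ⟨0, fun v l _ => ⟨0, by simp⟩⟩
  · rintro x y ⟨M, hM⟩ ⟨N, hN⟩
    refine ⟨max M N, fun v l hl => ?_⟩
    obtain ⟨a, ha⟩ := hM v l (le_trans (le_max_left _ _) hl)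
    obtain ⟨b, hb⟩ := hN v l (le_trans (le_max_right _ _) hl)
    exact ⟨a + b, by rw [mul_add, add_mul, ha, hb, add_smul]⟩
  · rintro k x ⟨N, hN⟩
    refine ⟨N, fun v l hl => ?_⟩
    obtain ⟨a, ha⟩ := hN v l hl
    exact ⟨k * a, by rw [mul_smul_comm, smul_mul_assoc, ha, mul_smul]⟩

theorem exists_path_pow {v : V} (c : G.PathTo v) (hc : c.src = v) (hlen : 0 < c.1.length) (k : ℕ) :
    ∃ p : G.PathTo v, p.src = v ∧ k ≤ p.1.length ∧ ofPath K G p = ofPath K G c ^ k * ν v ∧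
      ofGhostPath K G p = ν v * ofGhostPath K G c ^ k := by
  induction k with
  | zero =>
    exact ⟨PathTo.nil v, rfl, Nat.zero_le _, by simp [ofPath_nil], by simp [ofGhostPath_nil]⟩
  | succ k ih =>
    obtain ⟨p, hp, hk, h1, h2⟩ := ih
    refine ⟨c.comp p hp, (PathTo.src_comp c p hp).trans hc, ?_, ?_, ?_⟩
    · have : (c.comp p hp).1.length = c.1.length + p.1.length := List.length_append
      omega
    · rw [ofPath_comp, h1, pow_succ', mul_assoc]
    · rw [ofGhostPath_comp, h2, pow_succ, mul_assoc]

variable (K) in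
/-- A closed path `c` with an exit `f` gives homogeneous elements `x k = cᵏ f` and `y k = f* c*ᵏ`
with `y j * x k = δ_{jk} r(f)`.  No `z` of degree `0` has `y k * z * x k` equal to `r(f)` for even
`k` and to `0` for odd `k`: conjugation by a long power of `c` turns `z` into a multiple `a` of
a vertex, and `a` does not change with one more turn around `c`. -/
theorem exists_matrixUnits (hG : ¬ G.NoCycleHasExit) :
    ∃ (u : V) (x y : ℕ → LeavittPathAlgebra K G) (d : ℕ → ℤ),
      (∀ k, x k ∈ grading K G (d k)) ∧ (∀ k, y k ∈ grading K G (-d k)) ∧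
      (∀ k, y k * x k = ν u) ∧ (∀ k, x k * ν u = x k) ∧ (∀ k, ν u * y k = y k) ∧
      (∀ j k, j ≠ k → y j * x k = 0) ∧
      ∀ z ∈ grading K G 0, (∀ k, Even k → y k * z * x k = ν u) →
        (∀ k, ¬ Even k → y k * z * x k = 0) → False := by
  unfold NoCycleHasExit at hG
  push Not at hG
  obtain ⟨c, e, he, f, hs, hfe⟩ := hG
  obtain ⟨q, hq, -, -⟩ := c.exists_eq_cons he
  have hdc := ofGhostPath_mul_ofPath (K := K) (q.cons e hq)
  have hvc : ν (G.s e) * ofPath K G (q.cons e hq) = ofPath K G (q.cons e hq) :=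
    src_mul_ofPath (q.cons e hq)
  have hvf : ν (G.s e) * ε f = ε f := by rw [← hs, source_mul_edge]
  have hfv : γ f * ν (G.s e) = γ f := by rw [← hs, ghost_mul_source]
  have hhc : γ f * ofPath K G (q.cons e hq) = 0 := by
    rw [ofPath_cons, ← mul_assoc, ghost_mul_edge_of_ne K G hfe, zero_mul]
  have hdf : ofGhostPath K G (q.cons e hq) * ε f = 0 := by
    rw [ofGhostPath_cons, mul_assoc, ghost_mul_edge_of_ne K G hfe.symm, mul_zero]
  have hlen : 0 < (q.cons e hq).1.length := by simp [PathTo.cons_val]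
  have hC := ofPath_mem_grading (K := K) (q.cons e hq)
  have hD := ofGhostPath_mem_grading (K := K) (q.cons e hq)
  have hpow := exists_path_pow (K := K) (q.cons e hq) rfl hlen
  have hDv : ofGhostPath K G (q.cons e hq) * ν (G.s e) = ofGhostPath K G (q.cons e hq) :=
    ofGhostPath_mul_src (q.cons e hq)
  generalize ofPath K G (q.cons e hq) = C at *
  generalize ofGhostPath K G (q.cons e hq) = D at *
  generalize (q.cons e hq).1.length = n at *
  have hCk : ∀ k : ℕ, C ^ k ∈ grading K G (k * n) := by
    intro k
    induction k with
    | zero => simpa using one_mem_grading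
    | succ k ih =>
      rw [pow_succ]; convert mul_mem_grading ih hC using 2; push_cast; ring
  have hDk : ∀ k : ℕ, D ^ k ∈ grading K G (-(k * n)) := by
    intro k
    induction k with
    | zero => simpa using one_mem_grading
    | succ k ih =>
      rw [pow_succ]; convert mul_mem_grading ih hD using 2; push_cast; ring
  refine ⟨G.r f, fun k => C ^ k * ε f, fun k => γ f * D ^ k, fun k => k * n + 1,
    fun k => mul_mem_grading (hCk k) (edge_mem_grading f), fun k => ?_, fun k => ?_, fun k => ?_,
    fun k => ?_, fun j k hjk => ?_, ?_⟩
  · rw [neg_add, add_comm]; exact mul_mem_grading (ghost_mem_grading f) (hDk k)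
  · rw [mul_assoc, pow_mul_pow_mul_of_left_inverse hdc hvc k hvf, ghost_mul_edge_self]
  · rw [mul_assoc, edge_mul_range]
  · rw [← mul_assoc, range_mul_ghost]
  · exact mul_pow_mul_pow_mul_of_ne hdc hvc hvf hhc hdf hjk
  · intro z hz heven hodd
    obtain ⟨N, hN⟩ := exists_forall_conj_eq_smul hz
    have h1 : ∀ k, N ≤ k → ∃ a : K, ν (G.s e) * D ^ k * z * (C ^ k * ν (G.s e)) =
        a • ν (G.s e) := by
      intro k hk
      obtain ⟨p, -, hkp, hp1, hp2⟩ := hpow k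
      obtain ⟨a, ha⟩ := hN _ p (hk.trans hkp)
      exact ⟨a, by rw [← hp1, ← hp2, ha]⟩
    have h2 : ∀ k (a : K), ν (G.s e) * D ^ k * z * (C ^ k * ν (G.s e)) = a • ν (G.s e) →
        γ f * D ^ k * z * (C ^ k * ε f) = a • ν (G.r f) := by
      intro k a ha
      calc _ = γ f * (ν (G.s e) * D ^ k * z * (C ^ k * ν (G.s e))) * ε f := by
            nth_rewrite 1 [← hfv, ← hvf]; simp only [mul_assoc]
        _ = _ := by
          rw [ha, mul_smul_comm, smul_mul_assoc, hfv, ghost_mul_edge_self]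
    obtain ⟨a, ha⟩ := h1 (2 * N) (by omega)
    obtain ⟨b, hb⟩ := h1 (2 * N + 1) (by omega)
    have ha1 := (h2 _ _ ha).symm.trans (heven _ (even_two_mul N))
    have hb1 := (h2 _ _ hb).symm.trans (hodd _ (by simp))
    have hab : b • ν (G.s e) = a • ν (G.s e) := by
      rw [← hb]
      have hDv' : ∀ w, D * (ν (G.s e) * w) = D * w := fun w => by rw [← mul_assoc, hDv]
      have hvc' : ∀ w, ν (G.s e) * (C * w) = C * w := fun w => by rw [← mul_assoc, hvc]
      -- conjugation by one more turn around the cycle does not change the multiple of the vertex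
      calc _ = ν (G.s e) * D * (ν (G.s e) * D ^ (2 * N) * z * (C ^ (2 * N) * ν (G.s e))) *
            (C * ν (G.s e)) := by
            rw [pow_succ' D, pow_succ C]
            simp only [mul_assoc, hDv', hvc']
        _ = _ := by
          rw [ha, mul_smul_comm, smul_mul_assoc, mul_assoc _ D, hDv, mul_assoc, ← mul_assoc D,
            hdc, vert_mul_self, vert_mul_self]
    have hv0 := vert_ne_zero K G (G.s e)
    have hr0 := vert_ne_zero K G (G.r f)
    have hb0 : b = 0 := (smul_eq_zero.1 hb1).resolve_right hr0
    rw [hb0, zero_smul] at hab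
    have ha0 : a = 0 := (smul_eq_zero.1 hab.symm).resolve_right hv0
    rw [ha0, zero_smul] at ha1
    exact hr0 ha1.symm

end LeavittPathAlgebra

end Leavitt

/-! ### Each of the finiteness conditions excludes exits -/

/-- If `d c = 1`, then `(1 - cⁿ dⁿ) d` is nilpotent, and its `n`-th power is `(1 - c d) dⁿ`. -/
theorem HasBoundedNilpotenceIndex.isDedekindFiniteMonoid {R : Type*} [Ring R]
    (h : HasBoundedNilpotenceIndex R) : IsDedekindFiniteMonoid R := by
  obtain ⟨n, hn, h⟩ := h
  refine ⟨fun {d c} hdc => ?_⟩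
  have hpow : ∀ k, d ^ k * c ^ k = 1 := by
    intro k
    have := pow_mul_pow_mul_of_left_inverse (v := (1 : R)) hdc (one_mul c) k (one_mul 1)
    rwa [mul_one] at this
  let P : ℕ → R := fun j => 1 - c ^ j * d ^ j
  have hdP : ∀ k j, d ^ k * P (k + j) = P j * d ^ k := by
    intro k j
    simp only [P, mul_sub, sub_mul, mul_one, one_mul]
    rw [pow_add c, mul_assoc, ← mul_assoc (d ^ k), hpow, one_mul,
      add_comm k j, pow_add d, mul_assoc]
  have hPP : ∀ j, P (j + 1) * P j = P j := by
    intro j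
    have : c ^ (j + 1) * d ^ (j + 1) * (c ^ j * d ^ j) = c ^ (j + 1) * d ^ (j + 1) := by
      rw [pow_succ' d, mul_assoc (c ^ (j + 1)), mul_assoc d, ← mul_assoc (d ^ j), hpow, one_mul]
    simp only [P]
    rw [sub_mul, one_mul, mul_sub, this, mul_one, sub_self, sub_zero]
  have key : ∀ k j, 1 ≤ k → k + j = n + 1 → (P n * d) ^ k = P j * d ^ k := by
    intro k j hk
    induction k, hk using Nat.le_induction generalizing j with
    | base =>
      intro hj
      obtain rfl : j = n := by omega
      simp
    | succ k hk ih =>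
      intro hj
      obtain rfl : n = k + j := by omega
      rw [pow_succ, ih (j + 1) (by omega), mul_assoc, ← mul_assoc (d ^ k), hdP, ← mul_assoc,
        ← mul_assoc, hPP, mul_assoc, pow_succ]
  have h0 : (P n * d) ^ (n + 1) = 0 := by
    rw [key (n + 1) 0 (by omega) (by omega)]
    simp [P]
  have h1 := h _ ⟨n + 1, h0⟩
  rw [key n 1 hn rfl] at h1
  have h2 : P 1 = 0 := by
    have := congrArg (· * c ^ n) h1
    simpa [mul_assoc, hpow] using this
  simp only [P, pow_one, sub_eq_zero] at h2
  exact h2.symm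

/-- If `x y = u` in the corner `u R u`, then `(x + 1 - u) (y + 1 - u) = 1` in `R`. -/
theorem isGradedDirectlyFinite_of_isDedekindFiniteMonoid {R : Type*} [Ring R]
    [IsDedekindFiniteMonoid R] (𝒜 : ℤ → AddSubgroup R) {S : Set R} (hS : ∀ u ∈ S, u * u = u) :
    IsGradedDirectlyFinite 𝒜 S := by
  intro u hu m n x y _ _ hxu hux hyu huy hxy
  have h1 : (x + (1 - u)) * (y + (1 - u)) = 1 := by
    simp only [mul_add, add_mul, mul_sub, sub_mul, mul_one, one_mul, hxy, hxu, huy, hS u hu]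
    abel
  have h2 := IsDedekindFiniteMonoid.mul_eq_one_symm h1
  simp only [mul_add, add_mul, mul_sub, sub_mul, mul_one, one_mul, hyu, hux, hS u hu] at h2
  have : y * x + (1 - u) = 1 := by
    refine Eq.trans ?_ h2
    abel
  rwa [← sub_eq_zero, show y * x + (1 - u) - 1 = y * x - u by abel, sub_eq_zero] at this

section Leavitt

variable {K : Type uK} [Field K] {V : Type uV} {A : Type uA} [Fintype V] [Fintype A]
  [DecidableEq V] {G : DirGraph V A}

namespace LeavittPathAlgebra

open DirGraph

theorem noCycleHasExit_of_isGradedDirectlyFinite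
    (h : IsGradedDirectlyFinite (grading K G) (vertices K G)) : G.NoCycleHasExit := by
  intro c e he f hs
  by_contra hfe
  obtain ⟨q, hq, -, -⟩ := c.exists_eq_cons he
  have h1 := h _ ⟨G.s e, rfl⟩ _ _ _ _ (ofGhostPath_mem_grading (q.cons e hq))
    (ofPath_mem_grading (q.cons e hq)) (ofGhostPath_mul_src (q.cons e hq))
    (vert_mul_ofGhostPath _) (ofPath_mul_vert _) (src_mul_ofPath (q.cons e hq))
    (ofGhostPath_mul_ofPath _)
  -- `f = c c* f = 0`
  have h2 := congrArg (· * gen K G (.edge f)) h1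
  simp only at h2
  have hvf : gen K G (.vertex (G.s e)) * gen K G (.edge f) = gen K G (.edge f) := by
    rw [← hs, source_mul_edge]
  rw [hvf, mul_assoc, ofGhostPath_cons, mul_assoc (ofGhostPath K G q),
    ghost_mul_edge_of_ne K G (Ne.symm hfe), mul_zero, mul_zero] at h2
  apply vert_ne_zero K G (G.r f)
  rw [← ghost_mul_edge_self, ← h2, mul_zero]

theorem one_mem_opGrading : (1 : (LeavittPathAlgebra K G)ᵐᵒᵖ) ∈ opGrading (grading K G) 0 :=
  op_mem_opGrading.2 one_mem_grading

theorem noCycleHasExit_of_isGradedSigmaVRing (h : IsGradedSigmaVRing (grading K G)) :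
    G.NoCycleHasExit := by
  by_contra hG
  obtain ⟨u, x, y, d, hx, hy, hyx, hxu, huy, horth, -⟩ := exists_matrixUnits K hG
  exact not_isGradedSigmaVRing isGradedModule_grading one_mem_grading hx (vert_mem_grading u)
    (vert_ne_zero K G u) (vert_mul_self K G u) hyx hxu horth h

theorem noCycleHasExit_of_isGradedSigmaVRing_op (h : IsGradedSigmaVRing (opGrading (grading K G))) :
    G.NoCycleHasExit := by
  by_contra hG
  obtain ⟨u, x, y, d, hx, hy, hyx, hxu, huy, horth, -⟩ := exists_matrixUnits K hG
  refine not_isGradedSigmaVRing (isGradedModule_opGrading isGradedModule_grading)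
    one_mem_opGrading (x := fun k => MulOpposite.op (y k)) (y := fun k => MulOpposite.op (x k))
    (d := fun k => -d k) (u := MulOpposite.op (gen K G (.vertex u)))
    (fun k => op_mem_opGrading.2 (hy k)) (op_mem_opGrading.2 (vert_mem_grading u))
    ?_ ?_ (fun k => ?_) (fun k => ?_) (fun j k hjk => ?_) h
  · exact fun h => vert_ne_zero K G u (MulOpposite.op_injective h)
  · rw [← MulOpposite.op_mul, vert_mul_self]
  · rw [← MulOpposite.op_mul, hyx]
  · rw [← MulOpposite.op_mul, huy]
  · rw [← MulOpposite.op_mul, horth k j (Ne.symm hjk), MulOpposite.op_zero]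

theorem noCycleHasExit_of_isGradedSelfInjective (h : IsGradedSelfInjective (grading K G)) :
    G.NoCycleHasExit := by
  by_contra hG
  obtain ⟨u, x, y, d, hx, hy, hyx, hxu, huy, horth, hno⟩ := exists_matrixUnits K hG
  obtain ⟨z, hz, heven, hodd⟩ := h.exists_mul_eq isGradedModule_grading one_mem_grading hx hy hyx
    hxu horth {k | Even k}
  have key : ∀ k, y k * z * x k = y k * (x k * y k * z) * x k := fun k => by
    rw [← mul_assoc (y k), ← mul_assoc (y k), hyx, huy]
  refine hno z hz (fun k hk => ?_) (fun k hk => ?_)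
  · rw [key, heven k hk, ← mul_assoc, hyx, huy, hyx]
  · rw [key, hodd k hk, mul_zero, zero_mul]

theorem noCycleHasExit_of_isGradedSelfInjective_op
    (h : IsGradedSelfInjective (opGrading (grading K G))) : G.NoCycleHasExit := by
  by_contra hG
  obtain ⟨u, x, y, d, hx, hy, hyx, hxu, huy, horth, hno⟩ := exists_matrixUnits K hG
  obtain ⟨z, hz, heven, hodd⟩ := h.exists_mul_eq (isGradedModule_opGrading isGradedModule_grading)
    one_mem_opGrading (x := fun k => MulOpposite.op (y k)) (y := fun k => MulOpposite.op (x k))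
    (d := fun k => -d k) (u := MulOpposite.op (gen K G (.vertex u)))
    (fun k => op_mem_opGrading.2 (hy k))
    (fun k => by rw [neg_neg]; exact op_mem_opGrading.2 (hx k))
    (fun k => by rw [← MulOpposite.op_mul, hyx]) (fun k => by rw [← MulOpposite.op_mul, huy])
    (fun j k hjk => by
      rw [← MulOpposite.op_mul, horth k j (Ne.symm hjk), MulOpposite.op_zero]) {k | Even k}
  obtain ⟨z, hz', rfl⟩ := hz
  have heven' : ∀ k, Even k → z * (x k * y k) = x k * y k := fun k hk =>
    MulOpposite.op_injective (heven k hk)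
  have hodd' : ∀ k, ¬ Even k → z * (x k * y k) = 0 := fun k hk =>
    MulOpposite.op_injective (hodd k hk)
  have key : ∀ k, y k * z * x k = y k * (z * (x k * y k)) * x k := fun k => by
    rw [mul_assoc (y k), mul_assoc (y k), mul_assoc z, mul_assoc (x k), hyx, hxu]
  refine hno z hz' (fun k hk => ?_) (fun k hk => ?_)
  · rw [key, heven' k hk, ← mul_assoc, hyx, huy, hyx]
  · rw [key, hodd' k hk, mul_zero, zero_mul]

end LeavittPathAlgebra

end Leavitt

/-! ### Graphs in which no cycle has an exit -/

namespace DirGraph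

variable {V : Type uV} {A : Type uA} {G : DirGraph V A}

/-- Following a choice of edges which never leaves a nonempty set of vertices of a finite graph, one
runs into a cycle. -/
theorem exists_cycle [Finite V] {X : Set V} (hne : X.Nonempty) (f : V → A)
    (hf : ∀ x ∈ X, G.s (f x) = x ∧ G.r (f x) ∈ X) :
    ∃ c : G.Cycles, ∀ e ∈ c.1, G.s e ∈ X ∧ e = f (G.s e) := by
  let τ : X → X := fun x => ⟨G.r (f x), (hf x x.2).2⟩
  obtain ⟨y, hy⟩ : ∃ y, y ∈ Function.periodicPts τ := by
    obtain ⟨x, hx⟩ := hne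
    obtain ⟨m, n, hmn, h⟩ := Finite.exists_ne_map_eq_of_infinite fun k => τ^[k] ⟨x, hx⟩
    wlog hlt : m < n generalizing m n
    · exact this n m (Ne.symm hmn) h.symm (by omega)
    obtain ⟨k, rfl⟩ := Nat.exists_eq_add_of_lt hlt
    refine ⟨τ^[m] ⟨x, hx⟩, Function.mk_mem_periodicPts (n := k + 1) (Nat.succ_pos k) ?_⟩
    rw [Function.IsPeriodicPt, Function.IsFixedPt, ← Function.iterate_add_apply, h]
    congr 1
    omega
  refine ⟨⟨(Function.periodicOrbit τ y).map fun x : X => f x, ?_, ?_, ?_⟩, ?_⟩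
  · intro h
    have h1 := (Cycle.mem_map (f := fun x : X => f x)).2
      ⟨y, Function.self_mem_periodicOrbit hy, rfl⟩
    rw [h] at h1
    exact Cycle.notMem_nil _ h1
  · rw [Cycle.chain_map, Function.periodicOrbit_chain' _ hy]
    intro n
    rw [Function.iterate_succ_apply']
    exact ((hf _ (τ (τ^[n] y)).2).1).symm
  · have hnd : (Function.periodicOrbit τ y).Nodup := Function.nodup_periodicOrbit
    generalize Function.periodicOrbit τ y = c at hnd
    induction c using Quotient.inductionOn with | _ l => ?_
    change l.Nodup at hnd
    change ((l.map fun x : X => f x).map G.s).Nodup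
    rw [List.map_map]
    refine hnd.map fun x x' h => Subtype.ext ?_
    rwa [Function.comp_apply, Function.comp_apply, (hf x x.2).1, (hf x' x'.2).1] at h
  · intro e he
    have he' : e ∈ (Function.periodicOrbit τ y).map fun x : X => f x := he
    obtain ⟨x, -, rfl⟩ := Cycle.mem_map.1 he'
    rw [(hf x x.2).1]
    exact ⟨x.2, rfl⟩

/-- To prove a property of all vertices, it is enough to prove it for the sinks and for one vertex
on each cycle, and to show that it passes from the ranges of the edges starting at a vertex to the
vertex. -/
theorem vertex_induction [Finite V] {P : V → Prop} (base : G.Cycles → V)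
    (hbase : ∀ c : G.Cycles, base c ∈ c.1.map G.s) (sink : ∀ v, (∀ e, G.s e ≠ v) → P v)
    (cycle : ∀ c, P (base c)) (step : ∀ v, (∃ e, G.s e = v) → (∀ e, G.s e = v → P (G.r e)) → P v)
    (v : V) : P v := by
  classical
  by_contra hv
  have h : ∀ x, ¬ P x → ∃ e, G.s e = x ∧ ¬ P (G.r e) := by
    intro x hx
    by_contra! hcon
    refine hx (step x ?_ hcon)
    by_contra! hs
    exact hx (sink x hs)
  obtain ⟨e₀, -⟩ := h v hv
  obtain ⟨c, hc⟩ := exists_cycle (G := G) (X := {x | ¬ P x}) ⟨v, hv⟩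
    (fun x => if hx : ¬ P x then (h x hx).choose else e₀) (fun x hx => by
      rw [dif_pos (show ¬ P x from hx)]
      exact (h x hx).choose_spec)
  obtain ⟨e, he, hs⟩ := Cycle.mem_map.1 (hbase c)
  exact (hc e he).1 (hs ▸ cycle c)

/-- The vertex `v` lies on the cycle `c`. -/
def OnCycle (c : G.Cycles) (v : V) : Prop := ∃ e ∈ c.1, G.s e = v

theorem Cycles.onCycle_range (c : G.Cycles) {e : A} (he : e ∈ c.1) : OnCycle c (G.r e) := by
  obtain ⟨q, hq, hc, -⟩ := c.exists_eq_cons he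
  rw [hq]
  obtain ⟨q, h⟩ := q
  cases q with
  | nil => exact ⟨e, he, rfl⟩
  | cons f l => exact ⟨f, by rw [hc]; simp, rfl⟩

theorem PathTo.exists_suffix {v : V} (p : G.PathTo v) {l : List A} (h : l <:+ p.1) :
    ∃ q : G.PathTo v, q.1 = l := by
  obtain ⟨p, hp, hv⟩ := p
  refine ⟨⟨l, hp.suffix h, fun e he => hv e ?_⟩, rfl⟩
  obtain ⟨t, rfl⟩ := h
  rw [Option.mem_def] at he ⊢
  rw [List.getLast?_append, he]
  rfl

/-- If no cycle has an exit, paths starting on a cycle stay on it. -/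
theorem NoCycleHasExit.path_onCycle (hG : G.NoCycleHasExit) (c : G.Cycles) {v : V} (p : G.PathTo v)
    (hp : OnCycle c p.src) : (∀ f ∈ p.1, f ∈ c.1) ∧ OnCycle c v := by
  induction p using PathTo.induction with
  | nil => exact ⟨by simp [PathTo.nil], hp⟩
  | cons e q h ih =>
    obtain ⟨e', he', hs⟩ := hp
    obtain rfl : e = e' := hG c e' he' e hs.symm
    obtain ⟨h1, h2⟩ := ih (h ▸ c.onCycle_range he')
    exact ⟨fun f hf => (List.mem_cons.1 hf).elim (fun h => h ▸ he') (h1 f), h2⟩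

theorem PathTo.eq_of_deterministic {v : V} (p p' : G.PathTo v) (hsrc : p.src = p'.src)
    (hp : v ∉ p.1.map G.s) (hp' : v ∉ p'.1.map G.s)
    (h : ∀ e ∈ p.1, ∀ f, G.s f = G.s e → f = e) : p.1 = p'.1 := by
  induction p using PathTo.induction generalizing p' with
  | nil =>
    induction p' using PathTo.induction with
    | nil => rfl
    | cons e q hq _ => exact absurd (List.mem_map.2 ⟨e, by simp [PathTo.cons_val], hsrc.symm⟩) hp'
  | cons e q hq ih =>
    induction p' using PathTo.induction with
    | nil => exact absurd (List.mem_map.2 ⟨e, by simp [PathTo.cons_val], hsrc⟩) hp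
    | cons e' q' hq' _ =>
      rw [PathTo.cons_val] at hp hp' h
      obtain rfl : e' = e := h e (by simp) e' hsrc.symm
      rw [PathTo.cons_val, PathTo.cons_val, ih q' (hq.symm.trans hq')
        (fun hv => hp (by simp only [List.map_cons, List.mem_cons, hv, or_true]))
        (fun hv => hp' (by simp only [List.map_cons, List.mem_cons, hv, or_true]))
        fun f hf => h f (by simp [hf])]

/-- If no cycle has an exit, distinct cycles are disjoint. -/
theorem NoCycleHasExit.cycle_unique (hG : G.NoCycleHasExit) {c c' : G.Cycles} {v : V}
    (h : OnCycle c v) (h' : OnCycle c' v) : c = c' := by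
  obtain ⟨e, he, rfl⟩ := h
  obtain ⟨e', he', hs⟩ := h'
  obtain rfl : e' = e := hG c e he e' hs
  obtain ⟨q, hq, hc, hnd⟩ := c.exists_eq_cons he
  obtain ⟨q', hq', hc', hnd'⟩ := c'.exists_eq_cons he'
  have := PathTo.eq_of_deterministic q q' (hq.symm.trans hq') (List.nodup_cons.1 hnd).1
    (List.nodup_cons.1 hnd').1 fun f hf => hG c f (by rw [hc]; simp [hf])
  exact Subtype.ext (by rw [hc, hc', this])

theorem NoCycleHasExit.prefix_or_prefix (hG : G.NoCycleHasExit) (c : G.Cycles) {u v : V}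
    (p : G.PathTo u) (q : G.PathTo v) (hsrc : p.src = q.src) (hc : OnCycle c p.src) :
    p.1 <+: q.1 ∨ q.1 <+: p.1 := by
  induction p using PathTo.induction generalizing q with
  | nil => exact Or.inl List.nil_prefix
  | cons e p hp ih =>
    induction q using PathTo.induction with
    | nil => exact Or.inr List.nil_prefix
    | cons f q hq _ =>
      obtain ⟨e', he', hs⟩ := hc
      obtain rfl : e = e' := hG c e' he' e hs.symm
      obtain rfl : f = e := hG c e he' f hsrc.symm
      rw [PathTo.cons_val, PathTo.cons_val, List.cons_prefix_cons, List.cons_prefix_cons]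
      simpa using ih q (hp.symm.trans hq) (hp ▸ c.onCycle_range he')

/-- If no cycle has an exit, a nonempty closed path at a vertex `s(e)` of the cycle `c = e t` is a
power of `e t`. -/
theorem NoCycleHasExit.suffix_of_closed (hG : G.NoCycleHasExit) (c : G.Cycles) {e : A}
    (t : G.PathTo (G.s e)) (ht : G.r e = t.src) (hc : c.1 = ((e :: t.1 : List A) : Cycle A))
    (hnd : (G.s e :: t.1.map G.s).Nodup) (p : G.PathTo (G.s e)) (hp : p.src = G.s e)
    (hne : p.1 ≠ []) : e :: t.1 <:+ p.1 := by
  have he : e ∈ c.1 := by rw [hc]; simp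
  obtain ⟨n, hn⟩ : ∃ n, p.1.length = n := ⟨_, rfl⟩
  induction n using Nat.strong_induction_on generalizing p with
  | _ n ih =>
    rcases hG.prefix_or_prefix c p (t.cons e ht) hp ⟨e, he, hp.symm⟩ with ⟨m, hm⟩ | ⟨m, hm⟩
    · cases m with
      | nil => rw [List.append_nil] at hm; rw [hm]; exact List.suffix_rfl
      | cons x m =>
        exfalso
        -- the first edge of the remainder would also start at `s e`
        have hx : G.s x = G.s e := by
          obtain ⟨p, hp1, hp2⟩ := p
          have hch := (t.cons e ht).2.1
          rw [← hm] at hch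
          obtain ⟨y, hy⟩ : ∃ y, y ∈ p.getLast? := by
            cases h : p.getLast? with
            | none => exact absurd (List.getLast?_eq_none_iff.1 h) hne
            | some y => exact ⟨y, rfl⟩
          exact ((List.isChain_append.1 hch).2.2 y hy x (by simp)).symm.trans (hp2 y hy)
        obtain ⟨p, hp'⟩ := p
        cases p with
        | nil => exact hne rfl
        | cons y p =>
          rw [PathTo.cons_val, List.cons_append, List.cons.injEq] at hm
          refine (List.nodup_cons.1 hnd).1 (List.mem_map.2 ⟨x, ?_, hx⟩)
          rw [← hm.2]; simp
    · obtain ⟨q, hq⟩ := p.exists_suffix (l := m) ⟨_, hm⟩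
      cases m with
      | nil => rw [List.append_nil] at hm; rw [← hm]; exact List.suffix_rfl
      | cons x m =>
        have hx : G.s x = G.s e := by
          have hch := p.2.1
          rw [← hm] at hch
          obtain ⟨y, hy⟩ : ∃ y, y ∈ (t.cons e ht).1.getLast? := by
            cases h : (t.cons e ht).1.getLast? with
            | none => exact absurd (List.getLast?_eq_none_iff.1 h) (by simp [PathTo.cons_val])
            | some y => exact ⟨y, rfl⟩
          exact ((List.isChain_append.1 hch).2.2 y hy x (by simp)).symm.trans
            ((t.cons e ht).2.2 y hy)
        have hqs : q.src = G.s e := by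
          obtain ⟨q, hq'⟩ := q
          subst hq
          exact hx
        have hlen : q.1.length < n := by
          rw [← hn, ← hm, List.length_append, PathTo.cons_val, List.length_cons, hq]
          omega
        have := ih _ hlen q hqs (by rw [hq]; simp) rfl
        rw [hq] at this
        exact this.trans ⟨_, hm⟩

/-- If no cycle has an exit, the paths ending at `s(e)` which include all the edges of the cycle
`c = e t` are those which end in `e t`. -/
theorem NoCycleHasExit.suffix_iff (hG : G.NoCycleHasExit) (c : G.Cycles) {e : A}
    (t : G.PathTo (G.s e)) (ht : G.r e = t.src) (hc : c.1 = ((e :: t.1 : List A) : Cycle A))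
    (hnd : (G.s e :: t.1.map G.s).Nodup) (p : G.PathTo (G.s e)) :
    e :: t.1 <:+ p.1 ↔ ∀ f ∈ c.1, f ∈ p.1 := by
  constructor
  · intro h f hf
    rw [hc] at hf
    exact h.subset (by simpa using hf)
  · intro h
    obtain ⟨l₁, l₂, hl⟩ := List.append_of_mem (h e (by rw [hc]; simp))
    obtain ⟨q, hq⟩ := p.exists_suffix (l := e :: l₂) ⟨l₁, hl.symm⟩
    have hqs : q.src = G.s e := by
      obtain ⟨q, hq'⟩ := q
      subst hq
      rfl
    have := hG.suffix_of_closed c t ht hc hnd q hqs (by rw [hq]; simp)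
    rw [hq] at this
    exact this.trans ⟨l₁, hl.symm⟩

theorem exists_source_eq_range {l : List A} {b : A} (h : (l ++ [b]).IsChain G.Follows) {a : A}
    (ha : a ∈ l) : ∃ a' ∈ l ++ [b], G.r a = G.s a' := by
  obtain ⟨l₁, l₂, rfl⟩ := List.append_of_mem ha
  have h' : (a :: (l₂ ++ [b])).IsChain G.Follows := h.suffix ⟨l₁, by simp⟩
  cases l₂ with
  | nil => exact ⟨b, by simp, (List.isChain_cons_cons.1 h').1⟩
  | cons x l₂ => exact ⟨x, by simp, (List.isChain_cons_cons.1 h').1⟩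

/-- If no cycle has an exit, a path which does not traverse the whole of a cycle through its end
never visits a vertex twice. -/
theorem NoCycleHasExit.nodup_map_source [Finite V] (hG : G.NoCycleHasExit) {v : V}
    (p : G.PathTo v) (hp : ∀ c : G.Cycles, OnCycle c v → ∃ f ∈ c.1, f ∉ p.1) :
    (p.1.map G.s).Nodup := by
  classical
  induction p using PathTo.induction with
  | nil => simp [PathTo.nil]
  | cons e q hq ih =>
    have hsub : ∀ f ∈ q.1, f ∈ (q.cons e hq).1 := fun f hf => List.mem_cons_of_mem _ hf
    rw [PathTo.cons_val, List.map_cons, List.nodup_cons]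
    refine ⟨fun hmem => ?_, ih fun c hc => ?_⟩
    swap
    · obtain ⟨f, hf, hf'⟩ := hp c hc
      exact ⟨f, hf, fun h => hf' (hsub f h)⟩
    -- A closed subpath `e l₁` contains all the edges of some cycle.
    obtain ⟨b, hb, hbs⟩ := List.mem_map.1 hmem
    obtain ⟨l₁, l₂, hl⟩ := List.append_of_mem hb
    have hch : ((e :: l₁) ++ [b]).IsChain G.Follows := by
      have := (q.cons e hq).2.1
      rw [PathTo.cons_val, hl] at this
      exact this.prefix ⟨l₂, by simp⟩
    have hex : ∀ x, x ∈ (e :: l₁).map G.s → ∃ a ∈ e :: l₁, G.s a = x := fun x hx =>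
      List.mem_map.1 hx
    obtain ⟨c, hc⟩ := exists_cycle (G := G) (X := {x | x ∈ (e :: l₁).map G.s}) ⟨G.s e, by simp⟩
      (fun x => if hx : x ∈ (e :: l₁).map G.s then (hex x hx).choose else e) (fun x hx => by
        rw [dif_pos (show x ∈ (e :: l₁).map G.s from hx)]
        obtain ⟨h1, h2⟩ := (hex x hx).choose_spec
        refine ⟨h2, ?_⟩
        obtain ⟨a', ha', hr⟩ := exists_source_eq_range hch h1
        rw [hr]
        rcases List.mem_append.1 ha' with h | h
        · exact List.mem_map_of_mem h
        · rw [List.mem_singleton.1 h, hbs]; exact List.mem_map_of_mem (by simp))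
    have hsub' : ∀ f ∈ c.1, f ∈ (q.cons e hq).1 := by
      intro f hf
      obtain ⟨h1, h2⟩ := hc f hf
      rw [dif_pos (show G.s f ∈ (e :: l₁).map G.s from h1)] at h2
      have h3 := (hex _ h1).choose_spec.1
      rw [← h2] at h3
      rw [PathTo.cons_val, hl]
      rcases List.mem_cons.1 h3 with h | h
      · rw [h]; exact List.mem_cons_self
      · exact List.mem_cons_of_mem _ (List.mem_append_left _ h)
    obtain ⟨g, hg⟩ : ∃ g, g ∈ c.1 := by
      obtain ⟨c, hne, -, -⟩ := c
      induction c using Quotient.inductionOn with | _ l => ?_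
      cases l with
      | nil => exact absurd rfl hne
      | cons g l => exact ⟨g, List.mem_cons_self⟩
    obtain ⟨m₁, m₂, hm⟩ := List.append_of_mem (hsub' g hg)
    obtain ⟨q', hq'⟩ := (q.cons e hq).exists_suffix (l := g :: m₂) ⟨m₁, hm.symm⟩
    have hon : OnCycle c v := (hG.path_onCycle c q' (by
      refine ⟨g, hg, ?_⟩
      obtain ⟨q', h⟩ := q'
      subst hq'
      rfl)).2
    obtain ⟨f, hf, hf'⟩ := hp c hon
    exact hf' (hsub' f hf)

theorem finite_of_nodup_map_source [Finite A] {v : V} {P : G.PathTo v → Prop}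
    (h : ∀ p, P p → (p.1.map G.s).Nodup) : Finite {p : G.PathTo v // P p} := by
  classical
  cases nonempty_fintype A
  let f : {p : G.PathTo v // P p} → {l : List A // l.Nodup} := fun p => ⟨p.1.1, (h p.1 p.2).of_map⟩
  exact Finite.of_injective f fun p q hpq =>
    Subtype.ext (Subtype.ext (congrArg (fun x => x.1) hpq :))

theorem finite_cycles [Finite A] : Finite G.Cycles := by
  classical
  cases nonempty_fintype A
  let f : G.Cycles → {c : Cycle A // c.Nodup} := fun c => ⟨c.1, by
    obtain ⟨c, -, -, h⟩ := c
    induction c using Quotient.inductionOn with | _ l => ?_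
    exact List.Nodup.of_map G.s h⟩
  exact Finite.of_injective f fun p q hpq => Subtype.ext (congrArg (fun x => x.1) hpq :)

end DirGraph

/-! ### Matrix representations on sets of paths -/

section MatrixGrading

variable {R : Type*} [Ring R] {ℛ : ℤ → AddSubgroup R} {I : Type*} {δ : I → ℤ}

theorem mul_mem_matrixGrading [Fintype I]
    (hmul : ∀ m n x y, x ∈ ℛ m → y ∈ ℛ n → x * y ∈ ℛ (m + n)) {m n : ℤ} {X Y : Matrix I I R}
    (hX : X ∈ matrixGrading ℛ δ m) (hY : Y ∈ matrixGrading ℛ δ n) :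
    X * Y ∈ matrixGrading ℛ δ (m + n) := by
  intro i j
  rw [Matrix.mul_apply]
  refine sum_mem fun k _ => ?_
  convert hmul _ _ _ _ (hX i k) (hY k j) using 2
  ring

end MatrixGrading

section Blocks

variable {V : Type uV} {A : Type uA}

open DirGraph

/-- A branching system whose elements are paths ending at a vertex `w`, the only one of which to
start at `w` is the trivial path `nil`, and in which the decomposition of a nontrivial path removes
its first edge, with weight `1`.  The decomposition of `nil`, if any, is free. -/
structure PathSystem (G : DirGraph V A) (R : Type*) [CommRing R] (I : Type*) (w : V) extends
    BranchingSystem G R I where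
  /-- the underlying path -/
  path : I → G.PathTo w
  src_eq : ∀ p, src p = (path p).src
  /-- the trivial path -/
  nil : I
  path_nil : path nil = PathTo.nil w
  eq_nil : ∀ p, src p = w → p = nil
  dec_cons : ∀ p, p ≠ nil → ∃ (e : A) (q : I) (h : G.r e = (path q).src),
    dec p = some (e, q) ∧ path p = (path q).cons e h ∧ wt p = 1

variable [Fintype V] [Fintype A] [DecidableEq V]
  {K : Type uK} [Field K] {G : DirGraph V A}

local notation "ν" v:max => LeavittPathAlgebra.gen K G (LeavittGen.vertex v)
local notation "ε" e:max => LeavittPathAlgebra.gen K G (LeavittGen.edge e)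
local notation "γ" e:max => LeavittPathAlgebra.gen K G (LeavittGen.ghost e)

namespace BranchingSystem

variable {R : Type*} [CommRing R] [Algebra K R] {I : Type*} [Fintype I] [DecidableEq I]
  (S : BranchingSystem G R I)

variable (K) in
/-- The representation of the Leavitt path algebra by matrices indexed by a finite branching
system. -/
noncomputable def toMatrix : LeavittPathAlgebra K G →ₐ[K] Matrix I I R :=
  ((LinearMap.toMatrixAlgEquiv' (R := R) (n := I)).restrictScalars K).toAlgHom.comp (S.toEnd K)

theorem toMatrix_vert_apply (v : V) (p q : I) :
    S.toMatrix K (ν v) p q = if S.src p = v ∧ p = q then 1 else 0 := by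
  have : S.toMatrix K (ν v) p q = S.vertMap v (Pi.single q 1) p := by
    change LinearMap.toMatrixAlgEquiv' (S.toEnd K (ν v)) p q = _
    rw [LinearMap.toMatrixAlgEquiv'_apply, toEnd, LeavittPathAlgebra.lift_vert]
    rfl
  rw [this]
  by_cases h : S.src p = v
  · rw [vertMap_apply_self _ h]
    simp [h, Pi.single_apply]
  · rw [vertMap_apply_of_ne _ h]; simp [h]

theorem toMatrix_edge_apply (e : A) (p q : I) [Decidable (S.dec p = some (e, q))] :
    S.toMatrix K (ε e) p q = if S.dec p = some (e, q) then (S.wt p : R) else 0 := by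
  have : S.toMatrix K (ε e) p q = S.edgeMap e (Pi.single q 1) p := by
    change LinearMap.toMatrixAlgEquiv' (S.toEnd K (ε e)) p q = _
    rw [LinearMap.toMatrixAlgEquiv'_apply, toEnd, LeavittPathAlgebra.lift_edge]
    rfl
  rw [this]
  rcases Option.eq_none_or_eq_some (S.dec p) with hp | ⟨⟨f, q'⟩, hp⟩
  · rw [edgeMap_apply_of_none _ hp, if_neg (by simp [hp])]
  · by_cases hf : f = e
    · subst hf
      rw [edgeMap_apply_of_dec _ hp]
      by_cases hq : q' = q
      · subst hq; simp [hp]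
      · rw [if_neg (by simp [hp, hq])]; simp [hq]
    · rw [edgeMap_apply_of_dec_ne _ hp hf, if_neg (by simp [hp, hf])]

theorem toMatrix_ghost_apply (e : A) (p q : I) [Decidable (S.dec p = some (e, q))] :
    S.toMatrix K (γ e) q p = if S.dec p = some (e, q) then (↑(S.wt p)⁻¹ : R) else 0 := by
  have : S.toMatrix K (γ e) q p = S.ghostMap e (Pi.single p 1) q := by
    change LinearMap.toMatrixAlgEquiv' (S.toEnd K (γ e)) q p = _
    rw [LinearMap.toMatrixAlgEquiv'_apply, toEnd, LeavittPathAlgebra.lift_ghost]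
    rfl
  rw [this]
  by_cases h : S.src q = G.r e
  · obtain ⟨p', hp'⟩ := S.exists_dec e q h.symm
    rw [ghostMap_apply_of_dec _ hp']
    by_cases hp : p' = p
    · subst hp; simp [hp']
    · have : ¬ S.dec p = some (e, q) := fun h => hp (S.dec_inj _ _ _ _ hp' h)
      simp [this, hp]
  · rw [ghostMap_apply_of_ne _ h, if_neg fun hp => h (S.range_eq _ _ _ hp).symm]

theorem toMatrix_edge_mul_single {e : A} {p q : I} (h : S.dec p = some (e, q)) (o : I) (r : R) :
    S.toMatrix K (ε e) * Matrix.single q o r = Matrix.single p o (S.wt p * r) := by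
  classical
  ext i j
  by_cases hj : j = o
  · subst hj
    rw [Matrix.mul_single_apply_same, toMatrix_edge_apply, Matrix.single_apply]
    by_cases hi : p = i
    · subst hi; simp [h]
    · have : ¬ S.dec i = some (e, q) := fun h' => hi (S.dec_inj _ _ _ _ h h')
      simp [this, hi]
  · rw [Matrix.mul_single_apply_of_ne _ _ _ _ _ hj, Matrix.single_apply_of_col_ne _ _ (Ne.symm hj)]

theorem toMatrix_single_mul_ghost {e : A} {p q : I} (h : S.dec p = some (e, q)) (o : I) (r : R) :
    Matrix.single o q r * S.toMatrix K (γ e) = Matrix.single o p (r * (↑(S.wt p)⁻¹ : R)) := by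
  classical
  ext i j
  by_cases hi : i = o
  · subst hi
    rw [Matrix.single_mul_apply_same, toMatrix_ghost_apply, Matrix.single_apply]
    by_cases hj : p = j
    · subst hj; simp [h]
    · have : ¬ S.dec j = some (e, q) := fun h' => hj (S.dec_inj _ _ _ _ h h')
      simp [this, hj]
  · rw [Matrix.single_mul_apply_of_ne _ _ _ _ _ hi, Matrix.single_apply_of_row_ne (Ne.symm hi)]

end BranchingSystem

namespace PathSystem

open LeavittPathAlgebra

variable {R : Type*} [CommRing R] [Algebra K R] {I : Type*} [Fintype I] [DecidableEq I] {w : V}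
  (S : PathSystem G R I w)

theorem toMatrix_vert : S.toMatrix K (ν w) = Matrix.single S.nil S.nil 1 := by
  ext p q
  rw [BranchingSystem.toMatrix_vert_apply, Matrix.single_apply]
  refine if_congr ⟨?_, ?_⟩ rfl rfl
  · rintro ⟨h1, rfl⟩
    exact ⟨(S.eq_nil p h1).symm, (S.eq_nil p h1).symm⟩
  · rintro ⟨rfl, rfl⟩
    exact ⟨by rw [S.src_eq, S.path_nil]; rfl, rfl⟩

theorem toMatrix_path (p : I) :
    S.toMatrix K (ofPath K G (S.path p)) = Matrix.single p S.nil 1 := by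
  obtain ⟨n, hn⟩ : ∃ n, (S.path p).1.length = n := ⟨_, rfl⟩
  induction n generalizing p with
  | zero =>
    by_cases hp : p = S.nil
    · subst hp
      rw [S.path_nil, ofPath_nil, toMatrix_vert]
    · obtain ⟨e, q, h, -, hpath, -⟩ := S.dec_cons p hp
      rw [hpath, PathTo.cons_val] at hn
      simp at hn
  | succ n ih =>
    by_cases hp : p = S.nil
    · subst hp
      rw [S.path_nil] at hn
      simp [PathTo.nil] at hn
    · obtain ⟨e, q, h, hdec, hpath, hwt⟩ := S.dec_cons p hp
      rw [hpath, PathTo.cons_val, List.length_cons] at hn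
      rw [hpath, ofPath_cons, map_mul, ih q (by omega), S.toMatrix_edge_mul_single hdec, hwt]
      simp

theorem toMatrix_ghostPath (p : I) :
    S.toMatrix K (ofGhostPath K G (S.path p)) = Matrix.single S.nil p 1 := by
  obtain ⟨n, hn⟩ : ∃ n, (S.path p).1.length = n := ⟨_, rfl⟩
  induction n generalizing p with
  | zero =>
    by_cases hp : p = S.nil
    · subst hp
      rw [S.path_nil, ofGhostPath_nil, toMatrix_vert]
    · obtain ⟨e, q, h, -, hpath, -⟩ := S.dec_cons p hp
      rw [hpath, PathTo.cons_val] at hn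
      simp at hn
  | succ n ih =>
    by_cases hp : p = S.nil
    · subst hp
      rw [S.path_nil] at hn
      simp [PathTo.nil] at hn
    · obtain ⟨e, q, h, hdec, hpath, hwt⟩ := S.dec_cons p hp
      rw [hpath, PathTo.cons_val, List.length_cons] at hn
      rw [hpath, ofGhostPath_cons, map_mul, ih q (by omega), S.toMatrix_single_mul_ghost hdec, hwt]
      simp

end PathSystem

variable (K G) in
/-- A block of a Leavitt path algebra `L`: a path system, together with a map `coeff : R → L` such
that `r ↦ w coeff(r)` is a section of the representation of the corner of `L` at `w` and that the
edges multiply the elements `p coeff(r)` of `L` as in the path system, and a grading of `R` with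
which the weights have the degrees that make the representation a graded one. -/
structure LeavittBlock (R : Type*) [CommRing R] [Algebra K R]
    (ℛ : ℤ → AddSubgroup R) (I : Type*) [Fintype I] [DecidableEq I] (w : V) extends
    PathSystem G R I w where
  /-- the embedding of the scalars -/
  coeff : R →ₐ[K] LeavittPathAlgebra K G
  edge_mul : ∀ p e q, dec p = some (e, q) → ε e * LeavittPathAlgebra.ofPath K G (path q) =
    LeavittPathAlgebra.ofPath K G (path p) * coeff (wt p)
  toMatrix_coeff : ∀ r, toPathSystem.toMatrix K (ν w * coeff r) = Matrix.single nil nil r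
  wt_mem : ∀ p e q, dec p = some (e, q) →
    (wt p : R) ∈ ℛ (1 + (path q).1.length - (path p).1.length)
  wt_inv_mem : ∀ p e q, dec p = some (e, q) →
    (↑(wt p)⁻¹ : R) ∈ ℛ (-1 + (path p).1.length - (path q).1.length)

namespace LeavittBlock

open LeavittPathAlgebra

variable {R : Type*} [CommRing R] [Algebra K R] {ℛ : ℤ → AddSubgroup R} {I : Type*} [Fintype I]
  [DecidableEq I] {w : V} (S : LeavittBlock K G R ℛ I w)

theorem toMatrix_path_mul_coeff (p : I) (r : R) :
    S.toMatrix K (ofPath K G (S.path p) * S.coeff r) = Matrix.single p S.nil r := by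
  rw [← ofPath_mul_vert, mul_assoc, map_mul, S.toMatrix_coeff, S.toMatrix_path,
    Matrix.single_mul_single_same, one_mul]

theorem toMatrix_matrixUnit (p q : I) (r : R) :
    S.toMatrix K (ofPath K G (S.path p) * S.coeff r * ofGhostPath K G (S.path q)) =
      Matrix.single p q r := by
  rw [map_mul, S.toMatrix_path_mul_coeff, S.toMatrix_ghostPath, Matrix.single_mul_single_same,
    mul_one]

/-- The map `(r_p) ↦ ∑ p coeff(r_p)`, whose image contains `L w`. -/
noncomputable def column : (I → R) →ₗ[K] LeavittPathAlgebra K G :=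
  ∑ p, LinearMap.mulLeft K (ofPath K G (S.path p)) ∘ₗ S.coeff.toLinearMap ∘ₗ LinearMap.proj p

theorem column_apply (r : I → R) :
    S.column r = ∑ p, ofPath K G (S.path p) * S.coeff (r p) := by
  simp [column]

theorem column_single (p : I) (r : R) :
    S.column (Pi.single p r) = ofPath K G (S.path p) * S.coeff r := by
  rw [column_apply, Finset.sum_eq_single p]
  · simp
  · intro q _ hq; simp [hq]
  · simp

theorem mul_vert_mem_range_column (x : LeavittPathAlgebra K G) :
    x * ν w ∈ LinearMap.range S.column := by
  have hmem : ∀ p r, ofPath K G (S.path p) * S.coeff r ∈ LinearMap.range S.column :=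
    fun p r => ⟨_, S.column_single p r⟩
  refine mul_mem_of_gen (fun g y hy => ?_) x _ ?_
  · obtain ⟨r, rfl⟩ := hy
    rw [column_apply, Finset.mul_sum]
    refine sum_mem fun p _ => ?_
    generalize r p = r
    rw [← mul_assoc]
    cases g with
    | vertex v =>
      by_cases h : v = (S.path p).src
      · rw [h, src_mul_ofPath]; exact hmem p r
      · rw [vert_mul_ofPath_of_ne _ h, zero_mul]; exact zero_mem _
    | edge e =>
      by_cases h : G.r e = S.src p
      · obtain ⟨p', hp'⟩ := S.exists_dec e p h
        rw [S.edge_mul p' e p hp', mul_assoc, ← map_mul]; exact hmem _ _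
      · rw [S.src_eq] at h
        rw [← edge_mul_range, mul_assoc (ε e), vert_mul_ofPath_of_ne _ h, mul_zero, zero_mul]
        exact zero_mem _
    | ghost e =>
      cases hp : S.dec p with
      | none =>
        have h := S.sink_of_dec p hp e
        rw [S.src_eq] at h
        rw [← ghost_mul_source, mul_assoc (γ e), vert_mul_ofPath_of_ne _ h, mul_zero, zero_mul]
        exact zero_mem _
      | some x =>
        obtain ⟨f, q⟩ := x
        have h : ofPath K G (S.path p) * S.coeff r =
            ε f * (ofPath K G (S.path q) * S.coeff ((↑(S.wt p)⁻¹ : R) * r)) := by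
          rw [← mul_assoc, S.edge_mul p f q hp, mul_assoc, ← map_mul, Units.mul_inv_cancel_left]
        rw [mul_assoc, h, ← mul_assoc]
        by_cases hef : e = f
        · subst hef
          rw [ghost_mul_edge_self, ← mul_assoc, S.range_eq p e q hp, S.src_eq, src_mul_ofPath]
          exact hmem _ _
        · rw [ghost_mul_edge_of_ne K G hef, zero_mul]; exact zero_mem _
  · have := hmem S.nil 1
    rwa [S.path_nil, ofPath_nil, map_one, mul_one] at this

/-- The block representation is faithful on `L w`. -/
theorem mul_vert_eq_zero (x : LeavittPathAlgebra K G) (hx : S.toMatrix K x = 0) : x * ν w = 0 := by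
  obtain ⟨r, hr⟩ := S.mul_vert_mem_range_column x
  have h : S.toMatrix K (S.column r) = 0 := by rw [hr, map_mul, hx, zero_mul]
  rw [column_apply, map_sum] at h
  simp only [toMatrix_path_mul_coeff] at h
  have h0 : r = 0 := by
    ext p
    have := congrFun (congrFun h p) S.nil
    rw [Matrix.sum_apply, Finset.sum_eq_single p] at this
    · simpa using this
    · intro q _ hq
      rw [Matrix.single_apply_of_row_ne hq]
    · simp
  rw [← hr, h0, map_zero]

theorem toMatrix_mem_matrixGrading (hone : 1 ∈ ℛ 0)
    (hmul : ∀ m n x y, x ∈ ℛ m → y ∈ ℛ n → x * y ∈ ℛ (m + n))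
    (hsmul : ∀ n (k : K) x, x ∈ ℛ n → k • x ∈ ℛ n) {n : ℤ} {x : LeavittPathAlgebra K G}
    (hx : x ∈ grading K G n) :
    S.toMatrix K x ∈ matrixGrading ℛ (fun p => ((S.path p).1.length : ℤ)) n := by
  classical
  refine map_mem_of_mem_grading
    (ℬ := matrixGrading ℛ (fun p => ((S.path p).1.length : ℤ)))
    (fun m n X Y => mul_mem_matrixGrading hmul)
    (fun n k X hX i j => hsmul _ k _ (hX i j)) _ (fun v i j => ?_) (fun e i j => ?_)
    (fun e i j => ?_) hx
  · rw [BranchingSystem.toMatrix_vert_apply]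
    split_ifs with h
    · rw [h.2, zero_add, sub_self]; exact hone
    · exact zero_mem _
  · rw [BranchingSystem.toMatrix_edge_apply]
    split_ifs with h
    · exact S.wt_mem _ _ _ h
    · exact zero_mem _
  · rw [BranchingSystem.toMatrix_ghost_apply]
    split_ifs with h
    · exact S.wt_inv_mem _ _ _ h
    · exact zero_mem _

end LeavittBlock

end Blocks

/-! ### The coefficient rings -/

section Coefficients

theorem iSupIndep_of_hom {R P : Type*} [Ring R] [AddCommGroup P] {ℛ : ℤ → AddSubgroup R}
    (π : ℤ → R →+ P) (h₁ : ∀ n, ∀ r ∈ ℛ n, π n r = 0 → r = 0)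
    (h₂ : ∀ m n, m ≠ n → ∀ r ∈ ℛ m, π n r = 0) : iSupIndep ℛ := by
  intro n
  rw [AddSubgroup.disjoint_def]
  intro x hx hx'
  refine h₁ n x hx ?_
  have : (⨆ j, ⨆ (_ : j ≠ n), ℛ j) ≤ (π n).ker :=
    iSup_le fun j => iSup_le fun hj r hr => h₂ j n hj r hr
  exact this hx'

variable (K : Type*) [Field K]

theorem trivialGrading_zero : trivialGrading K 0 = ⊤ := if_pos rfl

theorem trivialGrading_of_ne {n : ℤ} (hn : n ≠ 0) : trivialGrading K n = ⊥ := if_neg hn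

theorem one_mem_trivialGrading : (1 : K) ∈ trivialGrading K 0 := by
  rw [trivialGrading_zero]; trivial

theorem mul_mem_trivialGrading (m n : ℤ) (x y : K) (hx : x ∈ trivialGrading K m)
    (hy : y ∈ trivialGrading K n) : x * y ∈ trivialGrading K (m + n) := by
  by_cases hm : m = 0
  · by_cases hn : n = 0
    · rw [hm, hn, add_zero, trivialGrading_zero]; trivial
    · rw [trivialGrading_of_ne K hn, AddSubgroup.mem_bot] at hy
      rw [hy, mul_zero]; exact zero_mem _
  · rw [trivialGrading_of_ne K hm, AddSubgroup.mem_bot] at hx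
    rw [hx, zero_mul]; exact zero_mem _

theorem smul_mem_trivialGrading (n : ℤ) (k x : K) (hx : x ∈ trivialGrading K n) :
    k • x ∈ trivialGrading K n := by
  have := mul_mem_trivialGrading K 0 n k x (by rw [trivialGrading_zero]; trivial) hx
  rwa [zero_add] at this

theorem iSupIndep_trivialGrading : iSupIndep (trivialGrading K) := by
  refine iSupIndep_of_hom (fun n => if n = 0 then AddMonoidHom.id K else 0) ?_ ?_
  · intro n r hr h
    by_cases hn : n = 0
    · simpa [hn] using h
    · rwa [trivialGrading_of_ne K hn, AddSubgroup.mem_bot] at hr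
  · intro m n hmn r hr
    by_cases hn : n = 0
    · rw [trivialGrading_of_ne K (hn ▸ hmn), AddSubgroup.mem_bot] at hr
      rw [hr, map_zero]
    · simp [hn]

variable {K} {n : ℕ}

theorem mem_laurentPowGrading {d : ℤ} {r : laurentPow K n} :
    r ∈ laurentPowGrading K n d ↔ ∃ a : K, a • LaurentPolynomial.T d = (r : K[T;T⁻¹]) :=
  Submodule.mem_span_singleton

theorem one_mem_laurentPowGrading : (1 : laurentPow K n) ∈ laurentPowGrading K n 0 :=
  mem_laurentPowGrading.2 ⟨1, by rw [one_smul, LaurentPolynomial.T_zero]; rfl⟩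

theorem mul_mem_laurentPowGrading (i j : ℤ) (x y : laurentPow K n)
    (hx : x ∈ laurentPowGrading K n i) (hy : y ∈ laurentPowGrading K n j) :
    x * y ∈ laurentPowGrading K n (i + j) := by
  rw [mem_laurentPowGrading] at *
  obtain ⟨a, ha⟩ := hx
  obtain ⟨b, hb⟩ := hy
  exact ⟨a * b, by
    rw [Subalgebra.coe_mul, ← ha, ← hb, LaurentPolynomial.T_add, smul_mul_smul_comm]⟩

theorem smul_mem_laurentPowGrading (d : ℤ) (k : K) (x : laurentPow K n)
    (hx : x ∈ laurentPowGrading K n d) : k • x ∈ laurentPowGrading K n d := by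
  rw [mem_laurentPowGrading] at *
  obtain ⟨a, ha⟩ := hx
  exact ⟨k * a, by rw [mul_smul, ha]; rfl⟩

theorem coeff_smul_T (a : K) (i j : ℤ) :
    (a • LaurentPolynomial.T i : K[T;T⁻¹]).coeff j = if i = j then a else 0 := by
  rw [LaurentPolynomial.T, AddMonoidAlgebra.smul_single, smul_eq_mul, mul_one]
  exact Finsupp.single_apply

theorem iSupIndep_laurentPowGrading : iSupIndep (laurentPowGrading K n) := by
  refine iSupIndep_of_hom (P := K) (fun d =>
    { toFun := fun r => (r : K[T;T⁻¹]).coeff d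
      map_zero' := rfl
      map_add' := fun _ _ => rfl }) ?_ ?_
  · intro d r hr h
    obtain ⟨a, ha⟩ := mem_laurentPowGrading.1 hr
    change (r : K[T;T⁻¹]).coeff d = 0 at h
    rw [← ha, coeff_smul_T, if_pos rfl] at h
    rw [h, zero_smul] at ha
    exact Subtype.ext ha.symm
  · intro i j hij r hr
    obtain ⟨a, ha⟩ := mem_laurentPowGrading.1 hr
    change (r : K[T;T⁻¹]).coeff j = 0
    rw [← ha, coeff_smul_T, if_neg hij]

/-- Nonzero homogeneous elements are invertible: the automorphism `x ↦ x⁻¹` of `K[x, x⁻¹]` preserves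
the subalgebra `K[xⁿ, x⁻ⁿ]` and maps `a x ^ d` to `a x ^ (-d)`. -/
theorem exists_mul_eq_one_of_mem_laurentPowGrading {d : ℤ} {r : laurentPow K n}
    (hr : r ∈ laurentPowGrading K n d) (hr0 : r ≠ 0) : ∃ s, s * r = 1 := by
  obtain ⟨a, ha⟩ := mem_laurentPowGrading.1 hr
  have ha0 : a ≠ 0 := by
    rintro rfl
    rw [zero_smul] at ha
    exact hr0 (Subtype.ext ha.symm)
  have hinv : LaurentPolynomial.invert (r : K[T;T⁻¹]) ∈ laurentPow K n := by
    have h : (r : K[T;T⁻¹]) ∈ (laurentPow K n).comap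
        (LaurentPolynomial.invert (R := K)).toAlgHom := by
      refine (Algebra.adjoin_le ?_ : laurentPow K n ≤ _) r.2
      rintro _ (rfl | rfl)
      · change LaurentPolynomial.invert (LaurentPolynomial.T (n : ℤ) : K[T;T⁻¹]) ∈ laurentPow K n
        rw [LaurentPolynomial.invert_T]
        exact Algebra.subset_adjoin (by simp)
      · change LaurentPolynomial.invert (LaurentPolynomial.T (-n : ℤ) : K[T;T⁻¹]) ∈ laurentPow K n
        rw [LaurentPolynomial.invert_T, neg_neg]
        exact Algebra.subset_adjoin (by simp)
    exact h
  refine ⟨(a⁻¹ * a⁻¹) • ⟨_, hinv⟩, Subtype.ext ?_⟩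
  change ((a⁻¹ * a⁻¹) • LaurentPolynomial.invert (r : K[T;T⁻¹])) * (r : K[T;T⁻¹]) = 1
  rw [← ha, map_smul, LaurentPolynomial.invert_T, smul_smul, smul_mul_smul_comm,
    ← LaurentPolynomial.T_add, neg_add_cancel, LaurentPolynomial.T_zero]
  rw [inv_mul_cancel_right₀ ha0, inv_mul_cancel₀ ha0, one_smul]

variable (K n) in
/-- The unit `xⁿ` of `K[xⁿ, x⁻ⁿ]`. -/
noncomputable def laurentPowUnit : (laurentPow K n)ˣ where
  val := ⟨LaurentPolynomial.T n, Algebra.subset_adjoin (by simp)⟩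
  inv := ⟨LaurentPolynomial.T (-n), Algebra.subset_adjoin (by simp)⟩
  val_inv := Subtype.ext (by
    change LaurentPolynomial.T (n : ℤ) * LaurentPolynomial.T (-n : ℤ) = (1 : K[T;T⁻¹])
    rw [← LaurentPolynomial.T_add, add_neg_cancel, LaurentPolynomial.T_zero])
  inv_val := Subtype.ext (by
    change LaurentPolynomial.T (-n : ℤ) * LaurentPolynomial.T (n : ℤ) = (1 : K[T;T⁻¹])
    rw [← LaurentPolynomial.T_add, neg_add_cancel, LaurentPolynomial.T_zero])

theorem laurentPowUnit_mem : (laurentPowUnit K n : laurentPow K n) ∈ laurentPowGrading K n n :=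
  mem_laurentPowGrading.2 ⟨1, one_smul _ _⟩

theorem laurentPowUnit_inv_mem :
    (↑(laurentPowUnit K n)⁻¹ : laurentPow K n) ∈ laurentPowGrading K n (-n) :=
  mem_laurentPowGrading.2 ⟨1, one_smul _ _⟩

theorem laurentPow_induction {P : laurentPow K n → Prop}
    (algebraMap : ∀ a : K, P (algebraMap K _ a)) (unit : P (laurentPowUnit K n))
    (unit_inv : P ↑(laurentPowUnit K n)⁻¹) (add : ∀ x y, P x → P y → P (x + y))
    (mul : ∀ x y, P x → P y → P (x * y)) (x : laurentPow K n) : P x := by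
  obtain ⟨x, hx⟩ := x
  induction hx using Algebra.adjoin_induction with
  | mem x hx =>
    rcases hx with rfl | rfl
    · exact unit
    · exact unit_inv
  | algebraMap a => exact algebraMap a
  | add x y hx hy h₁ h₂ => exact add ⟨x, hx⟩ ⟨y, hy⟩ h₁ h₂
  | mul x y hx hy h₁ h₂ => exact mul ⟨x, hx⟩ ⟨y, hy⟩ h₁ h₂

/-- For `n > 0`, the substitution `x ↦ xⁿ` identifies `K[x, x⁻¹]` with `K[xⁿ, x⁻ⁿ]`, so a
homomorphism from `K[xⁿ, x⁻ⁿ]` can be given by prescribing the image of the unit `xⁿ`. -/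
theorem exists_laurentPow_hom (hn : 0 < n) {B : Type*} [Ring B] [Algebra K B] (u : Bˣ) :
    ∃ f : laurentPow K n →ₐ[K] B, f (laurentPowUnit K n) = u := by
  let φ : K[T;T⁻¹] →ₐ[K] K[T;T⁻¹] :=
    AddMonoidAlgebra.mapDomainAlgHom K K (AddMonoidHom.mulLeft (n : ℤ))
  have hφ : ∀ m : ℤ, φ (LaurentPolynomial.T m) = LaurentPolynomial.T (n * m) := fun m =>
    AddMonoidAlgebra.mapDomain_single
  have hinj : Function.Injective φ := by
    refine AddMonoidAlgebra.mapDomain_injective fun a b h => ?_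
    exact mul_left_cancel₀ (by exact_mod_cast hn.ne' : (n : ℤ) ≠ 0) h
  have hle : laurentPow K n ≤ φ.range := by
    refine Algebra.adjoin_le ?_
    rintro _ (rfl | rfl)
    · exact ⟨LaurentPolynomial.T 1, by change φ _ = _; rw [hφ, mul_one]⟩
    · exact ⟨LaurentPolynomial.T (-1), by change φ _ = _; rw [hφ, mul_neg_one]⟩
  let e := AlgEquiv.ofInjective φ hinj
  let ψ : K[T;T⁻¹] →ₐ[K] B :=
    AddMonoidAlgebra.lift K B ℤ ((Units.coeHom B).comp (zpowersHom Bˣ u))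
  refine ⟨(ψ.comp e.symm.toAlgHom).comp (Subalgebra.inclusion hle), ?_⟩
  have h1 : e.symm (Subalgebra.inclusion hle (laurentPowUnit K n)) = LaurentPolynomial.T 1 := by
    rw [AlgEquiv.symm_apply_eq]
    refine Subtype.ext ?_
    change LaurentPolynomial.T (n : ℤ) = φ (LaurentPolynomial.T 1)
    rw [hφ, mul_one]
  change ψ (e.symm (Subalgebra.inclusion hle (laurentPowUnit K n))) = u
  rw [h1]
  refine (AddMonoidAlgebra.lift_single _ _ _).trans ?_
  simp [zpowersHom_apply]

end Coefficients

/-! ### The blocks of the sinks and of the cycles -/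

section Blocks

variable {V : Type uV} {A : Type uA}

namespace DirGraph

variable {G : DirGraph V A}

/-- The decomposition of a nontrivial path into its first edge and the remainder. -/
def PathTo.uncons {v : V} : G.PathTo v → Option (A × G.PathTo v)
  | ⟨[], _⟩ => none
  | ⟨e :: l, h⟩ => some (e, ⟨l, h.1.tail, by
      cases l with
      | nil => simp
      | cons f l => simpa using h.2⟩)

theorem PathTo.uncons_nil (v : V) : (PathTo.nil v : G.PathTo v).uncons = none := rfl

theorem PathTo.uncons_cons {v : V} (e : A) (q : G.PathTo v) (h : G.r e = q.src) :
    (q.cons e h).uncons = some (e, q) := rfl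

theorem PathTo.eq_nil_of_uncons {v : V} {p : G.PathTo v} (h : p.uncons = none) :
    p = PathTo.nil v := by
  induction p using PathTo.induction with
  | nil => rfl
  | cons e q hq _ => rw [uncons_cons] at h; cases h

theorem PathTo.exists_of_uncons {v : V} {p : G.PathTo v} {e : A} {q : G.PathTo v}
    (h : p.uncons = some (e, q)) : ∃ hq : G.r e = q.src, p = q.cons e hq := by
  induction p using PathTo.induction with
  | nil => rw [uncons_nil] at h; cases h
  | cons e' q' hq' _ => rw [uncons_cons] at h; cases h; exact ⟨hq', rfl⟩

end DirGraph

open DirGraph LeavittPathAlgebra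

variable [Fintype V] [Fintype A] [DecidableEq V]
  {K : Type uK} [Field K] {G : DirGraph V A}

local notation "ν" v:max => LeavittPathAlgebra.gen K G (LeavittGen.vertex v)
local notation "ε" e:max => LeavittPathAlgebra.gen K G (LeavittGen.edge e)
local notation "γ" e:max => LeavittPathAlgebra.gen K G (LeavittGen.ghost e)

/-- The paths ending at a sink. -/
def sinkSystem {v : V} (hv : ∀ e, G.s e ≠ v) (R : Type*) [CommRing R] :
    PathSystem G R (G.PathTo v) v where
  src := PathTo.src
  dec := PathTo.uncons
  wt _ := 1
  sink_of_dec p hp e := by rw [PathTo.eq_nil_of_uncons hp]; exact hv e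
  source_eq p e q hp := by obtain ⟨h, rfl⟩ := PathTo.exists_of_uncons hp; rfl
  range_eq p e q hp := (PathTo.exists_of_uncons hp).1
  dec_inj p p' e q hp hp' := by
    obtain ⟨h, rfl⟩ := PathTo.exists_of_uncons hp
    obtain ⟨h', rfl⟩ := PathTo.exists_of_uncons hp'
    rfl
  exists_dec e q h := ⟨q.cons e h, rfl⟩
  path := id
  src_eq _ := rfl
  nil := PathTo.nil v
  path_nil := rfl
  eq_nil p hp := by
    induction p using PathTo.induction with
    | nil => rfl
    | cons e q hq _ => exact absurd hp (hv e)
  dec_cons p hp := by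
    induction p using PathTo.induction with
    | nil => exact absurd rfl hp
    | cons e q hq _ => exact ⟨e, q, hq, rfl, rfl, rfl⟩

variable (K) in
/-- The block of a sink. -/
noncomputable def sinkBlock {v : V} (hv : ∀ e, G.s e ≠ v) [Fintype (G.PathTo v)]
    [DecidableEq (G.PathTo v)] :
    LeavittBlock K G K (trivialGrading K) (G.PathTo v) v where
  toPathSystem := sinkSystem hv K
  coeff := Algebra.ofId K _
  edge_mul p e q hp := by
    obtain ⟨h, rfl⟩ := PathTo.exists_of_uncons hp
    simp only [sinkSystem, id, ofPath_cons, Units.val_one, map_one, mul_one]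
  toMatrix_coeff r := by
    rw [Algebra.ofId_apply, ← Algebra.commutes, ← Algebra.smul_def, map_smul,
      PathSystem.toMatrix_vert, Matrix.smul_single, smul_eq_mul, mul_one]
  wt_mem p e q hp := by
    obtain ⟨h, rfl⟩ := PathTo.exists_of_uncons hp
    convert one_mem_trivialGrading K using 2
    · simp only [sinkSystem, id, PathTo.cons_val, List.length_cons]; push_cast; ring
    · rfl
  wt_inv_mem p e q hp := by
    obtain ⟨h, rfl⟩ := PathTo.exists_of_uncons hp
    simp only [sinkSystem, inv_one]
    convert one_mem_trivialGrading K using 2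
    · simp only [id, PathTo.cons_val, List.length_cons]; push_cast; ring
    · rfl

theorem ofPath_mul_ofGhostPath {v : V} (p : G.PathTo v)
    (hp : ∀ e ∈ p.1, ∀ f, G.s f = G.s e → f = e) :
    ofPath K G p * ofGhostPath K G p = ν p.src := by
  induction p using PathTo.induction with
  | nil => rw [ofPath_nil, ofGhostPath_nil, vert_mul_self]; rfl
  | cons e q hq ih =>
    rw [PathTo.cons_val] at hp
    rw [ofPath_cons, ofGhostPath_cons, mul_assoc, ← mul_assoc (ofPath K G q),
      ih fun f hf => hp f (by simp [hf]), ← hq, range_mul_ghost, PathTo.src_cons,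
      vert_eq_sum K G ⟨e, rfl⟩, Finset.sum_eq_single e]
    · intro f hf hne
      exact absurd (hp e (by simp) f (Finset.mem_filter.1 hf).2) hne
    · simp

section CycleBlock

variable {c : G.Cycles} {e : A}

open Classical in
/-- The paths ending at a vertex `s(e)` of the cycle `c = e t` which do not include all the edges of
`c`.  The trivial path decomposes as `e t`, with the given weight. -/
noncomputable def cycleSystem (hG : G.NoCycleHasExit) (t : G.PathTo (G.s e)) (ht : G.r e = t.src)
    (hc : c.1 = ((e :: t.1 : List A) : Cycle A)) (hnd : (G.s e :: t.1.map G.s).Nodup)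
    {R : Type*} [CommRing R] (u : Rˣ) : PathSystem G R (G.CyclePathTo c (G.s e)) (G.s e) :=
  have he : e ∈ c.1 := by rw [hc]; simp
  have hQ : ∀ p : G.PathTo (G.s e), (e :: t.1 <:+ p.1 ↔ ∀ f ∈ c.1, f ∈ p.1) :=
    hG.suffix_iff c t ht hc hnd
  have htQ : ¬ ∀ f ∈ c.1, f ∈ t.1 := fun h =>
    (List.nodup_cons.1 hnd).1 (List.mem_map_of_mem (h e he))
  have hnil : ¬ ∀ f ∈ c.1, f ∈ (PathTo.nil (G.s e) : G.PathTo (G.s e)).1 := fun h => by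
    simpa [PathTo.nil] using h e he
  have htail : ∀ (f : A) (q : G.PathTo (G.s e)) (h : G.r f = q.src),
      (¬ ∀ f' ∈ c.1, f' ∈ (q.cons f h).1) → ¬ ∀ f' ∈ c.1, f' ∈ q.1 := fun f q h hp hq =>
    hp fun f' hf' => List.mem_cons_of_mem _ (hq f' hf')
  let dec : G.CyclePathTo c (G.s e) → Option (A × G.CyclePathTo c (G.s e)) := fun p =>
    p.1.uncons.elim (some (e, ⟨t, htQ⟩)) fun x =>
      if h : ¬ ∀ f ∈ c.1, f ∈ x.2.1 then some (x.1, ⟨x.2, h⟩) else none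
  have dec_nil : ∀ h, dec ⟨PathTo.nil (G.s e), h⟩ = some (e, ⟨t, htQ⟩) := fun h => rfl
  have dec_cons : ∀ f q h hp, dec ⟨PathTo.cons f q h, hp⟩ = some (f, ⟨q, htail f q h hp⟩) :=
    fun f q h hp => dif_pos (htail f q h hp)
  have dec_cases : ∀ p f q, dec p = some (f, q) →
      (p = ⟨PathTo.nil (G.s e), hnil⟩ ∧ f = e ∧ q = ⟨t, htQ⟩) ∨
      ∃ h : G.r f = q.1.src, p.1 = PathTo.cons f q.1 h := by
    rintro ⟨p, hp⟩ f q h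
    induction p using PathTo.induction with
    | nil =>
      rw [dec_nil] at h
      cases h
      exact Or.inl ⟨rfl, rfl, rfl⟩
    | cons f' q' h' _ =>
      rw [dec_cons] at h
      cases h
      exact Or.inr ⟨h', rfl⟩
  { src := fun p => p.1.src
    dec := dec
    wt := fun p => if p.1 = PathTo.nil (G.s e) then u else 1
    sink_of_dec := by
      rintro ⟨p, hp⟩ h
      induction p using PathTo.induction with
      | nil => rw [dec_nil] at h; cases h
      | cons f' q' h' _ => rw [dec_cons] at h; cases h
    source_eq := by
      intro p f q h
      rcases dec_cases p f q h with ⟨rfl, rfl, rfl⟩ | ⟨h', hp⟩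
      · rfl
      · rw [hp]; rfl
    range_eq := by
      intro p f q h
      rcases dec_cases p f q h with ⟨rfl, rfl, rfl⟩ | ⟨h', hp⟩
      · exact ht
      · exact h'
    dec_inj := by
      intro p p' f q h h'
      rcases dec_cases p f q h with ⟨rfl, rfl, rfl⟩ | ⟨h1, hp⟩
      · rcases dec_cases p' f _ h' with ⟨rfl, -, -⟩ | ⟨h1, hp⟩
        · rfl
        · refine absurd ((hQ p'.1).1 ?_) p'.2
          rw [hp]; exact List.suffix_rfl
      · rcases dec_cases p' f q h' with ⟨rfl, rfl, rfl⟩ | ⟨h1', hp'⟩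
        · refine absurd ((hQ p.1).1 ?_) p.2
          rw [hp]; exact List.suffix_rfl
        · exact Subtype.ext (hp.trans hp'.symm)
    exists_dec := by
      rintro f ⟨q, hq⟩ h
      by_cases hfq : ∀ f' ∈ c.1, f' ∈ (q.cons f h).1
      · -- the path `f q` includes all the edges of the cycle, but `q` does not, so `f q = e t`
        rcases List.suffix_cons_iff.1 ((hQ _).2 hfq) with h1 | h1
        · rw [List.cons.injEq] at h1
          obtain ⟨rfl, h2⟩ := h1
          obtain rfl : t = q := Subtype.ext h2
          exact ⟨⟨PathTo.nil (G.s e), hnil⟩, dec_nil _⟩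
        · exact absurd ((hQ q).1 h1) hq
      · exact ⟨⟨q.cons f h, hfq⟩, dec_cons f q h hfq⟩
    path := fun p => p.1
    src_eq := fun p => rfl
    nil := ⟨PathTo.nil (G.s e), hnil⟩
    path_nil := rfl
    eq_nil := by
      intro p hp
      by_contra hne
      refine absurd ((hQ p.1).1 (hG.suffix_of_closed c t ht hc hnd p.1 hp fun h => hne ?_)) p.2
      exact Subtype.ext (Subtype.ext h)
    dec_cons := by
      rintro ⟨p, hp⟩ hne
      induction p using PathTo.induction with
      | nil => exact absurd rfl hne
      | cons f q h _ =>
        refine ⟨f, _, h, dec_cons f q h hp, rfl, if_neg fun h0 => ?_⟩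
        have := congrArg (fun p : G.PathTo (G.s e) => p.1.length) h0
        simp [PathTo.cons_val, PathTo.nil] at this }

variable (K) in
/-- The block of a cycle.  With the closed path `C` which runs once around the cycle from `w`, the
unit `x ^ |c|` acts as `C + (1 - w)`. -/
theorem exists_cycleBlock (hG : G.NoCycleHasExit) (c : G.Cycles) {w : V} (hw : w ∈ c.1.map G.s)
    [Fintype (G.CyclePathTo c w)] [DecidableEq (G.CyclePathTo c w)] :
    ∃ S : LeavittBlock K G (laurentPow K c.1.length) (laurentPowGrading K c.1.length)
      (G.CyclePathTo c w) w, ∀ p, S.path p = p.1 := by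
  obtain ⟨e, he, rfl⟩ := Cycle.mem_map.1 hw
  obtain ⟨t, ht, hc, hnd⟩ := c.exists_eq_cons he
  have hlen : c.1.length = t.1.length + 1 := by rw [hc]; rfl
  have hpos : 0 < c.1.length := by omega
  let S := cycleSystem hG t ht hc hnd (laurentPowUnit K c.1.length)
  have hpath : ∀ p, S.path p = p.1 := fun p => rfl
  have hnil : S.path S.nil = PathTo.nil (G.s e) := rfl
  obtain ⟨t', ht', hdec⟩ : ∃ t', S.path t' = t ∧ S.dec S.nil = some (e, t') := ⟨_, rfl, rfl⟩
  have hwt : S.wt S.nil = laurentPowUnit K c.1.length := if_pos rfl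
  have hwt' : ∀ p, p ≠ S.nil → S.wt p = 1 := fun p hp => by
    obtain ⟨_, _, _, _, _, h⟩ := S.dec_cons p hp
    exact h
  have hdet : ∀ f ∈ (t.cons e ht).1, ∀ g, G.s g = G.s f → g = f := fun f hf =>
    hG c f (by rw [hc]; exact hf)
  -- the closed path `C = e t` and its adjoint `D` are inverse to each other in the corner
  have hCD : ofPath K G (t.cons e ht) * ofGhostPath K G (t.cons e ht) = ν (G.s e) :=
    ofPath_mul_ofGhostPath _ hdet
  have hDC := ofGhostPath_mul_ofPath (K := K) (t.cons e ht)
  have hvC : ν (G.s e) * ofPath K G (t.cons e ht) = ofPath K G (t.cons e ht) :=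
    src_mul_ofPath (t.cons e ht)
  have hCv := ofPath_mul_vert (K := K) (t.cons e ht)
  have hvD := vert_mul_ofGhostPath (K := K) (t.cons e ht)
  have hDv : ofGhostPath K G (t.cons e ht) * ν (G.s e) = ofGhostPath K G (t.cons e ht) :=
    ofGhostPath_mul_src (t.cons e ht)
  have hvv := vert_mul_self K G (G.s e)
  have hMC : S.toMatrix K (ofPath K G (t.cons e ht)) =
      Matrix.single S.nil S.nil (laurentPowUnit K c.1.length : laurentPow K c.1.length) := by
    rw [ofPath_cons, map_mul]
    have := S.toMatrix_path (K := K) t'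
    rw [ht'] at this
    rw [this, S.toMatrix_edge_mul_single hdec, hwt, mul_one]
  have hMD : S.toMatrix K (ofGhostPath K G (t.cons e ht)) = Matrix.single S.nil S.nil
      (↑(laurentPowUnit K c.1.length)⁻¹ : laurentPow K c.1.length) := by
    rw [ofGhostPath_cons, map_mul]
    have := S.toMatrix_ghostPath (K := K) t'
    rw [ht'] at this
    rw [this, S.toMatrix_single_mul_ghost hdec, hwt, one_mul]
  have hCe : ofPath K G (t.cons e ht) = ε e * ofPath K G t := ofPath_cons e t ht
  generalize ofPath K G (t.cons e ht) = C at *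
  generalize ofGhostPath K G (t.cons e ht) = D at *
  let U : (LeavittPathAlgebra K G)ˣ :=
    { val := C + (1 - ν (G.s e))
      inv := D + (1 - ν (G.s e))
      val_inv := by
        simp only [mul_add, add_mul, mul_sub, sub_mul, mul_one, one_mul, hCD, hCv, hvD, hvv]
        abel
      inv_val := by
        simp only [mul_add, add_mul, mul_sub, sub_mul, mul_one, one_mul, hDC, hDv, hvC, hvv]
        abel }
  obtain ⟨Θ, hΘ⟩ := exists_laurentPow_hom (K := K) hpos U
  have hΘinv : Θ ↑(laurentPowUnit K c.1.length)⁻¹ = ↑U⁻¹ := by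
    have h : Units.map (Θ : laurentPow K c.1.length →* LeavittPathAlgebra K G)
        (laurentPowUnit K c.1.length) = U := Units.ext hΘ
    rw [← h, ← map_inv]; rfl
  have hvU : ν (G.s e) * (U : LeavittPathAlgebra K G) = C := by
    change ν (G.s e) * (C + (1 - ν (G.s e))) = C
    rw [mul_add, mul_sub, hvC, hvv, mul_one, sub_self, add_zero]
  have hvU' : ν (G.s e) * (↑U⁻¹ : LeavittPathAlgebra K G) = D := by
    change ν (G.s e) * (D + (1 - ν (G.s e))) = D
    rw [mul_add, mul_sub, hvD, hvv, mul_one, sub_self, add_zero]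
  refine ⟨{ toPathSystem := S, coeff := Θ, edge_mul := ?_, toMatrix_coeff := ?_, wt_mem := ?_,
            wt_inv_mem := ?_ }, hpath⟩
  · intro p f q h
    by_cases hp : p = S.nil
    · subst hp
      rw [hdec] at h
      cases h
      rw [ht', hwt, hΘ, hnil, ofPath_nil, hvU, hCe]
    · obtain ⟨f', q', h', hdec', hp', hw'⟩ := S.dec_cons p hp
      rw [hdec'] at h
      cases h
      rw [hp', hw', ofPath_cons, Units.val_one, map_one, mul_one]
  · intro r
    induction r using laurentPow_induction with
    | algebraMap a =>
      rw [AlgHom.commutes, ← Algebra.commutes, ← Algebra.smul_def, map_smul,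
        S.toMatrix_vert, Matrix.smul_single, Algebra.smul_def, mul_one]
    | unit => rw [hΘ, hvU, hMC]
    | unit_inv => rw [hΘinv, hvU', hMD]
    | add x y hx hy => rw [map_add, mul_add, map_add, hx, hy, Matrix.single_add]
    | mul x y hx hy =>
      have h1 : Matrix.single S.nil S.nil x * S.toMatrix K (ν (G.s e)) =
          Matrix.single S.nil S.nil x := by
        rw [S.toMatrix_vert, Matrix.single_mul_single_same, mul_one]
      rw [map_mul Θ, ← mul_assoc, map_mul, hx, ← h1, mul_assoc, ← map_mul (S.toMatrix K), hy,
        Matrix.single_mul_single_same]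
  · intro p f q h
    by_cases hp : p = S.nil
    · subst hp
      rw [hdec] at h
      cases h
      rw [ht', hwt, hnil]
      convert laurentPowUnit_mem (K := K) using 2
      rw [hlen]; simp only [PathTo.nil, List.length_nil]; push_cast; ring
    · obtain ⟨f', q', h', hdec', hp', hw'⟩ := S.dec_cons p hp
      rw [hdec'] at h
      cases h
      rw [hp', hw']
      convert one_mem_laurentPowGrading (K := K) using 2
      · simp only [PathTo.cons_val, List.length_cons]; push_cast; ring
      · rfl
  · intro p f q h
    by_cases hp : p = S.nil
    · subst hp
      rw [hdec] at h
      cases h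
      rw [ht', hwt, hnil]
      convert laurentPowUnit_inv_mem (K := K) using 2
      rw [hlen]; simp only [PathTo.nil, List.length_nil]; push_cast; ring
    · obtain ⟨f', q', h', hdec', hp', hw'⟩ := S.dec_cons p hp
      rw [hdec'] at h
      cases h
      rw [hp', hw', inv_one]
      convert one_mem_laurentPowGrading (K := K) using 2
      · simp only [PathTo.cons_val, List.length_cons]; push_cast; ring
      · rfl

end CycleBlock

end Blocks

/-! ### The graded matrix decomposition -/

section Decomposition

variable {V : Type uV} {A : Type uA}

namespace DirGraph

variable {G : DirGraph V A}

theorem PathTo.eq_of_sink {u v : V} (p : G.PathTo v) (hp : p.src = u) (hu : ∀ e, G.s e ≠ u) :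
    u = v := by
  induction p using PathTo.induction with
  | nil => exact hp.symm
  | cons e q h _ => exact absurd hp (hu e)

theorem onCycle_of_mem_map {c : G.Cycles} {w : V} (hw : w ∈ c.1.map G.s) : OnCycle c w :=
  Cycle.mem_map.1 hw

theorem not_onCycle_of_sink {c : G.Cycles} {v : V} (hv : ∀ e, G.s e ≠ v) : ¬ OnCycle c v :=
  fun ⟨e, _, he⟩ => hv e he

theorem NoCycleHasExit.finite_pathTo [Finite V] [Finite A] (hG : G.NoCycleHasExit) {v : V}
    (hv : ∀ e, G.s e ≠ v) : Finite (G.PathTo v) := by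
  have := finite_of_nodup_map_source (P := fun _ : G.PathTo v => True) fun p _ =>
    hG.nodup_map_source p fun c hc => absurd hc (not_onCycle_of_sink hv)
  exact Finite.of_injective (fun p => (⟨p, trivial⟩ : {p : G.PathTo v // True})) fun p q h =>
    congrArg (fun x => x.1) h

theorem NoCycleHasExit.finite_cyclePathTo [Finite V] [Finite A] (hG : G.NoCycleHasExit)
    {c : G.Cycles} {w : V} (hw : OnCycle c w) : Finite (G.CyclePathTo c w) :=
  finite_of_nodup_map_source fun p hp => hG.nodup_map_source p fun c' hc' => by
    rw [hG.cycle_unique hc' hw]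
    simpa using hp

theorem nonempty_cyclePathTo {c : G.Cycles} {w : V} (hw : OnCycle c w) :
    Nonempty (G.CyclePathTo c w) := by
  obtain ⟨e, he, -⟩ := hw
  exact ⟨PathTo.nil w, fun h => by simpa [PathTo.nil] using h e he⟩

end DirGraph

open DirGraph LeavittPathAlgebra

/-- Let `f` be a map which shifts degrees by `d`, into a ring whose homogeneous components are
independent.  If `f x` is homogeneous of the degree `n + d`, then it is the image of the component
of `x` of degree `n`. -/
theorem map_homogComp_of_mem {M P : Type*} [AddCommGroup M] {ℳ : ℤ → AddSubgroup M}
    (h : DirectSum.IsInternal ℳ) [Ring P] {ℛ : ℤ → AddSubgroup P} (hℛ : iSupIndep ℛ) {d : ℤ}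
    (f : M →+ P) (hf : ∀ m, ∀ x ∈ ℳ m, f x ∈ ℛ (m + d)) {n : ℤ} {x : M}
    (hx : f x ∈ ℛ (n + d)) : f (homogComp h n x) = f x := by
  set y := x - homogComp h n x with hy
  have hn : homogComp h n y = 0 := by
    rw [hy, map_sub, homogComp_of_mem h (homogComp_mem h n x), sub_self]
  have key : f y = 0 := by
    refine AddSubgroup.disjoint_def.1 (hℛ (n + d)) ?_ ?_
    · rw [hy, map_sub]
      exact sub_mem hx (hf n _ (homogComp_mem h n x))
    · obtain ⟨s, hs⟩ := exists_sum_homogComp h y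
      rw [← hs, map_sum]
      refine sum_mem fun m _ => ?_
      by_cases hm : m = n
      · rw [hm, hn, map_zero]; exact zero_mem _
      · exact AddSubgroup.mem_iSup_of_mem (m + d) (AddSubgroup.mem_iSup_of_mem (by simpa using hm)
          (hf m _ (homogComp_mem h m y)))
  rw [hy, map_sub, sub_eq_zero] at key
  exact key.symm

variable [Fintype V] [Fintype A] [DecidableEq V]
  {K : Type uK} [Field K] {G : DirGraph V A}

local notation "ν" v:max => LeavittPathAlgebra.gen K G (LeavittGen.vertex v)

/-- The vertices which are sinks or bases of cycles suffice to recognize zero, as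
`v = ∑ e e*` and `x y e = (x (y e)) r(e)`. -/
theorem LeavittPathAlgebra.eq_zero_of_mul_vert_eq_zero (base : G.Cycles → V)
    (hbase : ∀ c : G.Cycles, base c ∈ c.1.map G.s) {x : LeavittPathAlgebra K G}
    (hsink : ∀ v, (∀ e, G.s e ≠ v) → ∀ y, x * y * ν v = 0)
    (hcycle : ∀ c y, x * y * ν (base c) = 0) : x = 0 := by
  have h : ∀ v, ∀ y, x * y * ν v = 0 := by
    refine vertex_induction base hbase hsink hcycle fun v hv ih y => ?_
    rw [vert_eq_sum K G hv, Finset.mul_sum]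
    refine Finset.sum_eq_zero fun e he => ?_
    rw [← edge_mul_range K G e, ← mul_assoc, ← mul_assoc, mul_assoc x y,
      ih e (Finset.mem_filter.1 he).2, zero_mul]
  calc x = ∑ v, x * 1 * ν v := by rw [← Finset.mul_sum, sum_vert, mul_one, mul_one]
    _ = 0 := Finset.sum_eq_zero fun v _ => h v 1

/-- The matrix units of a block at `w` vanish in a block none of whose paths starts at `w`. -/
theorem LeavittBlock.toMatrix_matrixUnit_eq_zero {R : Type*} [CommRing R] [Algebra K R]
    {ℛ : ℤ → AddSubgroup R} {I : Type*} [Fintype I] [DecidableEq I] {w : V}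
    (S : LeavittBlock K G R ℛ I w)
    {R' : Type*} [CommRing R'] [Algebra K R'] {ℛ' : ℤ → AddSubgroup R'} {I' : Type*} [Fintype I']
    [DecidableEq I'] {w' : V} (S' : LeavittBlock K G R' ℛ' I' w')
    (h : ∀ p : G.PathTo w', p.src ≠ w) (p q : I) (r : R) :
    S'.toMatrix K (ofPath K G (S.path p) * S.coeff r * ofGhostPath K G (S.path q)) = 0 := by
  have h0 : S'.toMatrix K (ν w) = 0 := by
    ext i j
    rw [BranchingSystem.toMatrix_vert_apply, if_neg]
    · rfl
    · rintro ⟨hi, -⟩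
      rw [S'.src_eq] at hi
      exact h _ hi
  rw [← ofPath_mul_vert, map_mul, map_mul, map_mul, h0, mul_zero, zero_mul, zero_mul]

/-- If no cycle has an exit, the sum of the block representations of the sinks and of the cycles is
an isomorphism.  It is injective since a vertex which is neither a sink nor the base of a cycle can
be replaced by the ranges of its edges.  It is surjective since the matrix units of a block vanish
in the others: no path leads from a sink, or from a cycle, to another sink or cycle.  It reflects
degrees since a homogeneous component of `x` and `x` itself have the same image if that of `x` is
homogeneous. -/
theorem DirGraph.NoCycleHasExit.hasGradedMatrixDecomposition (hG : G.NoCycleHasExit)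
    (base : G.Cycles → V) (hbase : ∀ c : G.Cycles, base c ∈ c.1.map G.s) :
    HasGradedMatrixDecomposition K G base := by
  classical
  have hon : ∀ c : G.Cycles, OnCycle c (base c) := fun c => onCycle_of_mem_map (hbase c)
  have hfinV : Finite G.Sinks := Subtype.finite
  have hfinC : Finite G.Cycles := finite_cycles
  have hfinP : ∀ v : G.Sinks, Finite (G.PathTo v.1) := fun v => hG.finite_pathTo v.2
  have hfinQ : ∀ c : G.Cycles, Finite (G.CyclePathTo c (base c)) := fun c =>
    hG.finite_cyclePathTo (hon c)
  cases nonempty_fintype G.Sinks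
  cases nonempty_fintype G.Cycles
  let fP : ∀ v : G.Sinks, Fintype (G.PathTo v.1) := fun v => Fintype.ofFinite _
  let fQ : ∀ c : G.Cycles, Fintype (G.CyclePathTo c (base c)) := fun c => Fintype.ofFinite _
  refine ⟨hfinV, hfinC, fP, fQ, fun v => Fintype.card_pos_iff.2 ⟨PathTo.nil _⟩,
    fun c => Fintype.card_pos_iff.2 (nonempty_cyclePathTo (hon c)), ?_⟩
  let SV : ∀ v : G.Sinks, LeavittBlock K G K (trivialGrading K) (G.PathTo v.1) v.1 :=
    fun v => sinkBlock K v.2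
  choose SC hSC using fun c => exists_cycleBlock K hG c (hbase c)
  let MV : G.Sinks → Type _ := fun v => Matrix (G.PathTo v.1) (G.PathTo v.1) K
  let MC : G.Cycles → Type _ := fun c =>
    Matrix (G.CyclePathTo c (base c)) (G.CyclePathTo c (base c)) (laurentPow K c.1.length)
  let φ : LeavittPathAlgebra K G →ₐ[K]
      ((v : G.Sinks) → Matrix (G.PathTo v.1) (G.PathTo v.1) K) ×
      ((c : G.Cycles) → Matrix (G.CyclePathTo c (base c)) (G.CyclePathTo c (base c))
          (laurentPow K c.1.length)) :=
    AlgHom.prod (AlgHom.pi fun v => (SV v).toMatrix K) (AlgHom.pi fun c => (SC c).toMatrix K)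
  have hφ1 : ∀ x v, (φ x).1 v = (SV v).toMatrix K x := fun x v => rfl
  have hφ2 : ∀ x c, (φ x).2 c = (SC c).toMatrix K x := fun x c => rfl
  have hinj : Function.Injective φ := by
    refine (injective_iff_map_eq_zero φ).2 fun x hx => ?_
    refine eq_zero_of_mul_vert_eq_zero base hbase (fun v hv y => ?_) fun c y => ?_
    · obtain ⟨v, rfl⟩ : ∃ v' : G.Sinks, v'.1 = v := ⟨⟨v, hv⟩, rfl⟩
      refine (SV v).mul_vert_eq_zero _ ?_
      rw [← hφ1, map_mul, hx, zero_mul]; rfl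
    · refine (SC c).mul_vert_eq_zero _ ?_
      rw [← hφ2, map_mul, hx, zero_mul]; rfl
  have hVV : ∀ v v' : G.Sinks, v' ≠ v → ∀ p : G.PathTo v'.1, p.src ≠ v.1 := fun v v' hne p hp =>
    hne (Subtype.ext (p.eq_of_sink hp v.2).symm)
  have hVC : ∀ (v : G.Sinks) c, ∀ p : G.PathTo (base c), p.src ≠ v.1 := fun v c p hp =>
    not_onCycle_of_sink v.2 ((p.eq_of_sink hp v.2) ▸ hon c)
  have hCV : ∀ c (v : G.Sinks), ∀ p : G.PathTo v.1, p.src ≠ base c := fun c v p hp =>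
    not_onCycle_of_sink v.2 (hG.path_onCycle c p (hp ▸ hon c)).2
  have hCC : ∀ c c', c' ≠ c → ∀ p : G.PathTo (base c'), p.src ≠ base c := fun c c' hne p hp =>
    hne (hG.cycle_unique (hon c') (hG.path_onCycle c p (hp ▸ hon c)).2)
  have hunitV : ∀ v p q r, ∃ x, φ x = (Pi.single (M := MV) v (Matrix.single p q r), 0) := by
    intro v p q r
    refine ⟨ofPath K G ((SV v).path p) * (SV v).coeff r * ofGhostPath K G ((SV v).path q),
      Prod.ext (funext fun v' => ?_) (funext fun c => ?_)⟩
    · rw [hφ1]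
      by_cases h : v' = v
      · subst h
        refine Eq.trans ?_ (Pi.single_eq_same (M := MV) v' _).symm
        exact (SV v').toMatrix_matrixUnit p q r
      · refine Eq.trans ?_ (Pi.single_eq_of_ne (M := MV) h _).symm
        exact (SV v).toMatrix_matrixUnit_eq_zero (SV v') (hVV v v' h) p q r
    · exact (SV v).toMatrix_matrixUnit_eq_zero (SC c) (hVC v c) p q r
  have hunitC : ∀ c p q r, ∃ x, φ x = (0, Pi.single (M := MC) c (Matrix.single p q r)) := by
    intro c p q r
    refine ⟨ofPath K G ((SC c).path p) * (SC c).coeff r * ofGhostPath K G ((SC c).path q),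
      Prod.ext (funext fun v => ?_) (funext fun c' => ?_)⟩
    · exact (SC c).toMatrix_matrixUnit_eq_zero (SV v) (hCV c v) p q r
    · rw [hφ2]
      by_cases h : c' = c
      · subst h
        refine Eq.trans ?_ (Pi.single_eq_same (M := MC) c' _).symm
        exact (SC c').toMatrix_matrixUnit p q r
      · refine Eq.trans ?_ (Pi.single_eq_of_ne (M := MC) h _).symm
        exact (SC c).toMatrix_matrixUnit_eq_zero (SC c') (hCC c c' h) p q r
  have hsurj : Function.Surjective φ := by
    intro z
    change z ∈ φ.range
    have hz : z = ∑ v, ∑ p, ∑ q, (Pi.single (M := MV) v (Matrix.single p q (z.1 v p q)), 0) +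
        ∑ c, ∑ p, ∑ q, (0, Pi.single (M := MC) c (Matrix.single p q (z.2 c p q))) := by
      refine Prod.ext ?_ ?_
      · simp only [Prod.fst_add, Prod.fst_sum, Finset.sum_const_zero, add_zero]
        conv_lhs => rw [← Finset.univ_sum_single z.1]
        refine Finset.sum_congr rfl fun v _ => ?_
        conv_lhs => rw [Matrix.matrix_eq_sum_single (z.1 v)]
        simp only [← AddMonoidHom.single_apply, map_sum]
        rfl
      · simp only [Prod.snd_add, Prod.snd_sum, Finset.sum_const_zero, zero_add]
        conv_lhs => rw [← Finset.univ_sum_single z.2]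
        refine Finset.sum_congr rfl fun c _ => ?_
        conv_lhs => rw [Matrix.matrix_eq_sum_single (z.2 c)]
        simp only [← AddMonoidHom.single_apply, map_sum]
        rfl
    rw [hz]
    exact add_mem
      (sum_mem fun v _ => sum_mem fun p _ => sum_mem fun q _ => hunitV v p q _)
      (sum_mem fun c _ => sum_mem fun p _ => sum_mem fun q _ => hunitC c p q _)
  have hdegV : ∀ n, ∀ x ∈ grading K G n, ∀ v, (SV v).toMatrix K x ∈
      matrixGrading (trivialGrading K) (fun p : G.PathTo v.1 => (p.1.length : ℤ)) n :=
    fun n x hx v => (SV v).toMatrix_mem_matrixGrading (one_mem_trivialGrading K)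
      (mul_mem_trivialGrading K) (smul_mem_trivialGrading K) hx
  have hdegC : ∀ n, ∀ x ∈ grading K G n, ∀ c, (SC c).toMatrix K x ∈
      matrixGrading (laurentPowGrading K c.1.length)
        (fun q : G.CyclePathTo c (base c) => (q.1.1.length : ℤ)) n := fun n x hx c => by
    have := (SC c).toMatrix_mem_matrixGrading one_mem_laurentPowGrading
      mul_mem_laurentPowGrading smul_mem_laurentPowGrading hx
    simpa only [hSC] using this
  refine ⟨AlgEquiv.ofBijective φ ⟨hinj, hsurj⟩, fun n x =>
    ⟨fun hx => ⟨hdegV n x hx, hdegC n x hx⟩, fun ⟨hV, hC⟩ => ?_⟩⟩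
  have hI := (isGradedModule_grading (K := K) (G := G)).isInternal
  rw [← hinj (a₁ := homogComp hI n x) (a₂ := x)]
  · exact homogComp_mem hI n x
  · refine Prod.ext (funext fun v => Matrix.ext fun i j => ?_)
      (funext fun c => Matrix.ext fun i j => ?_)
    · refine map_homogComp_of_mem hI (iSupIndep_trivialGrading K)
        (d := (j.1.length : ℤ) - i.1.length)
        ((Matrix.entryAddMonoidHom K i j).comp ((SV v).toMatrix K).toRingHom.toAddMonoidHom)
        (fun m y hy => ?_) ?_
      · have := hdegV m y hy v i j
        rwa [add_sub_assoc] at this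
      · have := hV v i j
        rwa [add_sub_assoc] at this
    · refine map_homogComp_of_mem hI iSupIndep_laurentPowGrading
        (d := (j.1.1.length : ℤ) - i.1.1.length)
        ((Matrix.entryAddMonoidHom _ i j).comp ((SC c).toMatrix K).toRingHom.toAddMonoidHom)
        (fun m y hy => ?_) ?_
      · have := hdegC m y hy c i j
        rwa [add_sub_assoc] at this
      · have := hC c i j
        rwa [add_sub_assoc] at this

end Decomposition

/-! ### Consequences of the graded matrix decomposition -/

section Consequences

/-- A nilpotent matrix over a domain has characteristic polynomial `X ^ m`. -/
theorem Matrix.pow_card_eq_zero_of_isNilpotent {R I : Type*} [CommRing R] [IsDomain R] [Fintype I]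
    [DecidableEq I] {M : Matrix I I R} (hM : IsNilpotent M) : M ^ Fintype.card I = 0 := by
  have h := sub_eq_zero.1 (Matrix.isNilpotent_charpoly_sub_pow_of_isNilpotent hM).eq_zero
  have := M.aeval_self_charpoly
  rwa [h, map_pow, Polynomial.aeval_X] at this

theorem single_one_mem_matrixGrading {I : Type*} [DecidableEq I] {P : Type*} [Ring P]
    {ℛ : ℤ → AddSubgroup P} (h : 1 ∈ ℛ 0) (δ : I → ℤ) (i : I) :
    Matrix.single i i 1 ∈ matrixGrading ℛ δ 0 := by
  intro p q
  rw [Matrix.single_apply]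
  split_ifs with hi
  · rw [← hi.1, ← hi.2, zero_add, sub_self]; exact h
  · exact zero_mem _

/-- A matrix ring over `P` as a direct factor of the ring `R`: a projection `π` onto it, with a
section `ψ` (which need not preserve `1`) whose image is an ideal. -/
structure MatrixFactor (R : Type*) [Ring R] (I : Type*) [Fintype I] [DecidableEq I]
    (P : Type*) [Ring P] where
  /-- the projection -/
  π : R →+* Matrix I I P
  /-- the section -/
  ψ : Matrix I I P → R
  π_ψ : ∀ X, π (ψ X) = X
  mul_ψ : ∀ x X, x * ψ X = ψ (π x * X)
  ψ_mul : ∀ X x, ψ X * x = ψ (X * π x)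

namespace MatrixFactor

variable {R : Type*} [Ring R] {I : Type*} [Fintype I] [DecidableEq I] {P : Type*} [Ring P]
  (F : MatrixFactor R I P) {𝒜 : ℤ → AddSubgroup R} {ℛ : ℤ → AddSubgroup P} {δ : I → ℤ}

/-- The diagonal matrix units of the factor. -/
def idem (i : I) : R := F.ψ (Matrix.single i i 1)

theorem ψ_mul_ψ (X Y : Matrix I I P) : F.ψ X * F.ψ Y = F.ψ (X * Y) := by rw [mul_ψ, π_ψ]

theorem ψ_zero : F.ψ 0 = 0 := by
  have := F.mul_ψ 0 0
  rwa [zero_mul, map_zero, zero_mul, eq_comm] at this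

theorem idem_mul_self (i : I) : F.idem i * F.idem i = F.idem i := by
  rw [idem, ψ_mul_ψ, Matrix.single_mul_single_same, mul_one]

theorem idem_mul_of_ne {i j : I} (h : i ≠ j) : F.idem i * F.idem j = 0 := by
  rw [idem, idem, ψ_mul_ψ, Matrix.single_mul_single_of_ne (h := h), ψ_zero]

theorem idem_ne_zero [Nontrivial P] (i : I) : F.idem i ≠ 0 := fun h => by
  have h' := congrArg (fun x => F.π x i i) h
  simp [idem, π_ψ] at h'

theorem π_eq_zero_of_mul_idem {x : R} (h : ∀ i, x * F.idem i = 0) : F.π x = 0 := by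
  ext p i
  have := congrArg (fun x => F.π x p i) (h i)
  simpa [idem, π_ψ] using this

theorem π_eq_zero_of_idem_mul {x : R} (h : ∀ i, F.idem i * x = 0) : F.π x = 0 := by
  ext i p
  have := congrArg (fun x => F.π x i p) (h i)
  simpa [idem, π_ψ] using this

/-- Every nonzero homogeneous element of the left ideal `R e`, where `e` is a diagonal matrix unit,
generates it: invert a nonzero entry. -/
theorem exists_mul_eq_idem (hπ : ∀ n x, x ∈ 𝒜 n → F.π x ∈ matrixGrading ℛ δ n)
    (hunit : ∀ d r, r ∈ ℛ d → r ≠ 0 → ∃ s : P, s * r = 1 ∧ r * s = 1) {i : I} {n : ℤ} {x : R}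
    (hx : x ∈ 𝒜 n) (hx0 : x ≠ 0) (h : x * F.idem i = x) : ∃ y, y * x = F.idem i := by
  have hx' : x = F.ψ (F.π x * Matrix.single i i 1) := by rw [← mul_ψ]; exact h.symm
  obtain ⟨p, hp⟩ : ∃ p, F.π x p i ≠ 0 := by
    by_contra! hcon
    refine hx0 (hx'.trans ?_)
    rw [← F.ψ_zero]
    congr 1
    ext p j
    by_cases hj : j = i
    · subst hj; simp [hcon]
    · simp [hj]
  obtain ⟨s, hs, -⟩ := hunit _ _ (hπ n x hx p i) hp
  refine ⟨F.ψ (Matrix.single i p s), ?_⟩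
  rw [hx', ψ_mul_ψ, idem]
  congr 1
  ext q j
  by_cases hj : j = i
  · subst hj
    by_cases hq : q = j
    · subst hq; simp [hs]
    · simp [Ne.symm hq, hq]
  · simp [← Matrix.mul_assoc, hj, Ne.symm hj]

/-- The version of `exists_mul_eq_idem` for right ideals. -/
theorem exists_mul_eq_idem' (hπ : ∀ n x, x ∈ 𝒜 n → F.π x ∈ matrixGrading ℛ δ n)
    (hunit : ∀ d r, r ∈ ℛ d → r ≠ 0 → ∃ s : P, s * r = 1 ∧ r * s = 1) {i : I} {n : ℤ} {x : R}
    (hx : x ∈ 𝒜 n) (hx0 : x ≠ 0) (h : F.idem i * x = x) : ∃ y, x * y = F.idem i := by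
  have hx' : x = F.ψ (Matrix.single i i 1 * F.π x) := by rw [← ψ_mul]; exact h.symm
  obtain ⟨p, hp⟩ : ∃ p, F.π x i p ≠ 0 := by
    by_contra! hcon
    refine hx0 (hx'.trans ?_)
    rw [← F.ψ_zero]
    congr 1
    ext j p
    by_cases hj : j = i
    · subst hj; simp [hcon]
    · simp [hj]
  obtain ⟨s, -, hs⟩ := hunit _ _ (hπ n x hx i p) hp
  refine ⟨F.ψ (Matrix.single p i s), ?_⟩
  rw [hx', ψ_mul_ψ, idem]
  congr 1
  ext j q
  by_cases hj : j = i
  · subst hj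
    by_cases hq : q = j
    · subst hq; simp [hs]
    · simp [Ne.symm hq, hq]
  · simp [Matrix.mul_assoc, hj, Ne.symm hj]

theorem idem_mul_idem_of_π_eq_zero {I' : Type*} [Fintype I'] [DecidableEq I'] {P' : Type*}
    [Ring P'] (F' : MatrixFactor R I' P') {i' : I'} (h : F.π (F'.idem i') = 0) (i : I) :
    F.idem i * F'.idem i' = 0 := by
  rw [idem, ψ_mul, h, mul_zero, ψ_zero]

/-- The factor with index `k` of a ring which is isomorphic to a product of matrix rings, times a
ring `Q`. -/
def ofEquiv {κ : Type*} [DecidableEq κ] {I : κ → Type*} [∀ k, Fintype (I k)]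
    [∀ k, DecidableEq (I k)] {P : κ → Type*} [∀ k, Ring (P k)] {Q : Type*} [Ring Q]
    (φ : R ≃+* ((k : κ) → Matrix (I k) (I k) (P k)) × Q) (k : κ) : MatrixFactor R (I k) (P k) where
  π := ((Pi.evalRingHom _ k).comp (RingHom.fst _ _)).comp φ.toRingHom
  ψ X := φ.symm (Pi.single (M := fun k => Matrix (I k) (I k) (P k)) k X, 0)
  π_ψ X := by
    change (φ (φ.symm _)).1 k = X
    rw [φ.apply_symm_apply]
    exact Pi.single_eq_same (M := fun k => Matrix (I k) (I k) (P k)) k X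
  mul_ψ x X := by
    apply φ.injective
    rw [map_mul, φ.apply_symm_apply, φ.apply_symm_apply]
    refine Prod.ext ?_ (mul_zero _)
    funext k'
    by_cases h : k' = k
    · subst h; simp
    · simp [h]
  ψ_mul X x := by
    apply φ.injective
    rw [map_mul, φ.apply_symm_apply, φ.apply_symm_apply]
    refine Prod.ext ?_ (zero_mul _)
    funext k'
    by_cases h : k' = k
    · subst h; simp
    · simp [h]

theorem map_ofEquiv_idem {κ : Type*} [DecidableEq κ] {I : κ → Type*} [∀ k, Fintype (I k)]
    [∀ k, DecidableEq (I k)] {P : κ → Type*} [∀ k, Ring (P k)] {Q : Type*} [Ring Q]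
    (φ : R ≃+* ((k : κ) → Matrix (I k) (I k) (P k)) × Q) (k : κ) (i : I k) :
    φ ((ofEquiv φ k).idem i) =
      (Pi.single (M := fun k => Matrix (I k) (I k) (P k)) k (Matrix.single i i 1), 0) :=
  φ.apply_symm_apply _

theorem fst_ofEquiv_idem_mem {κ : Type*} [DecidableEq κ] {I : κ → Type*} [∀ k, Fintype (I k)]
    [∀ k, DecidableEq (I k)] {P : κ → Type*} [∀ k, Ring (P k)] {Q : Type*} [Ring Q]
    (φ : R ≃+* ((k : κ) → Matrix (I k) (I k) (P k)) × Q) {ℛ : ∀ k, ℤ → AddSubgroup (P k)}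
    (h : ∀ k, 1 ∈ ℛ k 0) (δ : ∀ k, I k → ℤ) (k : κ) (i : I k) (k' : κ) :
    (φ ((ofEquiv φ k).idem i)).1 k' ∈ matrixGrading (ℛ k') (δ k') 0 := by
  rw [map_ofEquiv_idem]
  by_cases hk : k' = k
  · subst hk
    convert single_one_mem_matrixGrading (h k') (δ k') i
    exact Pi.single_eq_same (M := fun k => Matrix (I k) (I k) (P k)) _ _
  · convert zero_mem (matrixGrading (ℛ k') (δ k') 0)
    exact Pi.single_eq_of_ne (M := fun k => Matrix (I k) (I k) (P k)) hk _

end MatrixFactor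

open DirGraph LeavittPathAlgebra

variable {V : Type uV} {A : Type uA} [Fintype V] [Fintype A] [DecidableEq V]
  {K : Type uK} [Field K] {G : DirGraph V A} {base : G.Cycles → V}

namespace HasGradedMatrixDecomposition

theorem hasBoundedNilpotenceIndex (h : HasGradedMatrixDecomposition K G base) :
    HasBoundedNilpotenceIndex (LeavittPathAlgebra K G) := by
  classical
  obtain ⟨hV, hC, fP, fQ, -, -, φ, -⟩ := h
  cases nonempty_fintype G.Sinks
  cases nonempty_fintype G.Cycles
  let N : ℕ := 1 + ∑ v : G.Sinks, Fintype.card (G.PathTo v.1) +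
    ∑ c : G.Cycles, Fintype.card (G.CyclePathTo c (base c))
  refine ⟨N, by omega, fun x hx => φ.injective ?_⟩
  have hφ : IsNilpotent (φ x) := hx.map φ
  rw [map_pow, map_zero]
  refine Prod.ext (funext fun v => ?_) (funext fun c => ?_)
  · have hn : IsNilpotent ((φ x).1 v) := (hφ.map (RingHom.fst _ _)).map (Pi.evalRingHom _ v)
    have := Finset.single_le_sum (f := fun v : G.Sinks => Fintype.card (G.PathTo v.1))
      (fun _ _ => Nat.zero_le _) (Finset.mem_univ v)
    exact pow_eq_zero_of_le (by omega) (Matrix.pow_card_eq_zero_of_isNilpotent hn)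
  · have hn : IsNilpotent ((φ x).2 c) := (hφ.map (RingHom.snd _ _)).map (Pi.evalRingHom _ c)
    have := Finset.single_le_sum
      (f := fun c : G.Cycles => Fintype.card (G.CyclePathTo c (base c)))
      (fun _ _ => Nat.zero_le _) (Finset.mem_univ c)
    exact pow_eq_zero_of_le (by omega) (Matrix.pow_card_eq_zero_of_isNilpotent hn)

/-- The diagonal matrix units are primitive in a graded sense, on both sides, since the nonzero
homogeneous elements of the coefficient rings are invertible. -/
theorem exists_idempotents (h : HasGradedMatrixDecomposition K G base) :
    ∃ (ι : Type (max uV uA)) (_ : Finite ι) (g : ι → LeavittPathAlgebra K G),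
      (∀ i, g i ∈ grading K G 0) ∧ (∀ i, g i ≠ 0) ∧ (∀ i, g i * g i = g i) ∧
      (∀ i j, i ≠ j → g i * g j = 0) ∧
      (∀ r, (∀ i, r * g i = 0) → r = 0) ∧ (∀ r, (∀ i, g i * r = 0) → r = 0) ∧
      (∀ i n, ∀ x ∈ grading K G n, x ≠ 0 → x * g i = x → ∃ y, y * x = g i) ∧
      (∀ i n, ∀ x ∈ grading K G n, x ≠ 0 → g i * x = x → ∃ y, x * y = g i) := by
  classical
  obtain ⟨hV, hC, fP, fQ, -, -, φ, hφ⟩ := h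
  let ψ := φ.toRingEquiv.trans RingEquiv.prodComm
  let FV := MatrixFactor.ofEquiv φ.toRingEquiv
  let FC := MatrixFactor.ofEquiv ψ
  have hπV : ∀ v n x, x ∈ grading K G n → (FV v).π x ∈
      matrixGrading (trivialGrading K) (fun p : G.PathTo v.1 => (p.1.length : ℤ)) n :=
    fun v n x hx => ((hφ n x).1 hx).1 v
  have hπC : ∀ c n x, x ∈ grading K G n → (FC c).π x ∈
      matrixGrading (laurentPowGrading K c.1.length)
        (fun q : G.CyclePathTo c (base c) => (q.1.1.length : ℤ)) n :=
    fun c n x hx => ((hφ n x).1 hx).2 c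
  have huV : ∀ d r, r ∈ trivialGrading K d → r ≠ 0 → ∃ s, s * r = 1 ∧ r * s = 1 :=
    fun d r _ hr => ⟨r⁻¹, inv_mul_cancel₀ hr, mul_inv_cancel₀ hr⟩
  have huC : ∀ m d r, r ∈ laurentPowGrading K m d → r ≠ 0 → ∃ s, s * r = 1 ∧ r * s = 1 :=
    fun m d r h hr => (exists_mul_eq_one_of_mem_laurentPowGrading h hr).imp fun s hs =>
      ⟨hs, mul_comm s r ▸ hs⟩
  have hgV : ∀ v p, φ ((FV v).idem p) = _ := MatrixFactor.map_ofEquiv_idem φ.toRingEquiv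
  have hgC : ∀ c q, ψ ((FC c).idem q) = _ := MatrixFactor.map_ofEquiv_idem ψ
  have h0 : ∀ x, (∀ v, (FV v).π x = 0) → (∀ c, (FC c).π x = 0) → x = 0 := fun x h1 h2 =>
    φ.injective ((Prod.ext (funext h1) (funext h2)).trans (map_zero φ).symm)
  have hVV : ∀ v v' p, v ≠ v' → (FV v).π ((FV v').idem p) = 0 := fun v v' p hne =>
    (congrFun (congrArg Prod.fst (hgV v' p)) v).trans (Pi.single_eq_of_ne hne _)
  have hCC : ∀ c c' p, c ≠ c' → (FC c).π ((FC c').idem p) = 0 := fun c c' p hne =>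
    (congrFun (congrArg Prod.fst (hgC c' p)) c).trans (Pi.single_eq_of_ne hne _)
  have hVC : ∀ v c p, (FV v).π ((FC c).idem p) = 0 := fun v c p =>
    congrFun (congrArg Prod.snd (hgC c p)) v
  have hCV : ∀ c v p, (FC c).π ((FV v).idem p) = 0 := fun c v p =>
    congrFun (congrArg Prod.snd (hgV v p)) c
  let g : (Σ v : G.Sinks, G.PathTo v.1) ⊕ (Σ c : G.Cycles, G.CyclePathTo c (base c)) →
      LeavittPathAlgebra K G := Sum.elim (fun i => (FV i.1).idem i.2) (fun i => (FC i.1).idem i.2)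
  refine ⟨_, inferInstance, g, ?_, ?_, ?_, ?_, ?_, ?_, ?_, ?_⟩
  · rintro (⟨v, p⟩ | ⟨c, q⟩)
    · refine (hφ 0 _).2 ⟨MatrixFactor.fst_ofEquiv_idem_mem φ.toRingEquiv
        (fun _ => one_mem_trivialGrading K) _ v p, fun c => ?_⟩
      convert AddSubgroup.zero_mem _
      exact hCV c v p
    · refine (hφ 0 _).2 ⟨fun v => ?_, MatrixFactor.fst_ofEquiv_idem_mem ψ
        (fun _ => one_mem_laurentPowGrading) _ c q⟩
      convert AddSubgroup.zero_mem _
      exact hVC v c q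
  · rintro (⟨v, p⟩ | ⟨c, q⟩)
    · exact (FV v).idem_ne_zero p
    · exact (FC c).idem_ne_zero q
  · rintro (⟨v, p⟩ | ⟨c, q⟩)
    · exact (FV v).idem_mul_self p
    · exact (FC c).idem_mul_self q
  · rintro (⟨v, p⟩ | ⟨c, q⟩) (⟨v', p'⟩ | ⟨c', q'⟩) hne
    · by_cases h : v = v'
      · subst h
        exact (FV v).idem_mul_of_ne fun h => hne (congrArg (fun p => Sum.inl (Sigma.mk v p)) h)
      · exact (FV v).idem_mul_idem_of_π_eq_zero _ (hVV v v' p' h) p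
    · exact (FV v).idem_mul_idem_of_π_eq_zero _ (hVC v c' q') p
    · exact (FC c).idem_mul_idem_of_π_eq_zero _ (hCV c v' p') q
    · by_cases h : c = c'
      · subst h
        exact (FC c).idem_mul_of_ne fun h => hne (congrArg (fun q => Sum.inr (Sigma.mk c q)) h)
      · exact (FC c).idem_mul_idem_of_π_eq_zero _ (hCC c c' q' h) q
  · exact fun r hr => h0 r
      (fun v => (FV v).π_eq_zero_of_mul_idem fun p => hr (Sum.inl ⟨v, p⟩))
      (fun c => (FC c).π_eq_zero_of_mul_idem fun q => hr (Sum.inr ⟨c, q⟩))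
  · exact fun r hr => h0 r
      (fun v => (FV v).π_eq_zero_of_idem_mul fun p => hr (Sum.inl ⟨v, p⟩))
      (fun c => (FC c).π_eq_zero_of_idem_mul fun q => hr (Sum.inr ⟨c, q⟩))
  · rintro (⟨v, p⟩ | ⟨c, q⟩) n x hx hx0 hxg
    · exact (FV v).exists_mul_eq_idem (hπV v) huV hx hx0 hxg
    · exact (FC c).exists_mul_eq_idem (hπC c) (huC _) hx hx0 hxg
  · rintro (⟨v, p⟩ | ⟨c, q⟩) n x hx hx0 hxg
    · exact (FV v).exists_mul_eq_idem' (hπV v) huV hx hx0 hxg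
    · exact (FC c).exists_mul_eq_idem' (hπC c) (huC _) hx hx0 hxg

theorem isGradedSemisimpleRing (h : HasGradedMatrixDecomposition K G base) :
    IsGradedSemisimpleRing (grading K G) := by
  obtain ⟨ι, _, g, hg, hg0, hidem, horth, hone, -, hmin, -⟩ := h.exists_idempotents
  exact isGradedSemisimpleRing_of_idempotents isGradedModule_grading g hg hg0 hidem horth hone hmin

theorem isGradedSemisimpleRing_op (h : HasGradedMatrixDecomposition K G base) :
    IsGradedSemisimpleRing (opGrading (grading K G)) := by
  obtain ⟨ι, _, g, hg, hg0, hidem, horth, -, hone, -, hmin⟩ := h.exists_idempotents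
  refine isGradedSemisimpleRing_of_idempotents (isGradedModule_opGrading isGradedModule_grading)
    (fun i => MulOpposite.op (g i)) (fun i => op_mem_opGrading.2 (hg i))
    (fun i hi => hg0 i (MulOpposite.op_injective hi)) (fun i => congrArg MulOpposite.op (hidem i))
    (fun i j hij => congrArg MulOpposite.op (horth j i hij.symm))
    (fun r hr => MulOpposite.unop_injective (hone _ fun i => congrArg MulOpposite.unop (hr i)))
    fun i n x hx hx0 hxg => ?_
  induction x using MulOpposite.rec' with | _ x => ?_
  obtain ⟨y, hy⟩ := hmin i n x (op_mem_opGrading.1 hx) (fun h => hx0 (congrArg MulOpposite.op h))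
    (congrArg MulOpposite.unop hxg)
  exact ⟨MulOpposite.op y, congrArg MulOpposite.op hy⟩

end HasGradedMatrixDecomposition

end Consequences

/-! ### The equivalence -/

theorem theorem4p13 (K : Type*) [Field K] {V A : Type*} [Fintype V] [Fintype A] [DecidableEq V]
    (G : DirGraph V A) (base : G.Cycles → V) (hbase : ∀ c : G.Cycles, base c ∈ c.1.map G.s) :
    List.TFAE [
      -- graded Σ-V ring, left and right
      IsGradedSigmaVRing (LeavittPathAlgebra.grading K G),
      IsGradedSigmaVRing (opGrading (LeavittPathAlgebra.grading K G)),
      -- no cycle has an exit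
      G.NoCycleHasExit,
      -- graded directly-finite, and directly-finite
      IsGradedDirectlyFinite (LeavittPathAlgebra.grading K G) (LeavittPathAlgebra.vertices K G),
      IsDedekindFiniteMonoid (LeavittPathAlgebra K G),
      -- graded direct sum of matrix rings
      HasGradedMatrixDecomposition K G base,
      -- graded semisimple, left and right
      IsGradedSemisimpleRing (LeavittPathAlgebra.grading K G),
      IsGradedSemisimpleRing (opGrading (LeavittPathAlgebra.grading K G)),
      -- bounded index of nilpotence
      HasBoundedNilpotenceIndex (LeavittPathAlgebra K G),
      -- graded self-injective, left and right
      IsGradedSelfInjective (LeavittPathAlgebra.grading K G),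
      IsGradedSelfInjective (opGrading (LeavittPathAlgebra.grading K G))] := by
  have hgr := LeavittPathAlgebra.isGradedModule_grading (K := K) (G := G)
  have hgr' := isGradedModule_opGrading hgr
  tfae_have 3 → 6 := fun h => h.hasGradedMatrixDecomposition base hbase
  tfae_have 6 → 7 := fun h => h.isGradedSemisimpleRing
  tfae_have 6 → 8 := fun h => h.isGradedSemisimpleRing_op
  tfae_have 6 → 9 := fun h => h.hasBoundedNilpotenceIndex
  tfae_have 7 → 1 := fun h _ _ _ _ _ _ _ => h.isGradedInjective hgr _
  tfae_have 8 → 2 := fun h _ _ _ _ _ _ _ => h.isGradedInjective hgr' _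
  tfae_have 7 → 10 := fun h => h.isGradedInjective hgr _
  tfae_have 8 → 11 := fun h => h.isGradedInjective hgr' _
  tfae_have 1 → 3 := LeavittPathAlgebra.noCycleHasExit_of_isGradedSigmaVRing
  tfae_have 2 → 3 := LeavittPathAlgebra.noCycleHasExit_of_isGradedSigmaVRing_op
  tfae_have 10 → 3 := LeavittPathAlgebra.noCycleHasExit_of_isGradedSelfInjective
  tfae_have 11 → 3 := LeavittPathAlgebra.noCycleHasExit_of_isGradedSelfInjective_op
  tfae_have 9 → 5 := fun h => h.isDedekindFiniteMonoid
  tfae_have 5 → 4 := fun h => by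
    refine isGradedDirectlyFinite_of_isDedekindFiniteMonoid _ ?_
    rintro _ ⟨v, rfl⟩
    exact LeavittPathAlgebra.vert_mul_self K G v
  tfae_have 4 → 3 := LeavittPathAlgebra.noCycleHasExit_of_isGradedDirectlyFinite
  tfae_finish
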